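/- Consider the two-dimensional pressureless gas dynamics system $$\varrho_t+(\varrho u)_x+(\varrho v)_y=0,\qquad (\varrho u)_t+(\varrho u^2)_x+(\varrho uv)_y=0,\qquad (\varrho v)_t+(\varrho uv)_x+(\varrho v^2)_y=0 .\tag{1}$$ **Generalized solutions.** A generalized solution is a family of Radon measures $(P_t,I_t,J_t)_{t>0}$ on $\mathbb R^2$, weakly continuous in $t$ (tested against continuous functions of compact support), with $P_t\ge 0$ and $I_t,J_t$ signed and absolutely continuous with respect to $P_t$ for almost every $t$, such that, with $\mathbf u=dI_t/dP_t$, $\mathbf v=dJ_t/dP_t$, for all $f,g,h\in C^1_0(\mathbb R^2)$ and $0<t_1<t_2$ (all integrals existing) $$\int f\,dP_{t_2}-\int f\,dP_{t_1}=\int_{t_1}^{t_2}\Bigl(\int f_x\,dI_\tau+\int f_y\,dJ_\tau\Bigr)d\tau,$$ $$\int g\,dI_{t_2}-\int g\,dI_{t_1}=\int_{t_1}^{t_2}\Bigl(\int g_x\mathbf u\,dI_\tau+\int g_y\mathbf v\,dI_\tau\Bigr)d\tau,\qquad \int h\,dJ_{t_2}-\int h\,dJ_{t_1}=\int_{t_1}^{t_2}\Bigl(\int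 h_x\mathbf u\,dJ_\tau+\int h_y\mathbf v\,dJ_\tau\Bigr)d\tau,$$ and such that $P_t,I_t,J_t$ tend weakly to the given initial mass and momenta as $t\to+0$. **Data.** Let $\varrho,\tilde\varrho>0$ and $u,v\in\mathbb R$ be constants. Let $l\mapsto(x_0(l),y_0(l))$, $l\in\mathbb R$, be a $C^1$ curve whose image is the zero set of a function $\Phi\in C^1(\mathbb R^2)$, where $\Phi<0$ just behind and $\Phi>0$ just ahead of the curve with respect to the direction $(u,v)$ (for each $l$ and all small $\varepsilon>0$, $\Phi<0$ at $(x_0(l)-\varepsilon u,y_0(l)-\varepsilon v)$ and $\Phi>0$ at $(x_0(l)+\varepsilon u,y_0(l)+\varepsilon v)$), and suppose $$G(l):=u\,y_0'(l)-v\,x_0'(l)>0\quad\text{for all } l.$$ Let $P_0\ge 0$ and $\hat k_0$ be continuous functions of $l$ with $0<\hat k_0(l)<1$ (the stability condition). The initial data are: density $\varrho$ and velocity $(u,v)$ in $\{\Phi<0\}$; density $\tilde\varrho$ and velocity $(0,0)$ in $\{\Phi>0\}$; and, on the curve, mass $P_0(l)\,dl$ and momentum $\hat k_0(l)P_0(l)(u,v)\,dl$.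 (For $P_0\equiv0$ these are the piecewise constant data without initial mass on the curve.) **Theorem.** There are functions $P(t,l)$, $\hat k(t,l)$, $t\ge0$, with $P(0,l)=P_0(l)$, with $\hat k(0,l)=\hat k_0(l)$ where $P_0(l)>0$, and with $P>0$ for $t>0$, such that, with $$K(t,l)=\int_0^t\hat k(\tau,l)\,d\tau,\qquad x(t,l)=x_0(l)+uK(t,l),\qquad y(t,l)=y_0(l)+vK(t,l),$$ the following hold. 1. (Reduced ODE and its explicit solution.) For $t>0$, $$\dot P+G\{\hat k(\varrho-\tilde\varrho)-\varrho\}=0,\qquad (P\hat k)^{\textstyle\cdot}+\varrho G\{\hat k-1\}=0,$$ and $$P^2=P_0^2-2GP_0Nt+\varrho\tilde\varrho G^2t^2,\qquad N=\hat k_0(\varrho-\tilde\varrho)-\varrho,$$ $$\hat k(\varrho-\tilde\varrho)=\varrho-\dot P/G,\qquad K=\frac{t\,(2P_0\hat k_0+\varrho Gt)}{P_0+\varrho Gt+P}.$$ The functions $P$, $P\hat k$, $x$, $y$ are continuous on $[0,\infty)\times\mathbb R$, and they are $C^1$ on $(0,\infty)\times\mathbb R$ if $G,P_0,\hat k_0$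 are $C^1$. 2. (Shock-internal system.) Put $I=P\hat ku$, $J=P\hat kv$. At every $(t,l)$ with $t>0$ at which $x_l,y_l$ exist, $(P,I,J,x,y)$ satisfies, with $U=I/P$, $V=J/P$, $$\dot P+(\varrho-\tilde\varrho)\{y_lU-x_lV\}-\varrho\{y_lu-x_lv\}=0,$$ $$\dot I+\varrho u\{y_lU-x_lV\}-\varrho u\{y_lu-x_lv\}=0,\qquad \dot J+\varrho v\{y_lU-x_lV\}-\varrho v\{y_lu-x_lv\}=0,$$ $$\dot x=U,\qquad \dot y=V .$$ Conversely, every solution of this system for all $t>0$, $l\in\mathbb R$ with positive mass density that tends to the data $(P_0,\hat k_0P_0u,\hat k_0P_0v,x_0,y_0)$ as $t\to+0$ for each $l$ coincides with $(P,I,J,x,y)$. 3. (Stability.) $0<K(t,l)<t$ for all $t>0$ and all $l$. 4. (Existence.) There is a generalized solution of (1) with the initial data above, and it has the following form: there is a $C^1$ function $S$ on $[0,\infty)\times\mathbb R^2$ such that $\{S(t,\cdot)=0\}$ is the front $\{(x(t,l),y(t,l)):l\in\mathbb R\}$ for every $t\ge0$, $S(0,\cdot)$ has the sign of $\Phi$,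 and for $t>0$ the density and velocity are $\varrho$, $(u,v)$ where $S<0$ and $\tilde\varrho$, $(0,0)$ where $S>0$, while the front carries the mass $P(t,l)\,dl$ and the momentum $(I,J)(t,l)\,dl$. 5. (Asymptotics.) For $t>0$, $\dot x=\hat ku$ and $\dot y=\hat kv$, and for each $l$, as $t\to+\infty$, $$\hat k(t,l)\to\varkappa:=\frac{\sqrt\varrho}{\sqrt\varrho+\sqrt{\tilde\varrho}},$$ $$\bigl(x(t,l),y(t,l)\bigr)-\bigl(x_0(l)+\varkappa ut,\;y_0(l)+\varkappa vt\bigr)\;\longrightarrow\;\frac{P_0(l)\,(\hat k_0(l)-\varkappa)}{\sqrt{\varrho\tilde\varrho}\;G(l)}\,(u,v).$$ So the front moves as $(x_0+\varkappa ut,\,y_0+\varkappa vt)$ up to a bounded displacement. If $P_0(l)=0$, then $x(t,l)=x_0(l)+\varkappa ut$ and $y(t,l)=y_0(l)+\varkappa vt$ exactly, for all $t\ge0$. -/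

import Mathlib

open MeasureTheory Set Filter Topology

noncomputable section

/-- A signed Radon measure on the plane, given by its Jordan decomposition: two mutually singular
positive Borel measures that are finite on compact sets (its total mass may be infinite). -/
structure SignedRadon where
  pos : Measure (ℝ × ℝ)
  neg : Measure (ℝ × ℝ)
  finite_pos : IsFiniteMeasureOnCompacts pos
  finite_neg : IsFiniteMeasureOnCompacts neg
  mutuallySingular : pos ⟂ₘ neg

namespace SignedRadon

/-- The integral of `f` against the signed measure. -/
def integral (M : SignedRadon) (f : ℝ × ℝ → ℝ) : ℝ :=
  (∫ X, f X ∂M.pos) - ∫ X, f X ∂M.neg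

/-- The total variation measure. -/
def variation (M : SignedRadon) : Measure (ℝ × ℝ) := M.pos + M.neg

/-- Absolute continuity with respect to a positive measure. -/
def AbsCont (M : SignedRadon) (P : Measure (ℝ × ℝ)) : Prop := M.variation ≪ P

/-- The Radon-Nikodym derivative `dM/dP`. -/
def density (M : SignedRadon) (P : Measure (ℝ × ℝ)) (X : ℝ × ℝ) : ℝ :=
  (M.pos.rnDeriv P X).toReal - (M.neg.rnDeriv P X).toReal

end SignedRadon

/-- `∂f/∂x`. -/
def partialX (f : ℝ × ℝ → ℝ) (X : ℝ × ℝ) : ℝ := fderiv ℝ f X (1, 0)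

/-- `∂f/∂y`. -/
def partialY (f : ℝ × ℝ → ℝ) (X : ℝ × ℝ) : ℝ := fderiv ℝ f X (0, 1)

/-- Continuous test functions with compact support. -/
def IsTestFunction (φ : ℝ × ℝ → ℝ) : Prop := Continuous φ ∧ HasCompactSupport φ

/-- Continuously differentiable test functions with compact support. -/
def IsC1TestFunction (f : ℝ × ℝ → ℝ) : Prop := ContDiff ℝ 1 f ∧ HasCompactSupport f

/-- Generalized (measure-valued) solutions of the two-dimensional pressureless gas dynamics system
`ϱ_t + (ϱu)_x + (ϱv)_y = 0`, `(ϱu)_t + (ϱu²)_x + (ϱuv)_y = 0`, `(ϱv)_t + (ϱuv)_x + (ϱv²)_y = 0`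
for `t > 0`: `P t` is the mass, `I t` and `J t` are the two components of the momentum, and the
velocity is `(u, v) = (dI/dP, dJ/dP)`.  The initial mass and momentum are the functionals
`p₀`, `i₀`, `j₀` on test functions.  The integrals that occur are required to exist. -/
structure IsGeneralizedSolution (P : ℝ → Measure (ℝ × ℝ)) (I J : ℝ → SignedRadon)
    (p₀ i₀ j₀ : (ℝ × ℝ → ℝ) → ℝ) : Prop where
  radon : ∀ t > 0, IsFiniteMeasureOnCompacts (P t)
  weakly_continuous : ∀ φ, IsTestFunction φ →
    ContinuousOn (fun t => ∫ X, φ X ∂(P t)) (Ioi 0) ∧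
    ContinuousOn (fun t => (I t).integral φ) (Ioi 0) ∧
    ContinuousOn (fun t => (J t).integral φ) (Ioi 0)
  abs_cont : ∀ᵐ t ∂(volume.restrict (Ioi (0 : ℝ))), (I t).AbsCont (P t) ∧ (J t).AbsCont (P t)
  locally_integrable : ∀ᵐ t ∂(volume.restrict (Ioi (0 : ℝ))),
    LocallyIntegrable ((I t).density (P t)) ((I t).variation) ∧
    LocallyIntegrable ((J t).density (P t)) ((I t).variation) ∧
    LocallyIntegrable ((I t).density (P t)) ((J t).variation) ∧
    LocallyIntegrable ((J t).density (P t)) ((J t).variation)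
  mass : ∀ f, IsC1TestFunction f → ∀ t₁ t₂ : ℝ, 0 < t₁ → t₁ < t₂ →
    IntervalIntegrable (fun τ => (I τ).integral (partialX f) + (J τ).integral (partialY f))
      volume t₁ t₂ ∧
    (∫ X, f X ∂(P t₂)) - ∫ X, f X ∂(P t₁) =
      ∫ τ in t₁..t₂, ((I τ).integral (partialX f) + (J τ).integral (partialY f))
  momentum_x : ∀ g, IsC1TestFunction g → ∀ t₁ t₂ : ℝ, 0 < t₁ → t₁ < t₂ →
    IntervalIntegrable
      (fun τ => (I τ).integral (fun X => partialX g X * (I τ).density (P τ) X) +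
        (I τ).integral (fun X => partialY g X * (J τ).density (P τ) X)) volume t₁ t₂ ∧
    (I t₂).integral g - (I t₁).integral g =
      ∫ τ in t₁..t₂, ((I τ).integral (fun X => partialX g X * (I τ).density (P τ) X) +
        (I τ).integral (fun X => partialY g X * (J τ).density (P τ) X))
  momentum_y : ∀ h, IsC1TestFunction h → ∀ t₁ t₂ : ℝ, 0 < t₁ → t₁ < t₂ →
    IntervalIntegrable
      (fun τ => (J τ).integral (fun X => partialX h X * (I τ).density (P τ) X) +
        (J τ).integral (fun X => partialY h X * (J τ).density (P τ) X)) volume t₁ t₂ ∧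
    (J t₂).integral h - (J t₁).integral h =
      ∫ τ in t₁..t₂, ((J τ).integral (fun X => partialX h X * (I τ).density (P τ) X) +
        (J τ).integral (fun X => partialY h X * (J τ).density (P τ) X))
  initial : ∀ φ, IsTestFunction φ →
    Tendsto (fun t => ∫ X, φ X ∂(P t)) (𝓝[>] 0) (𝓝 (p₀ φ)) ∧
    Tendsto (fun t => (I t).integral φ) (𝓝[>] 0) (𝓝 (i₀ φ)) ∧
    Tendsto (fun t => (J t).integral φ) (𝓝[>] 0) (𝓝 (j₀ φ))

/-- The Heaviside function. -/
def heavisideStep (θ : ℝ) : ℝ := if 0 < θ then 1 else 0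

/-- The field with constant values `cm` where `S < 0` and `cp` where `S > 0`. -/
def jumpField (cm cp : ℝ) (S : ℝ × ℝ → ℝ) (X : ℝ × ℝ) : ℝ :=
  cm + (cp - cm) * heavisideStep (S X)

/-- The distribution `cm + (cp - cm) H(S) + d δ`, where the last term is the mass with density
`d(l) dl` carried by the curve `l ↦ Γ(l)`. -/
def jumpDelta (cm cp : ℝ) (S : ℝ × ℝ → ℝ) (Γ : ℝ → ℝ × ℝ) (d : ℝ → ℝ)
    (φ : ℝ × ℝ → ℝ) : ℝ :=
  (∫ X, φ X * jumpField cm cp S X) + ∫ l, φ (Γ l) * d l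

/-- The shock-internal system at the point `(t, l)` for constant external states
`(ϱm, um, vm)` and `(ϱp, up, vp)`; the unknown functions of `(t, l)` are the mass density `P` and
momentum densities `I`, `J` along the front and its position `(x, y)`. -/
def InternalSystemAt (ϱm um vm ϱp up vp : ℝ) (P I J x y : ℝ → ℝ → ℝ) (t l : ℝ) : Prop :=
  ∃ xl yl : ℝ, HasDerivAt (fun l' => x t l') xl l ∧ HasDerivAt (fun l' => y t l') yl l ∧
    ∃ U V dP dI dJ : ℝ, U = I t l / P t l ∧ V = J t l / P t l ∧
      HasDerivAt (fun τ => P τ l) dP t ∧ HasDerivAt (fun τ => I τ l) dI t ∧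
      HasDerivAt (fun τ => J τ l) dJ t ∧
      HasDerivAt (fun τ => x τ l) U t ∧ HasDerivAt (fun τ => y τ l) V t ∧
      dP + xl * (V * (ϱp - ϱm) - (ϱp * vp - ϱm * vm))
        + yl * ((ϱp * up - ϱm * um) - U * (ϱp - ϱm)) = 0 ∧
      dI + xl * (V * (ϱp * up - ϱm * um) - (ϱp * up * vp - ϱm * um * vm))
        + yl * ((ϱp * up ^ 2 - ϱm * um ^ 2) - U * (ϱp * up - ϱm * um)) = 0 ∧
      dJ + xl * (V * (ϱp * vp - ϱm * vm) - (ϱp * vp ^ 2 - ϱm * vm ^ 2))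
        + yl * ((ϱp * up * vp - ϱm * um * vm) - U * (ϱp * vp - ϱm * vm)) = 0

/-- `G(l) = u y₀'(l) - v x₀'(l)`. -/
def crossSpeed (u v : ℝ) (x₀ y₀ : ℝ → ℝ) (l : ℝ) : ℝ := u * deriv y₀ l - v * deriv x₀ l

/-- `ϰ = √ϱ / (√ϱ + √ϱ̃)`, with `ϱ` behind the front and `ϱ̃` ahead of it. -/
def limitRatio (ϱ ϱ' : ℝ) : ℝ := √ϱ / (√ϱ + √ϱ')

/-- A coordinate at time `t` of a front point that starts at `z₀(l)` and moves with speed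
`c k(t, l)`. -/
def frontCoord (c : ℝ) (z₀ : ℝ → ℝ) (k : ℝ → ℝ → ℝ) (t l : ℝ) : ℝ :=
  z₀ l + c * ∫ τ in (0 : ℝ)..t, k τ l

end

/-!
A front point with label `l` moves on the line through its initial position in the direction
`(u, v)`, by a displacement `K(t, l)` with `K̇ = k`. On these lines the problem is one-dimensional:
since `u y - v x` does not change along the motion, `u y_l - v x_l` keeps its initial value `G`
wherever these derivatives exist, and the shock-internal system becomes the
ordinary differential equation for `P` and `k`. Its mass and momentum balances can be integrated
to `P = P₀ + ϱ G t - (ϱ - ϱ̃) G K` and `P k = P₀ k₀ + ϱ G (t - K)`; with `k = K̇` the second one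
is integrable once more and gives a quadratic equation for `K`. The choice of the root is forced
by `P > 0`, which yields the explicit formulas (`frontMass`, `frontDisp`, `frontRatio`),
uniqueness (`reduced_unique`, `InternalSystemAt.unique`) and the asymptotics
(`tendsto_frontDisp_sub`).

The initial front is the graph of a function over an open interval of the transversal coordinate
`u y - v x`, and on each line that meets it `Φ` is negative behind the front and positive ahead of
it. `movedLevel` transports `Φ` along these lines with the displacement `K` and keeps it on the
other lines, where `Φ` has constant sign. As `0 ≤ K ≤ t`, the regions where `movedLevel` is
positive or negative are open in space-time, so there are smooth nonnegative functions with
exactly these supports, and their difference is the level function `S` (`exists_contDiff_level`).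
The bound on `K` also makes the moving front proper, hence its mass locally finite.

The candidate for the generalized solution consists of `frontMeasure` and of its multiples by
`u θ` and `v θ`, where the ratio `θ` is `1` behind the front, `0` ahead of it and `k` on it
(`velocityRatio`). Fubini's theorem along the lines (`integral_eq_integral_lines`) expresses the
integral of a test function as a constant plus an integral over the label, whose integrand is
differentiable in time although the front is only continuous in `l` (`jumpDelta_movedLevel`,
`hasDerivAt_frontIntegrand`). Its time derivative is the flux, because the divergence theorem
behind the front also holds line by line (`integral_dirDeriv_behind`). Integration in time and
Fubini's theorem give all three weak equations at once (`jumpDelta_sub_eq_integral`).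
-/

noncomputable section

/-! ### The reduced ordinary differential equation -/

/-- The mass density `P` carried by a front point after time `t`.  Here `a = ϱ G`, `b = ϱ̃ G`, and
`p`, `m` are the initial values of the mass density and of the velocity ratio. -/
def frontMass (a b p m t : ℝ) : ℝ :=
  √(p ^ 2 + 2 * p * (a * (1 - m) + b * m) * t + a * b * t ^ 2)

/-- The displacement `K` of a front point along the velocity `(u, v)` after time `t`. -/
def frontDisp (a b p m t : ℝ) : ℝ :=
  t * (2 * p * m + a * t) / (p + a * t + frontMass a b p m t)

/-- The ratio `k` of the velocity of a front point to `(u, v)`.  Its numerator is the momentum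
`p m + a (t - K)` collected up to time `t`. -/
def frontRatio (a b p m t : ℝ) : ℝ :=
  (p * m + a * (t - frontDisp a b p m t)) / frontMass a b p m t

section Scalar

variable {a b p m : ℝ}

lemma frontMass_sq (ha : 0 < a) (hb : 0 < b) (hp : 0 ≤ p) (hm : 0 < m ∧ m < 1) {t : ℝ}
    (ht : 0 ≤ t) :
    frontMass a b p m t ^ 2 = p ^ 2 + 2 * p * (a * (1 - m) + b * m) * t + a * b * t ^ 2 := by
  have h1 : 0 ≤ 1 - m := by linarith [hm.2]
  have h2 := hm.1.le
  exact Real.sq_sqrt (by positivity)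

lemma frontMass_nonneg (t : ℝ) : 0 ≤ frontMass a b p m t := Real.sqrt_nonneg _

lemma frontMass_radicand_pos (ha : 0 < a) (hb : 0 < b) (hp : 0 ≤ p) (hm : 0 < m ∧ m < 1) {t : ℝ}
    (ht : 0 < t) : 0 < p ^ 2 + 2 * p * (a * (1 - m) + b * m) * t + a * b * t ^ 2 := by
  have h1 : 0 ≤ 1 - m := by linarith [hm.2]
  have h2 := hm.1.le
  positivity

lemma frontMass_pos (ha : 0 < a) (hb : 0 < b) (hp : 0 ≤ p) (hm : 0 < m ∧ m < 1) {t : ℝ}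
    (ht : 0 < t) : 0 < frontMass a b p m t :=
  Real.sqrt_pos.2 (frontMass_radicand_pos ha hb hp hm ht)

lemma frontMass_zero (hp : 0 ≤ p) : frontMass a b p m 0 = p := by
  simp [frontMass, Real.sqrt_sq hp]

lemma frontDisp_zero : frontDisp a b p m 0 = 0 := by simp [frontDisp]

lemma frontDisp_denom_pos (ha : 0 < a) (hp : 0 ≤ p) {t : ℝ} (ht : 0 < t) :
    0 < p + a * t + frontMass a b p m t := by
  have := frontMass_nonneg (a := a) (b := b) (p := p) (m := m) t
  positivity

lemma frontDisp_mul (ha : 0 < a) (hp : 0 ≤ p) {t : ℝ} (ht : 0 ≤ t) :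
    frontDisp a b p m t * (p + a * t + frontMass a b p m t) = t * (2 * p * m + a * t) := by
  rcases ht.eq_or_lt with rfl | ht
  · simp [frontDisp]
  · exact div_mul_cancel₀ _ (frontDisp_denom_pos ha hp ht).ne'

/-- The integrated mass balance: the front gains `a (t - K)` from behind and `b K` from ahead. -/
lemma frontMass_eq (ha : 0 < a) (hb : 0 < b) (hp : 0 ≤ p) (hm : 0 < m ∧ m < 1) {t : ℝ}
    (ht : 0 ≤ t) :
    frontMass a b p m t = p + a * t - (a - b) * frontDisp a b p m t := by
  rcases ht.eq_or_lt with rfl | ht'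
  · simp [frontDisp_zero, frontMass_zero hp]
  · have hD := frontDisp_denom_pos (b := b) (m := m) ha hp ht'
    have h1 := frontDisp_mul (b := b) (m := m) ha hp ht
    have h2 := frontMass_sq ha hb hp hm ht
    refine mul_right_cancel₀ hD.ne' ?_
    linear_combination h2 + (a - b) * h1

lemma frontDisp_pos (ha : 0 < a) (hp : 0 ≤ p) (hm : 0 < m ∧ m < 1) {t : ℝ}
    (ht : 0 < t) : 0 < frontDisp a b p m t := by
  have h2 := hm.1
  exact div_pos (by positivity) (frontDisp_denom_pos ha hp ht)

lemma frontDisp_lt (ha : 0 < a) (hb : 0 < b) (hp : 0 ≤ p) (hm : 0 < m ∧ m < 1) {t : ℝ}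
    (ht : 0 < t) : frontDisp a b p m t < t := by
  rw [frontDisp, div_lt_iff₀ (frontDisp_denom_pos ha hp ht)]
  have h1 : 0 < 1 - m := by linarith [hm.2]
  have h2 := hm.1
  have key : p * (2 * m - 1) < frontMass a b p m t := by
    refine lt_of_pow_lt_pow_left₀ 2 (frontMass_nonneg t) ?_
    rw [frontMass_sq ha hb hp hm ht.le]
    have : 0 < 4 * p ^ 2 * (m * (1 - m)) + 2 * p * (a * (1 - m) + b * m) * t + a * b * t ^ 2 := by
      positivity
    nlinarith
  nlinarith

lemma frontDisp_nonneg (ha : 0 < a) (hp : 0 ≤ p) (hm : 0 < m ∧ m < 1) {t : ℝ}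
    (ht : 0 ≤ t) : 0 ≤ frontDisp a b p m t := by
  rcases ht.eq_or_lt with rfl | ht
  · rw [frontDisp_zero]
  · exact (frontDisp_pos ha hp hm ht).le

lemma frontDisp_le (ha : 0 < a) (hb : 0 < b) (hp : 0 ≤ p) (hm : 0 < m ∧ m < 1) {t : ℝ}
    (ht : 0 ≤ t) : frontDisp a b p m t ≤ t := by
  rcases ht.eq_or_lt with rfl | ht
  · rw [frontDisp_zero]
  · exact (frontDisp_lt ha hb hp hm ht).le

lemma frontMass_mul_frontRatio (ha : 0 < a) (hb : 0 < b) (hp : 0 ≤ p) (hm : 0 < m ∧ m < 1) {t : ℝ}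
    (ht : 0 ≤ t) : frontMass a b p m t * frontRatio a b p m t =
      p * m + a * (t - frontDisp a b p m t) := by
  rcases ht.eq_or_lt with rfl | ht
  · rcases hp.eq_or_lt with rfl | hp
    · simp [frontRatio, frontDisp_zero]
    · rw [frontRatio, mul_div_cancel₀]
      rw [frontMass_zero hp.le]; exact hp.ne'
  · rw [frontRatio, mul_div_cancel₀ _ (frontMass_pos ha hb hp hm ht).ne']

lemma frontRatio_zero (hp : 0 < p) : frontRatio a b p m 0 = m := by
  rw [frontRatio, frontDisp_zero, frontMass_zero hp.le]
  field_simp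
  ring

lemma frontRatio_nonneg (ha : 0 < a) (hb : 0 < b) (hp : 0 ≤ p) (hm : 0 < m ∧ m < 1) {t : ℝ}
    (ht : 0 ≤ t) : 0 ≤ frontRatio a b p m t := by
  refine div_nonneg ?_ (frontMass_nonneg t)
  have h1 := sub_nonneg.2 (frontDisp_le ha hb hp hm ht)
  have h2 := hm.1.le
  positivity

lemma frontRatio_le_one (ha : 0 < a) (hb : 0 < b) (hp : 0 ≤ p) (hm : 0 < m ∧ m < 1) {t : ℝ}
    (ht : 0 ≤ t) : frontRatio a b p m t ≤ 1 := by
  refine div_le_one_of_le₀ ?_ (frontMass_nonneg t)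
  rw [frontMass_eq ha hb hp hm ht]
  have h1 := mul_nonneg hb.le (frontDisp_nonneg (b := b) ha hp hm ht)
  have h2 := mul_nonneg hp (sub_nonneg.2 hm.2.le)
  linarith

lemma hasDerivAt_frontDisp (ha : 0 < a) (hb : 0 < b) (hp : 0 ≤ p) (hm : 0 < m ∧ m < 1) {t : ℝ}
    (ht : 0 < t) : HasDerivAt (frontDisp a b p m) (frontRatio a b p m t) t := by
  have hP := frontMass_pos ha hb hp hm ht
  have hD := frontDisp_denom_pos (b := b) (m := m) ha hp ht
  have hsq := frontMass_sq ha hb hp hm ht.le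
  have hid := hasDerivAt_id' t
  have h1 : HasDerivAt (fun t => p ^ 2 + 2 * p * (a * (1 - m) + b * m) * t + a * b * t ^ 2)
      (2 * (p * (a * (1 - m) + b * m) + a * b * t)) t := by
    refine (((hid.const_mul (2 * p * (a * (1 - m) + b * m))).const_add (p ^ 2)).add
      ((hid.pow 2).const_mul (a * b))).congr_deriv ?_
    push_cast; ring
  have h2 : HasDerivAt (frontMass a b p m)
      ((p * (a * (1 - m) + b * m) + a * b * t) / frontMass a b p m t) t := by
    refine (h1.sqrt (frontMass_radicand_pos ha hb hp hm ht).ne').congr_deriv ?_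
    rw [mul_div_mul_left _ _ two_ne_zero, frontMass]
  have h3 : HasDerivAt (fun t => p + a * t + frontMass a b p m t)
      (a + (p * (a * (1 - m) + b * m) + a * b * t) / frontMass a b p m t) t := by
    refine (((hid.const_mul a).const_add p).add h2).congr_deriv ?_
    ring
  have h4 : HasDerivAt (fun t => t * (2 * p * m + a * t)) (2 * (p * m + a * t)) t := by
    refine (hid.mul ((hid.const_mul a).const_add (2 * p * m))).congr_deriv ?_
    ring
  refine (h4.div h3 hD.ne').congr_deriv ?_
  symm
  rw [frontRatio, frontDisp]
  generalize frontMass a b p m t = P at *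
  have e1 : (p * m + a * (t - t * (2 * p * m + a * t) / (p + a * t + P))) / P =
      ((p * m + a * t) * (p + a * t + P) - a * (t * (2 * p * m + a * t))) /
        (P * (p + a * t + P)) := by
    field_simp
    ring
  have e2 : a + (p * (a * (1 - m) + b * m) + a * b * t) / P =
      (a * P + (p * (a * (1 - m) + b * m) + a * b * t)) / P := by
    field_simp
  have e3 : 2 * (p * m + a * t) * (p + a * t + P) - t * (2 * p * m + a * t) *
      ((a * P + (p * (a * (1 - m) + b * m) + a * b * t)) / P) =
      (2 * (p * m + a * t) * (p + a * t + P) * P - t * (2 * p * m + a * t) *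
        (a * P + (p * (a * (1 - m) + b * m) + a * b * t))) / P := by
    field_simp
  -- after clearing denominators the two sides differ by a multiple of the formula for `P ^ 2`
  rw [e1, e2, e3, div_div, div_eq_div_iff (by positivity) (by positivity)]
  linear_combination (-(p + a * t + P) * (p * m + a * t) * P) * hsq

lemma hasDerivAt_frontMass (ha : 0 < a) (hb : 0 < b) (hp : 0 ≤ p) (hm : 0 < m ∧ m < 1) {t : ℝ}
    (ht : 0 < t) :
    HasDerivAt (frontMass a b p m) (a - (a - b) * frontRatio a b p m t) t := by
  have h := (((hasDerivAt_id' t).const_mul a).const_add p).sub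
    ((hasDerivAt_frontDisp ha hb hp hm ht).const_mul (a - b))
  rw [mul_one] at h
  refine h.congr_of_eventuallyEq ?_
  filter_upwards [Ioi_mem_nhds ht] with s hs
  exact frontMass_eq ha hb hp hm (le_of_lt hs)

lemma hasDerivAt_frontMomentum (ha : 0 < a) (hb : 0 < b) (hp : 0 ≤ p) (hm : 0 < m ∧ m < 1) {t : ℝ}
    (ht : 0 < t) :
    HasDerivAt (fun t => frontMass a b p m t * frontRatio a b p m t)
      (a * (1 - frontRatio a b p m t)) t := by
  have h := (((hasDerivAt_id' t).sub (hasDerivAt_frontDisp ha hb hp hm ht)).const_mul a).const_add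
    (p * m)
  refine h.congr_of_eventuallyEq ?_
  filter_upwards [Ioi_mem_nhds ht] with s hs
  exact frontMass_mul_frontRatio ha hb hp hm (le_of_lt hs)

section Continuity

variable {Z : Type*} [TopologicalSpace Z] {α β π μ τ : Z → ℝ}

lemma Continuous.frontMass (hα : Continuous α) (hβ : Continuous β) (hπ : Continuous π)
    (hμ : Continuous μ) (hτ : Continuous τ) :
    Continuous fun z => frontMass (α z) (β z) (π z) (μ z) (τ z) := by
  unfold _root_.frontMass; fun_prop

/-- The quotient defining `frontDisp` degenerates where both the initial mass and the time vanish;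
the bounds `0 ≤ K ≤ t` give continuity there. -/
lemma Continuous.frontDisp (hα : Continuous α) (hβ : Continuous β) (hπ : Continuous π)
    (hμ : Continuous μ) (hτ : Continuous τ) (pα : ∀ z, 0 < α z) (pβ : ∀ z, 0 < β z)
    (pπ : ∀ z, 0 ≤ π z) (pμ : ∀ z, 0 < μ z ∧ μ z < 1) (pτ : ∀ z, 0 ≤ τ z) :
    Continuous fun z => frontDisp (α z) (β z) (π z) (μ z) (τ z) := by
  have hM := Continuous.frontMass hα hβ hπ hμ hτ
  refine continuous_iff_continuousAt.2 fun z => ?_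
  by_cases hz : π z + α z * τ z + _root_.frontMass (α z) (β z) (π z) (μ z) (τ z) = 0
  · have h1 : τ z = 0 := by
      have := frontMass_nonneg (a := α z) (b := β z) (p := π z) (m := μ z) (τ z)
      have h2 := mul_nonneg (pα z).le (pτ z)
      have h3 : α z * τ z = 0 := by linarith [pπ z]
      exact (mul_eq_zero.1 h3).resolve_left (pα z).ne'
    have h2 : _root_.frontDisp (α z) (β z) (π z) (μ z) (τ z) = 0 := by rw [h1, frontDisp_zero]
    rw [ContinuousAt, h2]
    have h3 : Tendsto τ (𝓝 z) (𝓝 0) := by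
      have := hτ.tendsto z
      rwa [h1] at this
    exact tendsto_of_tendsto_of_tendsto_of_le_of_le tendsto_const_nhds h3
      (fun y => frontDisp_nonneg (pα y) (pπ y) (pμ y) (pτ y))
      (fun y => frontDisp_le (pα y) (pβ y) (pπ y) (pμ y) (pτ y))
  · unfold _root_.frontDisp
    exact ContinuousAt.div (by fun_prop) (by fun_prop) hz

lemma continuousOn_frontRatio (hα : Continuous α) (hβ : Continuous β) (hπ : Continuous π)
    (hμ : Continuous μ) (hτ : Continuous τ) (pα : ∀ z, 0 < α z) (pβ : ∀ z, 0 < β z)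
    (pπ : ∀ z, 0 ≤ π z) (pμ : ∀ z, 0 < μ z ∧ μ z < 1) (pτ : ∀ z, 0 ≤ τ z) :
    ContinuousOn (fun z => frontRatio (α z) (β z) (π z) (μ z) (τ z)) {z | 0 < τ z} := by
  have hM := Continuous.frontMass hα hβ hπ hμ hτ
  have hD := Continuous.frontDisp hα hβ hπ hμ hτ pα pβ pπ pμ pτ
  unfold frontRatio
  exact ContinuousOn.div (by fun_prop) hM.continuousOn
    fun z hz => (frontMass_pos (pα z) (pβ z) (pπ z) (pμ z) hz).ne'

lemma Continuous.frontMomentum (hα : Continuous α) (hβ : Continuous β) (hπ : Continuous π)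
    (hμ : Continuous μ) (hτ : Continuous τ) (pα : ∀ z, 0 < α z) (pβ : ∀ z, 0 < β z)
    (pπ : ∀ z, 0 ≤ π z) (pμ : ∀ z, 0 < μ z ∧ μ z < 1) (pτ : ∀ z, 0 ≤ τ z) :
    Continuous fun z => _root_.frontMass (α z) (β z) (π z) (μ z) (τ z) *
      frontRatio (α z) (β z) (π z) (μ z) (τ z) := by
  have hD := Continuous.frontDisp hα hβ hπ hμ hτ pα pβ pπ pμ pτ
  simp_rw [fun z => frontMass_mul_frontRatio (pα z) (pβ z) (pπ z) (pμ z) (pτ z)]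
  fun_prop

end Continuity

section Smooth

variable {Z : Type*} [NormedAddCommGroup Z] [NormedSpace ℝ Z] {s : Set Z} {α β π μ τ : Z → ℝ}

lemma ContDiffOn.frontMass (hα : ContDiffOn ℝ 1 α s) (hβ : ContDiffOn ℝ 1 β s)
    (hπ : ContDiffOn ℝ 1 π s) (hμ : ContDiffOn ℝ 1 μ s) (hτ : ContDiffOn ℝ 1 τ s)
    (pα : ∀ z, 0 < α z) (pβ : ∀ z, 0 < β z)
    (pπ : ∀ z, 0 ≤ π z) (pμ : ∀ z, 0 < μ z ∧ μ z < 1) (pτ : ∀ z ∈ s, 0 < τ z) :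
    ContDiffOn ℝ 1 (fun z => frontMass (α z) (β z) (π z) (μ z) (τ z)) s := by
  unfold _root_.frontMass
  exact ContDiffOn.sqrt (by fun_prop) fun z hz =>
    (frontMass_radicand_pos (pα z) (pβ z) (pπ z) (pμ z) (pτ z hz)).ne'

lemma ContDiffOn.frontDisp (hα : ContDiffOn ℝ 1 α s) (hβ : ContDiffOn ℝ 1 β s)
    (hπ : ContDiffOn ℝ 1 π s) (hμ : ContDiffOn ℝ 1 μ s) (hτ : ContDiffOn ℝ 1 τ s)
    (pα : ∀ z, 0 < α z) (pβ : ∀ z, 0 < β z)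
    (pπ : ∀ z, 0 ≤ π z) (pμ : ∀ z, 0 < μ z ∧ μ z < 1) (pτ : ∀ z ∈ s, 0 < τ z) :
    ContDiffOn ℝ 1 (fun z => frontDisp (α z) (β z) (π z) (μ z) (τ z)) s := by
  have hM := ContDiffOn.frontMass hα hβ hπ hμ hτ pα pβ pπ pμ pτ
  unfold _root_.frontDisp
  exact ContDiffOn.div (by fun_prop) (by fun_prop) fun z hz =>
    (frontDisp_denom_pos (pα z) (pπ z) (pτ z hz)).ne'

lemma ContDiffOn.frontMomentum (hα : ContDiffOn ℝ 1 α s) (hβ : ContDiffOn ℝ 1 β s)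
    (hπ : ContDiffOn ℝ 1 π s) (hμ : ContDiffOn ℝ 1 μ s) (hτ : ContDiffOn ℝ 1 τ s)
    (pα : ∀ z, 0 < α z) (pβ : ∀ z, 0 < β z)
    (pπ : ∀ z, 0 ≤ π z) (pμ : ∀ z, 0 < μ z ∧ μ z < 1) (pτ : ∀ z ∈ s, 0 < τ z) :
    ContDiffOn ℝ 1 (fun z => _root_.frontMass (α z) (β z) (π z) (μ z) (τ z) *
      frontRatio (α z) (β z) (π z) (μ z) (τ z)) s := by
  have hD := ContDiffOn.frontDisp hα hβ hπ hμ hτ pα pβ pπ pμ pτ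
  refine ContDiffOn.congr (f := fun z => π z * μ z + α z * (τ z -
    _root_.frontDisp (α z) (β z) (π z) (μ z) (τ z))) (by fun_prop) fun z hz => ?_
  exact frontMass_mul_frontRatio (pα z) (pβ z) (pπ z) (pμ z) (pτ z hz).le

end Smooth

lemma integral_frontRatio (ha : 0 < a) (hb : 0 < b) (hp : 0 ≤ p) (hm : 0 < m ∧ m < 1) {t : ℝ}
    (ht : 0 ≤ t) : ∫ s in (0 : ℝ)..t, frontRatio a b p m s = frontDisp a b p m t := by
  have hc : ContinuousOn (frontDisp a b p m) (Icc 0 t) := by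
    have h := Continuous.frontDisp (τ := fun s : ℝ => max s 0) (continuous_const (y := a))
      (continuous_const (y := b)) (continuous_const (y := p)) (continuous_const (y := m))
      (by fun_prop) (fun _ => ha) (fun _ => hb) (fun _ => hp) (fun _ => hm)
      fun s => le_max_right s 0
    refine h.continuousOn.congr fun s hs => ?_
    simp only [max_eq_left hs.1]
  have hd : ∀ s ∈ Ioo 0 t, HasDerivAt (frontDisp a b p m) (frontRatio a b p m s) s :=
    fun s hs => hasDerivAt_frontDisp ha hb hp hm hs.1
  have hi := intervalIntegral.integrableOn_deriv_of_nonneg hc hd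
    fun s hs => frontRatio_nonneg ha hb hp hm hs.1.le
  rw [intervalIntegral.integral_eq_sub_of_hasDeriv_right_of_le ht hc
    (fun s hs => (hd s hs).hasDerivWithinAt)
    ((intervalIntegrable_iff_integrableOn_Ioc_of_le ht).2 hi), frontDisp_zero, sub_zero]

/-! ### Asymptotics for large times -/

lemma tendsto_frontMass_div (ha : 0 < a) (hb : 0 < b) (hp : 0 ≤ p) (hm : 0 < m ∧ m < 1)
    {c : ℝ} (hc : 0 < c) (hab : c ^ 2 = a * b) :
    Tendsto (fun t => frontMass a b p m t / t) atTop (𝓝 c) := by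
  have hinv : Tendsto (fun t : ℝ => t⁻¹) atTop (𝓝 0) := tendsto_inv_atTop_zero
  have h : Tendsto (fun t : ℝ => √((p * t⁻¹) ^ 2 + 2 * p * (a * (1 - m) + b * m) * t⁻¹ + c ^ 2))
      atTop (𝓝 √((p * 0) ^ 2 + 2 * p * (a * (1 - m) + b * m) * 0 + c ^ 2)) :=
    ((((hinv.const_mul p).pow 2).add (hinv.const_mul _)).add_const _).sqrt
  have e : √((p * 0) ^ 2 + 2 * p * (a * (1 - m) + b * m) * 0 + c ^ 2) = c := by
    simp [Real.sqrt_sq hc.le]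
  rw [e] at h
  refine h.congr' ?_
  filter_upwards [eventually_gt_atTop 0] with t ht
  have hP := frontMass_pos ha hb hp hm ht
  rw [← Real.sqrt_sq (div_pos hP ht).le, div_pow, frontMass_sq ha hb hp hm ht.le, hab]
  congr 1
  field_simp

/-- The constants satisfy `c = √(a b)` and `κ = √a / (√a + √b)`. -/
lemma tendsto_frontDisp_sub (ha : 0 < a) (hb : 0 < b) (hp : 0 ≤ p) (hm : 0 < m ∧ m < 1)
    {c κ : ℝ} (hc : 0 < c) (hab : c ^ 2 = a * b) (hκ : κ * (a + c) = a) :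
    Tendsto (fun t => frontDisp a b p m t - κ * t) atTop (𝓝 (p * (m - κ) / c)) := by
  have hinv : Tendsto (fun t : ℝ => t⁻¹) atTop (𝓝 0) := tendsto_inv_atTop_zero
  have hq := tendsto_frontMass_div ha hb hp hm hc hab
  have hac : 0 < a + c := by positivity
  -- `P - c t` tends to `p (a (1 - m) + b m) / c`
  have h1 : Tendsto (fun t => (p ^ 2 * t⁻¹ + 2 * p * (a * (1 - m) + b * m)) /
      (frontMass a b p m t / t + c)) atTop
      (𝓝 ((p ^ 2 * 0 + 2 * p * (a * (1 - m) + b * m)) / (c + c))) :=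
    ((hinv.const_mul _).add_const _).div (hq.add_const c) (by positivity)
  have h2 : Tendsto (fun t => (2 * p * m - κ * p - κ * ((p ^ 2 * t⁻¹ +
      2 * p * (a * (1 - m) + b * m)) / (frontMass a b p m t / t + c))) /
      (p * t⁻¹ + a + frontMass a b p m t / t)) atTop
      (𝓝 ((2 * p * m - κ * p - κ * ((p ^ 2 * 0 + 2 * p * (a * (1 - m) + b * m)) / (c + c))) /
        (p * 0 + a + c))) :=
    ((h1.const_mul κ).const_sub _).div (((hinv.const_mul p).add_const a).add hq)
      (by simpa using hac.ne')
  have e : (2 * p * m - κ * p - κ * ((p ^ 2 * 0 + 2 * p * (a * (1 - m) + b * m)) / (c + c))) /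
        (p * 0 + a + c) = p * (m - κ) / c := by
    have e1 : κ * (a - b) = a - c := by
      refine mul_right_cancel₀ hac.ne' ?_
      linear_combination (a - b) * hκ + hab
    rw [mul_zero, zero_add, mul_zero, zero_add, div_eq_div_iff hac.ne' hc.ne']
    field_simp
    linear_combination 2 * p * m * e1
  rw [e] at h2
  refine h2.congr' ?_
  filter_upwards [eventually_gt_atTop 0] with t ht
  have hP := frontMass_pos ha hb hp hm ht
  have hsq := frontMass_sq ha hb hp hm ht.le
  have hD := frontDisp_denom_pos (b := b) (m := m) ha hp ht
  have hPc : 0 < frontMass a b p m t + c * t := by positivity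
  rw [frontDisp]
  generalize frontMass a b p m t = P at *
  have e1 : (p ^ 2 * t⁻¹ + 2 * p * (a * (1 - m) + b * m)) / (P / t + c) = P - c * t := by
    rw [div_eq_iff (by positivity)]
    field_simp
    linear_combination -hsq + t ^ 2 * hab
  have e2 : p * t⁻¹ + a + P / t = (p + a * t + P) / t := by field_simp
  rw [e1, e2, div_div_eq_mul_div, div_eq_iff hD.ne', sub_mul (_ / _),
    div_mul_cancel₀ _ hD.ne']
  linear_combination t ^ 2 * hκ

lemma tendsto_frontRatio (ha : 0 < a) (hb : 0 < b) (hp : 0 ≤ p) (hm : 0 < m ∧ m < 1)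
    {c κ : ℝ} (hc : 0 < c) (hab : c ^ 2 = a * b) (hκ : κ * (a + c) = a) :
    Tendsto (frontRatio a b p m) atTop (𝓝 κ) := by
  have hinv : Tendsto (fun t : ℝ => t⁻¹) atTop (𝓝 0) := tendsto_inv_atTop_zero
  have h1 := (tendsto_frontDisp_sub ha hb hp hm hc hab hκ).mul hinv
  have h2 : Tendsto (fun t => (p * m * t⁻¹ + a * (1 - κ -
      (frontDisp a b p m t - κ * t) * t⁻¹)) / (frontMass a b p m t / t)) atTop
      (𝓝 ((p * m * 0 + a * (1 - κ - p * (m - κ) / c * 0)) / c)) :=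
    ((hinv.const_mul _).add ((h1.const_sub _).const_mul a)).div
      (tendsto_frontMass_div ha hb hp hm hc hab) hc.ne'
  have e : (p * m * 0 + a * (1 - κ - p * (m - κ) / c * 0)) / c = κ := by
    rw [div_eq_iff hc.ne']
    linear_combination -hκ
  rw [e] at h2
  refine h2.congr' ?_
  filter_upwards [eventually_gt_atTop 0] with t ht
  have hP := frontMass_pos ha hb hp hm ht
  rw [frontRatio]
  field_simp
  ring

lemma frontDisp_of_mass_zero (ha : 0 < a)
    {c κ : ℝ} (hc : 0 < c) (hab : c ^ 2 = a * b) (hκ : κ * (a + c) = a) {t : ℝ} (ht : 0 ≤ t) :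
    frontDisp a b 0 m t = κ * t := by
  have hP : frontMass a b 0 m t = c * t := by
    rw [frontMass, ← hab]
    rw [← Real.sqrt_sq (show 0 ≤ c * t by positivity)]
    congr 1; ring
  rcases ht.eq_or_lt with rfl | ht
  · simp [frontDisp]
  · rw [frontDisp, hP, div_eq_iff (by positivity)]
    linear_combination -t ^ 2 * hκ

/-! ### Uniqueness for the reduced equation -/

lemma eq_of_hasDerivAt_zero_of_tendsto {f : ℝ → ℝ} {c : ℝ} (hf : ∀ t > 0, HasDerivAt f 0 t)
    (hc : Tendsto f (𝓝[>] 0) (𝓝 c)) {t : ℝ} (ht : 0 < t) : f t = c := by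
  obtain ⟨d, hd⟩ := isOpen_Ioi.exists_is_const_of_deriv_eq_zero (f := f) isPreconnected_Ioi
    (fun s hs => (hf s hs).differentiableAt.differentiableWithinAt) (fun s hs => (hf s hs).deriv)
  have h : Tendsto f (𝓝[>] 0) (𝓝 d) :=
    tendsto_const_nhds.congr' (by
      filter_upwards [self_mem_nhdsWithin] with s hs using (hd s hs).symm)
  rw [hd t ht, tendsto_nhds_unique h hc]

/-- Two first integrals of the reduced equation, the mass balance and the momentum balance
integrated once more, determine its solution algebraically. -/
lemma reduced_unique (ha : 0 < a) (hb : 0 < b) (hp : 0 ≤ p) (hm : 0 < m ∧ m < 1)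
    {P K k : ℝ → ℝ} (hP : ∀ t > 0, 0 < P t)
    (hP' : ∀ t > 0, HasDerivAt P (a - (a - b) * k t) t)
    (hM' : ∀ t > 0, HasDerivAt (fun t => P t * k t) (a * (1 - k t)) t)
    (hK' : ∀ t > 0, HasDerivAt K (k t) t)
    (hP0 : Tendsto P (𝓝[>] 0) (𝓝 p)) (hM0 : Tendsto (fun t => P t * k t) (𝓝[>] 0) (𝓝 (p * m)))
    (hK0 : Tendsto K (𝓝[>] 0) (𝓝 0)) {t : ℝ} (ht : 0 < t) :
    P t = frontMass a b p m t ∧ K t = frontDisp a b p m t ∧ k t = frontRatio a b p m t := by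
  have hid : Tendsto (fun t : ℝ => t) (𝓝[>] 0) (𝓝 0) :=
    tendsto_nhdsWithin_of_tendsto_nhds tendsto_id
  have h1 : ∀ t > 0, P t - a * t + (a - b) * K t = p := by
    intro t ht
    refine eq_of_hasDerivAt_zero_of_tendsto (f := fun t => P t - a * t + (a - b) * K t)
      (fun s hs => ?_) ?_ ht
    · refine (((hP' s hs).sub ((hasDerivAt_id' s).const_mul a)).add
        ((hK' s hs).const_mul (a - b))).congr_deriv ?_
      ring
    · have := (hP0.sub (hid.const_mul a)).add (hK0.const_mul (a - b))
      simpa using this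
  have h2 : ∀ t > 0, P t * k t - a * (t - K t) = p * m := by
    intro t ht
    refine eq_of_hasDerivAt_zero_of_tendsto (f := fun t => P t * k t - a * (t - K t))
      (fun s hs => ?_) ?_ ht
    · refine ((hM' s hs).sub (((hasDerivAt_id' s).sub (hK' s hs)).const_mul a)).congr_deriv ?_
      ring
    · have := hM0.sub ((hid.sub hK0).const_mul a)
      simpa using this
  have h3 : ∀ t > 0, (a - b) * K t ^ 2 - 2 * (p + a * t) * K t + t * (2 * p * m + a * t) = 0 := by
    intro t ht
    refine eq_of_hasDerivAt_zero_of_tendsto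
      (f := fun t => (a - b) * K t ^ 2 - 2 * (p + a * t) * K t + t * (2 * p * m + a * t))
      (fun s hs => ?_) ?_ ht
    · refine (((((hK' s hs).pow 2).const_mul (a - b)).sub
        (((((hasDerivAt_id' s).const_mul a).const_add p).const_mul 2).mul (hK' s hs))).add
        ((hasDerivAt_id' s).mul (((hasDerivAt_id' s).const_mul a).const_add
          (2 * p * m)))).congr_deriv ?_
      push_cast
      linear_combination (2 * k s) * h1 s hs - 2 * h2 s hs
    · have := (((hK0.pow 2).const_mul (a - b)).sub
        ((((hid.const_mul a).const_add p).const_mul 2).mul hK0)).add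
        (hid.mul ((hid.const_mul a).const_add (2 * p * m)))
      simpa using this
  have hPt : P t = frontMass a b p m t := by
    rw [← Real.sqrt_sq (hP t ht).le, frontMass]
    congr 1
    linear_combination (P t + (p + a * t - (a - b) * K t)) * h1 t ht + (a - b) * h3 t ht
  have hKt : K t = frontDisp a b p m t := by
    rw [frontDisp, eq_div_iff (frontDisp_denom_pos ha hp ht).ne', ← hPt]
    linear_combination K t * h1 t ht - h3 t ht
  refine ⟨hPt, hKt, ?_⟩
  rw [frontRatio, eq_div_iff (frontMass_pos ha hb hp hm ht).ne', ← hPt, ← hKt]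
  linear_combination h2 t ht

end Scalar

/-! ### Geometry of the moving front -/

/-- The hypotheses on the initial front: a continuously differentiable curve that is the zero set
of the continuous function `Φ`, is crossed by the velocity `(u, v)` everywhere in the same sense,
and whose `-` side is the one that the velocity comes from. -/
structure IsTransversalCurve (u v : ℝ) (x₀ y₀ : ℝ → ℝ) (Φ : ℝ × ℝ → ℝ) : Prop where
  contDiff_fst : ContDiff ℝ 1 x₀
  contDiff_snd : ContDiff ℝ 1 y₀
  continuous_level : Continuous Φ
  zero_iff : ∀ X : ℝ × ℝ, Φ X = 0 ↔ ∃ l, X = (x₀ l, y₀ l)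
  side : ∀ l, ∀ᶠ ε in 𝓝[>] (0 : ℝ),
    Φ (x₀ l - ε * u, y₀ l - ε * v) < 0 ∧ 0 < Φ (x₀ l + ε * u, y₀ l + ε * v)
  crossSpeed_pos : ∀ l, 0 < crossSpeed u v x₀ y₀ l

/-- `K t l` is an admissible displacement at time `t` of the front point with label `l`: it is
continuous and lies between `0` and `t`; for negative times, it vanishes. -/
structure IsDisplacement (K : ℝ → ℝ → ℝ) : Prop where
  continuous : Continuous fun z : ℝ × ℝ => K z.1 z.2
  nonneg : ∀ t l, 0 ≤ K t l
  le_max : ∀ t l, K t l ≤ max t 0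

/-- Translation by `s (u, v)`. -/
def shift (u v s : ℝ) (X : ℝ × ℝ) : ℝ × ℝ := (X.1 + s * u, X.2 + s * v)

/-- The coordinate transversal to `(u, v)`, constant along the lines in this direction. -/
def transCoord (u v : ℝ) (X : ℝ × ℝ) : ℝ := u * X.2 - v * X.1

/-- The label `l` of the point of the initial front that lies on the same line in the direction
`(u, v)` as `X`; it is meaningful only if there is such a point. -/
def lineLabel (u v : ℝ) (x₀ y₀ : ℝ → ℝ) (X : ℝ × ℝ) : ℝ :=
  Function.invFun (fun l => transCoord u v (x₀ l, y₀ l)) (transCoord u v X)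

/-- The front at time `t`. -/
def movedCurve (u v : ℝ) (x₀ y₀ : ℝ → ℝ) (K : ℝ → ℝ → ℝ) (t l : ℝ) : ℝ × ℝ :=
  (x₀ l + u * K t l, y₀ l + v * K t l)

open Classical in
/-- A level function of the front at time `t`: on each line in the direction `(u, v)` that meets
the front, `Φ` is carried along with the front; on the other lines it is kept. -/
def movedLevel (u v : ℝ) (x₀ y₀ : ℝ → ℝ) (Φ : ℝ × ℝ → ℝ) (K : ℝ → ℝ → ℝ) (t : ℝ) (X : ℝ × ℝ) : ℝ :=
  if transCoord u v X ∈ range (fun l => transCoord u v (x₀ l, y₀ l)) then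
    Φ (shift u v (-K t (lineLabel u v x₀ y₀ X)) X)
  else Φ X

section Shift

variable {u v : ℝ}

@[simp] lemma shift_zero (X : ℝ × ℝ) : shift u v 0 X = X := by simp [shift]

@[simp] lemma shift_shift (s r : ℝ) (X : ℝ × ℝ) :
    shift u v s (shift u v r X) = shift u v (r + s) X := by
  simp only [shift, Prod.mk.injEq]; constructor <;> ring

@[simp] lemma transCoord_shift (s : ℝ) (X : ℝ × ℝ) :
    transCoord u v (shift u v s X) = transCoord u v X := by
  simp only [shift, transCoord]; ring

lemma Continuous.shift {Z : Type*} [TopologicalSpace Z] {f : Z → ℝ} {g : Z → ℝ × ℝ}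
    (hf : Continuous f) (hg : Continuous g) : Continuous fun z => _root_.shift u v (f z) (g z) := by
  unfold _root_.shift; fun_prop

lemma continuous_transCoord : Continuous (transCoord u v) := by
  unfold transCoord; fun_prop

lemma movedCurve_eq_shift (x₀ y₀ : ℝ → ℝ) (K : ℝ → ℝ → ℝ) (t l : ℝ) :
    movedCurve u v x₀ y₀ K t l = shift u v (K t l) (x₀ l, y₀ l) := by
  simp only [movedCurve, shift, mul_comm]

end Shift

namespace IsTransversalCurve

variable {u v : ℝ} {x₀ y₀ : ℝ → ℝ} {Φ : ℝ × ℝ → ℝ} {K : ℝ → ℝ → ℝ}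

lemma continuous_curve (h : IsTransversalCurve u v x₀ y₀ Φ) :
    Continuous fun l => (x₀ l, y₀ l) :=
  h.contDiff_fst.continuous.prodMk h.contDiff_snd.continuous

lemma hasStrictDerivAt_transCoord (h : IsTransversalCurve u v x₀ y₀ Φ) (l : ℝ) :
    HasStrictDerivAt (fun l => transCoord u v (x₀ l, y₀ l)) (crossSpeed u v x₀ y₀ l) l := by
  have hx := h.contDiff_fst.contDiffAt.hasStrictDerivAt (x := l) one_ne_zero
  have hy := h.contDiff_snd.contDiffAt.hasStrictDerivAt (x := l) one_ne_zero
  exact (hy.const_mul u).sub (hx.const_mul v)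

lemma continuous_crossSpeed (h : IsTransversalCurve u v x₀ y₀ Φ) :
    Continuous (crossSpeed u v x₀ y₀) := by
  have hx := h.contDiff_fst.continuous_deriv le_rfl
  have hy := h.contDiff_snd.continuous_deriv le_rfl
  unfold crossSpeed; fun_prop

lemma strictMono_transCoord (h : IsTransversalCurve u v x₀ y₀ Φ) :
    StrictMono fun l => transCoord u v (x₀ l, y₀ l) :=
  strictMono_of_deriv_pos fun l => by
    rw [(h.hasStrictDerivAt_transCoord l).hasDerivAt.deriv]; exact h.crossSpeed_pos l

lemma isOpenEmbedding_transCoord (h : IsTransversalCurve u v x₀ y₀ Φ) :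
    IsOpenEmbedding fun l => transCoord u v (x₀ l, y₀ l) :=
  .of_continuous_injective_isOpenMap (continuous_transCoord.comp h.continuous_curve)
    h.strictMono_transCoord.injective
    (isOpenMap_of_hasStrictDerivAt h.hasStrictDerivAt_transCoord fun l => (h.crossSpeed_pos l).ne')

lemma velocity_sq_pos (h : IsTransversalCurve u v x₀ y₀ Φ) : 0 < u ^ 2 + v ^ 2 := by
  by_contra hn
  have hu : u = 0 := by nlinarith [sq_nonneg u, sq_nonneg v]
  have hv : v = 0 := by nlinarith [sq_nonneg u, sq_nonneg v]
  have := h.crossSpeed_pos 0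
  simp [crossSpeed, hu, hv] at this

lemma lineLabel_eq (h : IsTransversalCurve u v x₀ y₀ Φ) {X : ℝ × ℝ} {l : ℝ}
    (hl : transCoord u v (x₀ l, y₀ l) = transCoord u v X) : lineLabel u v x₀ y₀ X = l := by
  rw [lineLabel, ← hl]
  exact Function.leftInverse_invFun h.strictMono_transCoord.injective l

lemma continuousAt_lineLabel (h : IsTransversalCurve u v x₀ y₀ Φ) {X : ℝ × ℝ}
    (hX : transCoord u v X ∈ range fun l => transCoord u v (x₀ l, y₀ l)) :
    ContinuousAt (lineLabel u v x₀ y₀) X := by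
  have h1 : ContinuousAt (Function.invFun fun l => transCoord u v (x₀ l, y₀ l))
      (transCoord u v X) := by
    obtain ⟨l, hl⟩ := hX
    rw [← hl, h.isOpenEmbedding_transCoord.continuousAt_iff.symm]
    have : (Function.invFun fun l => transCoord u v (x₀ l, y₀ l)) ∘
        (fun l => transCoord u v (x₀ l, y₀ l)) = id :=
      Function.invFun_comp h.strictMono_transCoord.injective
    rw [this]
    exact continuousAt_id
  exact ContinuousAt.comp h1 continuous_transCoord.continuousAt

/-- Every point on a line that meets the initial front is a translate of the point of the front. -/
lemma exists_shift_eq (h : IsTransversalCurve u v x₀ y₀ Φ) {X : ℝ × ℝ} {l : ℝ}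
    (hl : transCoord u v (x₀ l, y₀ l) = transCoord u v X) :
    ∃ s, X = shift u v s (x₀ l, y₀ l) := by
  have hq := h.velocity_sq_pos
  refine ⟨(u * (X.1 - x₀ l) + v * (X.2 - y₀ l)) / (u ^ 2 + v ^ 2), ?_⟩
  simp only [transCoord] at hl
  ext
  · simp only [shift]
    rw [← sub_eq_iff_eq_add', div_mul_eq_mul_div, eq_div_iff hq.ne']
    linear_combination v * hl
  · simp only [shift]
    rw [← sub_eq_iff_eq_add', div_mul_eq_mul_div, eq_div_iff hq.ne']
    linear_combination -u * hl

lemma level_shift_curve_eq_zero_iff (h : IsTransversalCurve u v x₀ y₀ Φ) (l s : ℝ) :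
    Φ (shift u v s (x₀ l, y₀ l)) = 0 ↔ s = 0 := by
  constructor
  · intro hs
    obtain ⟨l', hl'⟩ := (h.zero_iff _).1 hs
    have h1 : l = l' := h.strictMono_transCoord.injective (by
      have := congrArg (transCoord u v) hl'
      simpa using this)
    subst h1
    have hq := h.velocity_sq_pos
    simp only [shift, Prod.mk.injEq, add_eq_left, mul_eq_zero] at hl'
    by_contra hs0
    simp [hl'.1.resolve_left hs0, hl'.2.resolve_left hs0] at hq
  · rintro rfl
    rw [shift_zero]
    exact (h.zero_iff _).2 ⟨l, rfl⟩

lemma continuous_level_shift (h : IsTransversalCurve u v x₀ y₀ Φ) (X : ℝ × ℝ) :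
    Continuous fun s => Φ (shift u v s X) :=
  h.continuous_level.comp (continuous_id.shift continuous_const)

/-- A continuous function on an interval that does not vanish there has constant sign. -/
lemma _root_.pos_of_forall_ne_zero {f : ℝ → ℝ} {s : Set ℝ} (hs : OrdConnected s)
    (hf : ContinuousOn f s) (h0 : ∀ x ∈ s, f x ≠ 0) {x y : ℝ} (hx : x ∈ s) (hy : y ∈ s)
    (h : 0 < f x) : 0 < f y := by
  by_contra hn
  obtain ⟨z, hz, hz0⟩ := hs.isPreconnected.intermediate_value hy hx hf ⟨not_lt.1 hn, h.le⟩
  exact h0 z hz hz0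

lemma level_shift_curve_pos (h : IsTransversalCurve u v x₀ y₀ Φ) (l : ℝ) {s : ℝ} (hs : 0 < s) :
    0 < Φ (shift u v s (x₀ l, y₀ l)) := by
  obtain ⟨ε, hε, hε0⟩ := ((h.side l).and self_mem_nhdsWithin).exists
  refine pos_of_forall_ne_zero (f := fun s => Φ (shift u v s (x₀ l, y₀ l))) ordConnected_Ioi
    (h.continuous_level_shift _).continuousOn
    (fun r hr => (h.level_shift_curve_eq_zero_iff l r).not.2 (ne_of_gt hr)) hε0 hs ?_
  exact hε.2

lemma level_shift_curve_neg (h : IsTransversalCurve u v x₀ y₀ Φ) (l : ℝ) {s : ℝ} (hs : s < 0) :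
    Φ (shift u v s (x₀ l, y₀ l)) < 0 := by
  obtain ⟨ε, hε, hε0⟩ := ((h.side l).and self_mem_nhdsWithin).exists
  refine neg_pos.1 (pos_of_forall_ne_zero (f := fun s => -Φ (shift u v s (x₀ l, y₀ l)))
    ordConnected_Iio (h.continuous_level_shift _).neg.continuousOn
    (fun r hr => neg_ne_zero.2 ((h.level_shift_curve_eq_zero_iff l r).not.2 (ne_of_lt hr)))
    (neg_lt_zero.2 hε0) hs ?_)
  have := hε.1
  simp only [shift, neg_mul, ← sub_eq_add_neg]
  linarith

lemma level_shift_ne_zero (h : IsTransversalCurve u v x₀ y₀ Φ) {X : ℝ × ℝ}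
    (hX : transCoord u v X ∉ range fun l => transCoord u v (x₀ l, y₀ l)) (s : ℝ) :
    Φ (shift u v s X) ≠ 0 := by
  intro h0
  obtain ⟨l, hl⟩ := (h.zero_iff _).1 h0
  exact hX ⟨l, by simp only [← hl, transCoord_shift]⟩

lemma level_shift_pos (h : IsTransversalCurve u v x₀ y₀ Φ) {X : ℝ × ℝ}
    (hX : transCoord u v X ∉ range fun l => transCoord u v (x₀ l, y₀ l)) (hp : 0 < Φ X) (s : ℝ) :
    0 < Φ (shift u v s X) :=
  pos_of_forall_ne_zero (f := fun s => Φ (shift u v s X)) ordConnected_univ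
    (h.continuous_level_shift X).continuousOn
    (fun r _ => h.level_shift_ne_zero hX r) (mem_univ 0) (mem_univ s) (by simpa using hp)

lemma level_shift_neg (h : IsTransversalCurve u v x₀ y₀ Φ) {X : ℝ × ℝ}
    (hX : transCoord u v X ∉ range fun l => transCoord u v (x₀ l, y₀ l)) (hp : Φ X < 0) (s : ℝ) :
    Φ (shift u v s X) < 0 :=
  neg_pos.1 <| pos_of_forall_ne_zero (f := fun s => -Φ (shift u v s X)) ordConnected_univ
    (h.continuous_level_shift X).neg.continuousOn
    (fun r _ => neg_ne_zero.2 (h.level_shift_ne_zero hX r)) (mem_univ 0) (mem_univ s)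
    (by simpa using hp)

lemma movedLevel_of_label (h : IsTransversalCurve u v x₀ y₀ Φ) (K : ℝ → ℝ → ℝ) (t : ℝ)
    {X : ℝ × ℝ} {l : ℝ} (hl : transCoord u v (x₀ l, y₀ l) = transCoord u v X) :
    movedLevel u v x₀ y₀ Φ K t X = Φ (shift u v (-K t l) X) := by
  rw [movedLevel, if_pos ⟨l, hl⟩, h.lineLabel_eq hl]

lemma _root_.movedLevel_of_notMem {t : ℝ} {X : ℝ × ℝ}
    (hX : transCoord u v X ∉ range fun l => transCoord u v (x₀ l, y₀ l)) :
    movedLevel u v x₀ y₀ Φ K t X = Φ X := if_neg hX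

lemma movedLevel_shift_curve (h : IsTransversalCurve u v x₀ y₀ Φ) (K : ℝ → ℝ → ℝ) (t l s : ℝ) :
    movedLevel u v x₀ y₀ Φ K t (shift u v s (x₀ l, y₀ l)) =
      Φ (shift u v (s - K t l) (x₀ l, y₀ l)) := by
  rw [h.movedLevel_of_label K t (transCoord_shift _ _).symm, shift_shift, sub_eq_add_neg]

lemma movedLevel_shift_curve_pos_iff (h : IsTransversalCurve u v x₀ y₀ Φ) (K : ℝ → ℝ → ℝ)
    (t l s : ℝ) : 0 < movedLevel u v x₀ y₀ Φ K t (shift u v s (x₀ l, y₀ l)) ↔ K t l < s := by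
  rw [h.movedLevel_shift_curve]
  rcases lt_trichotomy (s - K t l) 0 with h1 | h1 | h1
  · simp only [(h.level_shift_curve_neg l h1).not_gt, false_iff]; linarith
  · simp only [(h.level_shift_curve_eq_zero_iff l _).2 h1, lt_irrefl, false_iff]; linarith
  · simp only [h.level_shift_curve_pos l h1, true_iff]; linarith

lemma movedLevel_eq_zero_iff (h : IsTransversalCurve u v x₀ y₀ Φ) (K : ℝ → ℝ → ℝ) (t : ℝ)
    (X : ℝ × ℝ) :
    movedLevel u v x₀ y₀ Φ K t X = 0 ↔ ∃ l, X = movedCurve u v x₀ y₀ K t l := by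
  constructor
  · intro h0
    by_cases hX : transCoord u v X ∈ range fun l => transCoord u v (x₀ l, y₀ l)
    · obtain ⟨l, hl⟩ := hX
      obtain ⟨s, rfl⟩ := h.exists_shift_eq hl
      rw [h.movedLevel_shift_curve, h.level_shift_curve_eq_zero_iff, sub_eq_zero] at h0
      exact ⟨l, by rw [movedCurve_eq_shift, h0]⟩
    · rw [movedLevel_of_notMem hX] at h0
      exact absurd (by simpa using h0) (h.level_shift_ne_zero hX 0)
  · rintro ⟨l, rfl⟩
    rw [movedCurve_eq_shift, h.movedLevel_shift_curve, h.level_shift_curve_eq_zero_iff, sub_self]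

lemma _root_.movedLevel_eq_of_zero {t : ℝ} (hK : ∀ l, K t l = 0) (X : ℝ × ℝ) :
    movedLevel u v x₀ y₀ Φ K t X = Φ X := by
  simp [movedLevel, hK]

/-- Near a line that does not meet the front, the bound `0 ≤ K ≤ t` and compactness replace the
missing continuity of the displacement as a function of the point. -/
lemma isOpen_movedLevel_mem (h : IsTransversalCurve u v x₀ y₀ Φ) (hK : IsDisplacement K)
    {U : Set ℝ} (hU : IsOpen U)
    (hUΦ : ∀ X : ℝ × ℝ, transCoord u v X ∉ range (fun l => transCoord u v (x₀ l, y₀ l)) →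
      Φ X ∈ U → ∀ s, Φ (shift u v s X) ∈ U) :
    IsOpen {z : ℝ × (ℝ × ℝ) | movedLevel u v x₀ y₀ Φ K z.1 z.2 ∈ U} := by
  refine isOpen_iff_mem_nhds.2 fun ⟨t, X⟩ hz => ?_
  change movedLevel u v x₀ y₀ Φ K t X ∈ U at hz
  by_cases hX : transCoord u v X ∈ range fun l => transCoord u v (x₀ l, y₀ l)
  · have hlab : ContinuousAt (fun z : ℝ × (ℝ × ℝ) => lineLabel u v x₀ y₀ z.2) (t, X) :=
      ContinuousAt.comp (f := Prod.snd) (h.continuousAt_lineLabel hX) continuousAt_snd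
    have hKc : ContinuousAt (fun z : ℝ × (ℝ × ℝ) => K z.1 (lineLabel u v x₀ y₀ z.2)) (t, X) :=
      ContinuousAt.comp (f := fun z : ℝ × (ℝ × ℝ) => (z.1, lineLabel u v x₀ y₀ z.2))
        hK.continuous.continuousAt (continuousAt_fst.prodMk hlab)
    have hc : ContinuousAt (fun z : ℝ × (ℝ × ℝ) =>
        Φ (shift u v (-K z.1 (lineLabel u v x₀ y₀ z.2)) z.2)) (t, X) := by
      refine ContinuousAt.comp (f := fun z : ℝ × (ℝ × ℝ) =>
        shift u v (-K z.1 (lineLabel u v x₀ y₀ z.2)) z.2) h.continuous_level.continuousAt ?_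
      exact ContinuousAt.prodMk
        (((continuous_fst.comp continuous_snd).continuousAt).add (hKc.neg.mul_const u))
        (((continuous_snd.comp continuous_snd).continuousAt).add (hKc.neg.mul_const v))
    have he : ∀ᶠ z : ℝ × (ℝ × ℝ) in 𝓝 (t, X),
        transCoord u v z.2 ∈ range fun l => transCoord u v (x₀ l, y₀ l) :=
      (continuous_transCoord.comp continuous_snd).continuousAt.eventually_mem
        (h.isOpenEmbedding_transCoord.isOpen_range.mem_nhds hX)
    rw [movedLevel, if_pos hX] at hz
    filter_upwards [he, hc.eventually_mem (hU.mem_nhds hz)] with z hz1 hz2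
    rw [movedLevel, if_pos hz1]
    exact hz2
  · rw [movedLevel_of_notMem hX] at hz
    have h1 : ∀ᶠ z : ℝ × (ℝ × ℝ) in 𝓝 (t, X), ∀ s ∈ Icc 0 (max t 0 + 1),
        Φ (shift u v (-s) z.2) ∈ U := by
      refine isCompact_Icc.eventually_forall_of_forall_eventually fun s _ => ?_
      have hc : Continuous fun y : (ℝ × (ℝ × ℝ)) × ℝ => Φ (shift u v (-y.2) y.1.2) :=
        h.continuous_level.comp (continuous_snd.neg.shift (continuous_snd.comp continuous_fst))
      exact hc.continuousAt.eventually_mem (hU.mem_nhds (hUΦ X hX hz _))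
    have h2 : ∀ᶠ z : ℝ × (ℝ × ℝ) in 𝓝 (t, X), max z.1 0 < max t 0 + 1 :=
      (continuous_fst.max continuous_const).continuousAt.eventually_lt continuousAt_const
        (lt_add_one _)
    filter_upwards [h1, h2] with z hz1 hz2
    rw [movedLevel]
    split_ifs with hr
    · exact hz1 _ ⟨hK.nonneg _ _, (hK.le_max _ _).trans hz2.le⟩
    · simpa using hz1 0 ⟨le_rfl, by positivity⟩

lemma isOpen_movedLevel_pos (h : IsTransversalCurve u v x₀ y₀ Φ) (hK : IsDisplacement K) :
    IsOpen {z : ℝ × (ℝ × ℝ) | 0 < movedLevel u v x₀ y₀ Φ K z.1 z.2} :=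
  h.isOpen_movedLevel_mem hK isOpen_Ioi fun _ hX hp s => h.level_shift_pos hX hp s

lemma isOpen_movedLevel_neg (h : IsTransversalCurve u v x₀ y₀ Φ) (hK : IsDisplacement K) :
    IsOpen {z : ℝ × (ℝ × ℝ) | movedLevel u v x₀ y₀ Φ K z.1 z.2 < 0} :=
  h.isOpen_movedLevel_mem hK isOpen_Iio fun _ hX hp s => h.level_shift_neg hX hp s

lemma isOpen_movedLevel_pos_at (h : IsTransversalCurve u v x₀ y₀ Φ) (hK : IsDisplacement K)
    (t : ℝ) : IsOpen {X | 0 < movedLevel u v x₀ y₀ Φ K t X} :=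
  (h.isOpen_movedLevel_pos hK).preimage (Continuous.prodMk_right t)

/-- A smooth function with the same sign as `movedLevel`: the difference of two nonnegative smooth
functions whose supports are the region ahead of the front and the region behind it. -/
lemma exists_contDiff_level (h : IsTransversalCurve u v x₀ y₀ Φ) (hK : IsDisplacement K) :
    ∃ S : ℝ → ℝ × ℝ → ℝ, ContDiff ℝ 1 (fun z : ℝ × (ℝ × ℝ) => S z.1 z.2) ∧
      (∀ t X, 0 < S t X ↔ 0 < movedLevel u v x₀ y₀ Φ K t X) ∧
      (∀ t X, S t X < 0 ↔ movedLevel u v x₀ y₀ Φ K t X < 0) := by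
  obtain ⟨f, hf, hfc, hfr⟩ := (h.isOpen_movedLevel_pos hK).exists_contDiff_support_eq (n := 1)
  obtain ⟨g, hg, hgc, hgr⟩ := (h.isOpen_movedLevel_neg hK).exists_contDiff_support_eq (n := 1)
  have hf' : ∀ z, 0 < f z ↔ 0 < movedLevel u v x₀ y₀ Φ K z.1 z.2 := fun z => by
    have h1 : z ∈ Function.support f ↔
        0 < movedLevel u v x₀ y₀ Φ K z.1 z.2 := by rw [hf]; exact Iff.rfl
    have h2 := (hfr ⟨z, rfl⟩).1
    rw [← h1, Function.mem_support, h2.lt_iff_ne']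
  have hg' : ∀ z, 0 < g z ↔ movedLevel u v x₀ y₀ Φ K z.1 z.2 < 0 := fun z => by
    have h1 : z ∈ Function.support g ↔
        movedLevel u v x₀ y₀ Φ K z.1 z.2 < 0 := by rw [hg]; exact Iff.rfl
    have h2 := (hgr ⟨z, rfl⟩).1
    rw [← h1, Function.mem_support, h2.lt_iff_ne']
  have key : ∀ z, (0 < f z - g z ↔ 0 < f z) ∧ (f z - g z < 0 ↔ 0 < g z) := fun z => by
    have h1 := (hfr ⟨z, rfl⟩).1
    have h2 := (hgr ⟨z, rfl⟩).1
    have h3 : ¬ (0 < f z ∧ 0 < g z) := by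
      rw [hf' z, hg' z]; exact fun h => lt_asymm h.1 h.2
    refine ⟨⟨fun _ => by linarith, fun h4 => ?_⟩, ⟨fun _ => by linarith, fun h4 => ?_⟩⟩
    · have : g z = 0 := le_antisymm (not_lt.1 fun h5 => h3 ⟨h4, h5⟩) h2
      linarith
    · have : f z = 0 := le_antisymm (not_lt.1 fun h5 => h3 ⟨h5, h4⟩) h1
      linarith
  exact ⟨fun t X => f (t, X) - g (t, X), hfc.sub hgc,
    fun t X => (key (t, X)).1.trans (hf' _), fun t X => (key (t, X)).2.trans (hg' _)⟩

/-- The front leaves every compact set as `l → ±∞`, uniformly for displacements in `[0, T]`: the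
initial front is closed, and its label is a continuous function of the point. -/
lemma exists_isCompact_label (h : IsTransversalCurve u v x₀ y₀ Φ) {C : Set (ℝ × ℝ)}
    (hC : IsCompact C) (T : ℝ) :
    ∃ L : Set ℝ, IsCompact L ∧
      ∀ l, ∀ s ∈ Icc 0 T, shift u v s (x₀ l, y₀ l) ∈ C → l ∈ L := by
  have h1 : IsCompact ((fun z : ℝ × (ℝ × ℝ) => shift u v (-z.1) z.2) '' (Icc 0 T ×ˢ C)) :=
    (isCompact_Icc.prod hC).image (continuous_fst.neg.shift continuous_snd)
  have h2 := h1.inter_right (isClosed_singleton.preimage h.continuous_level (t := {0}))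
  refine ⟨_, h2.image_of_continuousOn (f := lineLabel u v x₀ y₀) ?_, ?_⟩
  · rintro X ⟨-, hX⟩
    obtain ⟨l, rfl⟩ := (h.zero_iff X).1 hX
    exact (h.continuousAt_lineLabel ⟨l, rfl⟩).continuousWithinAt
  · intro l s hs hl
    refine ⟨(x₀ l, y₀ l), ⟨⟨(s, _), ⟨hs, hl⟩, ?_⟩, (h.zero_iff _).2 ⟨l, rfl⟩⟩,
      h.lineLabel_eq rfl⟩
    simp [shift]

lemma exists_isCompact_label_moved (h : IsTransversalCurve u v x₀ y₀ Φ) (hK : IsDisplacement K)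
    {C : Set (ℝ × ℝ)} (hC : IsCompact C) (T : ℝ) :
    ∃ L : Set ℝ, IsCompact L ∧
      ∀ t ≤ T, ∀ l, movedCurve u v x₀ y₀ K t l ∈ C → l ∈ L := by
  obtain ⟨L, hL, hLC⟩ := h.exists_isCompact_label hC (max T 0)
  refine ⟨L, hL, fun t ht l hl => hLC l (K t l) ⟨hK.nonneg t l, ?_⟩ ?_⟩
  · exact (hK.le_max t l).trans (max_le_max_right 0 ht)
  · rwa [movedCurve_eq_shift] at hl

lemma continuous_movedCurve (h : IsTransversalCurve u v x₀ y₀ Φ) (hK : IsDisplacement K) :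
    Continuous fun z : ℝ × ℝ => movedCurve u v x₀ y₀ K z.1 z.2 := by
  have h1 := h.contDiff_fst.continuous
  have h2 := h.contDiff_snd.continuous
  have h3 := hK.continuous
  unfold movedCurve; fun_prop

lemma movedCurve_injective (h : IsTransversalCurve u v x₀ y₀ Φ) (K : ℝ → ℝ → ℝ) (t : ℝ) :
    Function.Injective (movedCurve u v x₀ y₀ K t) := by
  intro l l' hl
  refine h.strictMono_transCoord.injective ?_
  have := congrArg (transCoord u v) hl
  simpa [movedCurve_eq_shift] using this

end IsTransversalCurve

/-! ### Integration along the lines in the direction of the velocity -/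

/-- Coordinates `(η, ξ)` in which the lines in the direction `(u, v)` are the lines `η = const`. -/
def lineChart (u v : ℝ) (z : ℝ × ℝ) : ℝ × ℝ :=
  (-v / (u ^ 2 + v ^ 2) * z.1 + u * z.2, u / (u ^ 2 + v ^ 2) * z.1 + v * z.2)

section LineChart

variable {u v : ℝ}

lemma transCoord_lineChart (hq : 0 < u ^ 2 + v ^ 2) (z : ℝ × ℝ) :
    transCoord u v (lineChart u v z) = z.1 := by
  simp only [transCoord, lineChart]
  field_simp
  ring

lemma shift_lineChart (s η ξ : ℝ) :
    shift u v s (lineChart u v (η, ξ)) = lineChart u v (η, ξ + s) := by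
  simp only [shift, lineChart, Prod.mk.injEq]; constructor <;> ring

lemma measurePreserving_lineChart (hq : 0 < u ^ 2 + v ^ 2) :
    MeasurePreserving (lineChart u v) := by
  have hdet : LinearMap.det (Matrix.toLin (Module.Basis.finTwoProd ℝ) (Module.Basis.finTwoProd ℝ)
      !![-v / (u ^ 2 + v ^ 2), u; u / (u ^ 2 + v ^ 2), v]) = -1 := by
    rw [LinearMap.det_toLin, Matrix.det_fin_two_of]
    field_simp
    ring
  have heq : lineChart u v = Matrix.toLin (Module.Basis.finTwoProd ℝ) (Module.Basis.finTwoProd ℝ)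
      !![-v / (u ^ 2 + v ^ 2), u; u / (u ^ 2 + v ^ 2), v] := by
    funext z
    rw [Matrix.toLin_finTwoProd_apply]; rfl
  refine ⟨by unfold lineChart; fun_prop, ?_⟩
  rw [heq, Measure.map_linearMap_addHaar_eq_smul_addHaar _ (by rw [hdet]; norm_num), hdet]
  norm_num

lemma measurableEmbedding_lineChart (hq : 0 < u ^ 2 + v ^ 2) :
    MeasurableEmbedding (lineChart u v) := by
  refine Continuous.measurableEmbedding (by unfold lineChart; fun_prop) fun z z' h => ?_
  have h1 := congrArg (transCoord u v) h
  rw [transCoord_lineChart hq, transCoord_lineChart hq] at h1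
  simp only [lineChart, h1, Prod.mk.injEq, add_right_inj, mul_eq_mul_left_iff] at h
  refine Prod.ext h1 ?_
  by_contra hne
  simp [h.1.resolve_left hne, h.2.resolve_left hne] at hq

lemma integrable_comp_lineChart (hq : 0 < u ^ 2 + v ^ 2) {g : ℝ × ℝ → ℝ} (hg : Integrable g) :
    Integrable (fun z => g (lineChart u v z)) (volume.prod volume) :=
  ((measurePreserving_lineChart hq).integrable_comp_emb (measurableEmbedding_lineChart hq)).2 hg

lemma integral_eq_integral_lineChart (hq : 0 < u ^ 2 + v ^ 2) {g : ℝ × ℝ → ℝ}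
    (hg : Integrable g) : ∫ X, g X = ∫ η, ∫ ξ, g (lineChart u v (η, ξ)) := by
  rw [← (measurePreserving_lineChart hq).integral_comp (measurableEmbedding_lineChart hq)]
  exact integral_prod _ (integrable_comp_lineChart hq hg)

lemma hasCompactSupport_comp_shift (hq : 0 < u ^ 2 + v ^ 2) {f : ℝ × ℝ → ℝ}
    (hf : HasCompactSupport f) (X : ℝ × ℝ) : HasCompactSupport fun s => f (shift u v s X) := by
  refine hf.comp_isClosedEmbedding (Function.LeftInverse.isClosedEmbedding
    (f := fun Y : ℝ × ℝ => (u * (Y.1 - X.1) + v * (Y.2 - X.2)) / (u ^ 2 + v ^ 2)) (fun s => ?_)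
    (by fun_prop) (continuous_id.shift continuous_const))
  simp only [shift]
  rw [div_eq_iff hq.ne']
  ring

/-- The derivative in the direction `(u, v)`. -/
def dirDeriv (u v : ℝ) (f : ℝ × ℝ → ℝ) (X : ℝ × ℝ) : ℝ := u * partialX f X + v * partialY f X

lemma hasDerivAt_comp_shift {f : ℝ × ℝ → ℝ} (hf : ContDiff ℝ 1 f) (X : ℝ × ℝ) (s : ℝ) :
    HasDerivAt (fun s => f (shift u v s X)) (dirDeriv u v f (shift u v s X)) s := by
  have h1 : HasDerivAt (fun s => shift u v s X) (u, v) s := by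
    have hx : HasDerivAt (fun s : ℝ => X.1 + s * u) u s := by
      simpa using ((hasDerivAt_id' s).mul_const u).const_add X.1
    have hy : HasDerivAt (fun s : ℝ => X.2 + s * v) v s := by
      simpa using ((hasDerivAt_id' s).mul_const v).const_add X.2
    exact hx.prodMk hy
  have h2 := ((hf.differentiable one_ne_zero) (shift u v s X)).hasFDerivAt.comp_hasDerivAt s h1
  refine h2.congr_deriv ?_
  have : ((u, v) : ℝ × ℝ) = u • (1, 0) + v • (0, 1) := by simp
  rw [this, map_add, map_smul, map_smul]
  rfl

lemma continuous_partialX {f : ℝ × ℝ → ℝ} (hf : ContDiff ℝ 1 f) : Continuous (partialX f) :=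
  (hf.continuous_fderiv one_ne_zero).clm_apply continuous_const

lemma continuous_partialY {f : ℝ × ℝ → ℝ} (hf : ContDiff ℝ 1 f) : Continuous (partialY f) :=
  (hf.continuous_fderiv one_ne_zero).clm_apply continuous_const

lemma isTestFunction_partialX {f : ℝ × ℝ → ℝ} (hf : IsC1TestFunction f) :
    IsTestFunction (partialX f) :=
  ⟨continuous_partialX hf.1, hf.2.fderiv_apply ℝ _⟩

lemma isTestFunction_partialY {f : ℝ × ℝ → ℝ} (hf : IsC1TestFunction f) :
    IsTestFunction (partialY f) :=
  ⟨continuous_partialY hf.1, hf.2.fderiv_apply ℝ _⟩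

lemma IsTestFunction.const_mul {φ : ℝ × ℝ → ℝ} (hφ : IsTestFunction φ) (c : ℝ) :
    IsTestFunction fun X => c * φ X :=
  ⟨continuous_const.mul hφ.1, hφ.2.mul_left⟩

lemma isTestFunction_dirDeriv {f : ℝ × ℝ → ℝ} (hf : IsC1TestFunction f) :
    IsTestFunction (dirDeriv u v f) :=
  ⟨((isTestFunction_partialX hf).const_mul u).1.add ((isTestFunction_partialY hf).const_mul v).1,
    ((isTestFunction_partialX hf).const_mul u).2.add ((isTestFunction_partialY hf).const_mul v).2⟩

lemma IsTestFunction.integrable {φ : ℝ × ℝ → ℝ} (hφ : IsTestFunction φ) : Integrable φ :=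
  hφ.1.integrable_of_hasCompactSupport hφ.2

lemma IsC1TestFunction.isTestFunction {f : ℝ × ℝ → ℝ} (hf : IsC1TestFunction f) :
    IsTestFunction f := ⟨hf.1.continuous, hf.2⟩

lemma contDiff_comp_shift {f : ℝ × ℝ → ℝ} (hf : ContDiff ℝ 1 f) (X : ℝ × ℝ) :
    ContDiff ℝ 1 fun s => f (shift u v s X) := by
  refine hf.comp ?_
  unfold shift; fun_prop

end LineChart

namespace IsTransversalCurve

variable {u v : ℝ} {x₀ y₀ : ℝ → ℝ} {Φ : ℝ × ℝ → ℝ} {K : ℝ → ℝ → ℝ}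

lemma integral_lineChart_transCoord (h : IsTransversalCurve u v x₀ y₀ Φ) (g : ℝ × ℝ → ℝ) (l : ℝ) :
    ∫ ξ, g (lineChart u v (transCoord u v (x₀ l, y₀ l), ξ)) =
      ∫ s, g (shift u v s (x₀ l, y₀ l)) := by
  obtain ⟨r, hr⟩ := h.exists_shift_eq (l := l)
    (X := lineChart u v (transCoord u v (x₀ l, y₀ l), 0))
    (by rw [transCoord_lineChart h.velocity_sq_pos])
  rw [← integral_add_left_eq_self (fun s => g (shift u v s (x₀ l, y₀ l))) r]
  congr 1
  funext ξ
  rw [add_comm, ← zero_add ξ, ← shift_lineChart, hr, shift_shift, zero_add, add_comm]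

lemma integral_range_transCoord (h : IsTransversalCurve u v x₀ y₀ Φ) (F : ℝ → ℝ) :
    ∫ η in range (fun l => transCoord u v (x₀ l, y₀ l)), F η =
      ∫ l, crossSpeed u v x₀ y₀ l * F (transCoord u v (x₀ l, y₀ l)) := by
  rw [← image_univ, integral_image_eq_integral_abs_deriv_smul MeasurableSet.univ
    (fun l _ => (h.hasStrictDerivAt_transCoord l).hasDerivAt.hasDerivWithinAt)
    h.strictMono_transCoord.injective.injOn, setIntegral_univ]
  simp only [abs_of_pos (h.crossSpeed_pos _), smul_eq_mul]

/-- Fubini's theorem along the lines in the direction `(u, v)`, those that meet the front being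
parametrized by its label. -/
lemma integral_eq_integral_lines (h : IsTransversalCurve u v x₀ y₀ Φ) {g : ℝ × ℝ → ℝ}
    (hg : Integrable g) :
    ∫ X, g X = (∫ l, crossSpeed u v x₀ y₀ l * ∫ s, g (shift u v s (x₀ l, y₀ l))) +
      ∫ η in (range fun l => transCoord u v (x₀ l, y₀ l))ᶜ, ∫ ξ, g (lineChart u v (η, ξ)) := by
  have hq := h.velocity_sq_pos
  rw [integral_eq_integral_lineChart hq hg, ← integral_add_compl
    h.isOpenEmbedding_transCoord.isOpen_range.measurableSet
    (integrable_comp_lineChart hq hg).integral_prod_left, h.integral_range_transCoord]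
  simp only [h.integral_lineChart_transCoord]

lemma measurableSet_movedLevel_pos (h : IsTransversalCurve u v x₀ y₀ Φ) (hK : IsDisplacement K)
    (t : ℝ) : MeasurableSet {X | 0 < movedLevel u v x₀ y₀ Φ K t X} :=
  (h.isOpen_movedLevel_pos_at hK t).measurableSet

lemma _root_.measurable_heavisideStep_comp {σ : ℝ × ℝ → ℝ} (hσ : MeasurableSet {X | 0 < σ X}) :
    Measurable fun X => heavisideStep (σ X) :=
  Measurable.ite hσ measurable_const measurable_const

lemma _root_.integrable_mul_heavisideStep {φ σ : ℝ × ℝ → ℝ} (hφ : Integrable φ)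
    (hσ : MeasurableSet {X | 0 < σ X}) : Integrable fun X => φ X * heavisideStep (σ X) := by
  refine hφ.mul_bdd (c := 1) (measurable_heavisideStep_comp hσ).aestronglyMeasurable
    (Eventually.of_forall fun X => ?_)
  unfold heavisideStep
  split_ifs <;> simp

lemma measurableSet_level_pos (h : IsTransversalCurve u v x₀ y₀ Φ) :
    MeasurableSet {X | 0 < Φ X} :=
  (isOpen_lt continuous_const h.continuous_level).measurableSet

/-- The region swept by the front up to time `t`, line by line. -/
lemma integral_mul_heavisideStep_sub (h : IsTransversalCurve u v x₀ y₀ Φ) (hK : IsDisplacement K)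
    {φ : ℝ × ℝ → ℝ} (hφ : Integrable φ) (t : ℝ) :
    (∫ X, φ X * heavisideStep (Φ X)) -
        ∫ X, φ X * heavisideStep (movedLevel u v x₀ y₀ Φ K t X) =
      ∫ l, crossSpeed u v x₀ y₀ l * ∫ s in (0 : ℝ)..K t l, φ (shift u v s (x₀ l, y₀ l)) := by
  have h1 := integrable_mul_heavisideStep hφ h.measurableSet_level_pos
  have h2 := integrable_mul_heavisideStep hφ (h.measurableSet_movedLevel_pos hK t)
  rw [← integral_sub h1 h2, h.integral_eq_integral_lines (h1.sub' h2)]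
  have hoff : ∀ η ∈ (range fun l => transCoord u v (x₀ l, y₀ l))ᶜ,
      ∫ ξ, (φ (lineChart u v (η, ξ)) * heavisideStep (Φ (lineChart u v (η, ξ))) -
        φ (lineChart u v (η, ξ)) *
          heavisideStep (movedLevel u v x₀ y₀ Φ K t (lineChart u v (η, ξ)))) = 0 := by
    intro η hη
    refine integral_eq_zero_of_ae (Eventually.of_forall fun ξ => ?_)
    have : transCoord u v (lineChart u v (η, ξ)) ∉ range fun l => transCoord u v (x₀ l, y₀ l) := by
      rwa [transCoord_lineChart h.velocity_sq_pos]
    simp only [movedLevel_of_notMem this, sub_self, Pi.zero_apply]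
  rw [setIntegral_congr_fun h.isOpenEmbedding_transCoord.isOpen_range.measurableSet.compl hoff,
    integral_zero, add_zero]
  congr 1
  funext l
  congr 1
  rw [intervalIntegral.integral_of_le (hK.nonneg t l), ← integral_indicator measurableSet_Ioc]
  congr 1
  funext s
  have h3 : 0 < Φ (shift u v s (x₀ l, y₀ l)) ↔ 0 < s := by
    have := h.movedLevel_shift_curve_pos_iff (fun _ _ => 0) 0 l s
    rwa [movedLevel_eq_of_zero (fun _ => rfl)] at this
  simp only [heavisideStep, h3, h.movedLevel_shift_curve_pos_iff, indicator, mem_Ioc]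
  have := hK.nonneg t l
  by_cases hs : 0 < s
  · by_cases hs' : K t l < s
    · simp [hs, hs', hs'.not_ge]
    · simp [hs, hs', not_lt.1 hs']
  · have : ¬ K t l < s := fun h4 => hs (this.trans_lt h4)
    simp [hs, this]

lemma continuous_integral_shift (h : IsTransversalCurve u v x₀ y₀ Φ) (hK : IsDisplacement K)
    {φ : ℝ × ℝ → ℝ} (hφ : Continuous φ) :
    Continuous fun z : ℝ × ℝ => ∫ s in (0 : ℝ)..K z.1 z.2, φ (shift u v s (x₀ z.2, y₀ z.2)) := by
  have hc : Continuous (Function.uncurry fun (z : ℝ × ℝ) (s : ℝ) =>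
      φ (shift u v s (x₀ z.2, y₀ z.2))) :=
    hφ.comp (continuous_snd.shift
      (h.continuous_curve.comp (continuous_snd.comp continuous_fst)))
  exact intervalIntegral.continuous_parametric_intervalIntegral_of_continuous hc hK.continuous

/-- The time-dependent part of `jumpDelta` on the moving front, as an integral over the label. -/
def _root_.frontIntegrand (u v : ℝ) (x₀ y₀ : ℝ → ℝ) (K D : ℝ → ℝ → ℝ) (δ : ℝ) (φ : ℝ × ℝ → ℝ)
    (t l : ℝ) : ℝ :=
  δ * (crossSpeed u v x₀ y₀ l * ∫ s in (0 : ℝ)..K t l, φ (shift u v s (x₀ l, y₀ l))) +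
    φ (movedCurve u v x₀ y₀ K t l) * D t l

lemma exists_isCompact_support (h : IsTransversalCurve u v x₀ y₀ Φ) (hK : IsDisplacement K)
    {φ : ℝ × ℝ → ℝ} (hφ : HasCompactSupport φ) (T : ℝ) :
    ∃ L : Set ℝ, IsCompact L ∧ ∀ t ≤ T, ∀ l, l ∉ L →
      (∫ s in (0 : ℝ)..K t l, φ (shift u v s (x₀ l, y₀ l))) = 0 ∧
      φ (movedCurve u v x₀ y₀ K t l) = 0 := by
  obtain ⟨L, hL, hLC⟩ := h.exists_isCompact_label hφ.isCompact (max T 0)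
  refine ⟨L, hL, fun t ht l hl => ?_⟩
  have hKT : K t l ≤ max T 0 := (hK.le_max t l).trans (max_le_max_right 0 ht)
  have h0 : ∀ s ∈ Icc 0 (max T 0), φ (shift u v s (x₀ l, y₀ l)) = 0 := fun s hs =>
    image_eq_zero_of_notMem_tsupport fun hmem => hl (hLC l s hs hmem)
  constructor
  · refine intervalIntegral.integral_zero_ae (Eventually.of_forall fun s hs => ?_)
    rw [uIoc_of_le (hK.nonneg t l)] at hs
    exact h0 s ⟨hs.1.le, hs.2.trans hKT⟩
  · rw [movedCurve_eq_shift]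
    exact h0 _ ⟨hK.nonneg t l, hKT⟩

lemma continuous_frontIntegrand (h : IsTransversalCurve u v x₀ y₀ Φ) (hK : IsDisplacement K)
    {D : ℝ → ℝ → ℝ} (hD : Continuous fun z : ℝ × ℝ => D z.1 z.2) (δ : ℝ) {φ : ℝ × ℝ → ℝ}
    (hφ : Continuous φ) :
    Continuous fun z : ℝ × ℝ => frontIntegrand u v x₀ y₀ K D δ φ z.1 z.2 := by
  have h1 := h.continuous_integral_shift hK hφ
  have h2 := h.continuous_crossSpeed
  have h3 := h.continuous_movedCurve hK
  unfold frontIntegrand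
  fun_prop

/-- Only the integral over the label depends on the time: the first term is the contribution of the
initial regions. -/
lemma jumpDelta_movedLevel (h : IsTransversalCurve u v x₀ y₀ Φ) (hK : IsDisplacement K)
    {D : ℝ → ℝ → ℝ} (hD : Continuous fun z : ℝ × ℝ => D z.1 z.2) (cm cp : ℝ) {φ : ℝ × ℝ → ℝ}
    (hφ : IsTestFunction φ) (t : ℝ) :
    jumpDelta cm cp (movedLevel u v x₀ y₀ Φ K t) (movedCurve u v x₀ y₀ K t) (D t) φ =
      (∫ X, φ X * jumpField cm cp Φ X) +
        ∫ l, frontIntegrand u v x₀ y₀ K D (cm - cp) φ t l := by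
  obtain ⟨L, hL, hL0⟩ := h.exists_isCompact_support hK hφ.2 t
  have hjump : ∀ σ : ℝ × ℝ → ℝ, MeasurableSet {X | 0 < σ X} →
      ∫ X, φ X * jumpField cm cp σ X =
        cm * (∫ X, φ X) - (cm - cp) * ∫ X, φ X * heavisideStep (σ X) := fun σ hσ => by
    rw [← integral_const_mul, ← integral_const_mul, ← integral_sub (hφ.integrable.const_mul _)
      ((integrable_mul_heavisideStep hφ.integrable hσ).const_mul _)]
    congr 1
    funext X
    simp only [jumpField]
    ring
  have hc1 : Continuous fun l => crossSpeed u v x₀ y₀ l *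
      ∫ s in (0 : ℝ)..K t l, φ (shift u v s (x₀ l, y₀ l)) :=
    h.continuous_crossSpeed.mul
      ((h.continuous_integral_shift hK hφ.1).comp (Continuous.prodMk_right t))
  have hc2 : Continuous fun l => φ (movedCurve u v x₀ y₀ K t l) * D t l :=
    (hφ.1.comp ((h.continuous_movedCurve hK).comp (Continuous.prodMk_right t))).mul
      (hD.comp (Continuous.prodMk_right t))
  have hi1 := hc1.integrable_of_hasCompactSupport (μ := volume)
    (HasCompactSupport.intro hL fun l hl => by simp [(hL0 t le_rfl l hl).1])
  have hi2 := hc2.integrable_of_hasCompactSupport (μ := volume)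
    (HasCompactSupport.intro hL fun l hl => by simp [(hL0 t le_rfl l hl).2])
  simp only [frontIntegrand]
  rw [jumpDelta, hjump _ (h.measurableSet_movedLevel_pos hK t), hjump _ h.measurableSet_level_pos,
    integral_add (hi1.const_mul _) hi2, integral_const_mul,
    ← h.integral_mul_heavisideStep_sub hK hφ.integrable t]
  ring

lemma continuous_jumpDelta_movedLevel (h : IsTransversalCurve u v x₀ y₀ Φ) (hK : IsDisplacement K)
    {D : ℝ → ℝ → ℝ} (hD : Continuous fun z : ℝ × ℝ => D z.1 z.2) (cm cp : ℝ) {φ : ℝ × ℝ → ℝ}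
    (hφ : IsTestFunction φ) :
    Continuous fun t => jumpDelta cm cp (movedLevel u v x₀ y₀ Φ K t)
      (movedCurve u v x₀ y₀ K t) (D t) φ := by
  simp only [h.jumpDelta_movedLevel hK hD cm cp hφ]
  refine continuous_const.add (continuous_iff_continuousAt.2 fun t => ?_)
  obtain ⟨L, hL, hL0⟩ := h.exists_isCompact_support hK hφ.2 (t + 1)
  refine (continuousOn_integral_of_compact_support hL
    (h.continuous_frontIntegrand hK hD (cm - cp) hφ.1).continuousOn
    fun s l hs hl => ?_).continuousAt (Iic_mem_nhds (lt_add_one t))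
  simp [frontIntegrand, hL0 s hs l hl]

/-- The divergence theorem for the region behind the front. -/
lemma integral_dirDeriv_behind (h : IsTransversalCurve u v x₀ y₀ Φ) (hK : IsDisplacement K)
    {f : ℝ × ℝ → ℝ} (hf : IsC1TestFunction f) (t : ℝ) :
    ∫ X, dirDeriv u v f X * (1 - heavisideStep (movedLevel u v x₀ y₀ Φ K t X)) =
      ∫ l, crossSpeed u v x₀ y₀ l * f (movedCurve u v x₀ y₀ K t l) := by
  have hq := h.velocity_sq_pos
  have hD := (isTestFunction_dirDeriv (u := u) (v := v) hf).integrable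
  have hi : Integrable fun X => dirDeriv u v f X *
      (1 - heavisideStep (movedLevel u v x₀ y₀ Φ K t X)) := by
    simp only [mul_sub, mul_one]
    exact hD.sub (integrable_mul_heavisideStep hD (h.measurableSet_movedLevel_pos hK t))
  have hderiv : ∀ X : ℝ × ℝ, (fun s => dirDeriv u v f (shift u v s X)) =
      deriv fun s => f (shift u v s X) := fun X => by
    funext s; exact (hasDerivAt_comp_shift hf.1 X s).deriv.symm
  rw [h.integral_eq_integral_lines hi]
  have hoff : ∀ η ∈ (range fun l => transCoord u v (x₀ l, y₀ l))ᶜ,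
      ∫ ξ, dirDeriv u v f (lineChart u v (η, ξ)) *
        (1 - heavisideStep (movedLevel u v x₀ y₀ Φ K t (lineChart u v (η, ξ)))) = 0 := by
    intro η hη
    have hη' : ∀ ξ, transCoord u v (lineChart u v (η, ξ)) ∉
        range fun l => transCoord u v (x₀ l, y₀ l) := fun ξ => by
      rwa [transCoord_lineChart hq]
    have hshift : ∀ ξ, lineChart u v (η, ξ) = shift u v ξ (lineChart u v (η, 0)) := fun ξ => by
      rw [shift_lineChart, zero_add]
    simp only [movedLevel_of_notMem (hη' _)]
    by_cases hp : 0 < Φ (lineChart u v (η, 0))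
    · refine integral_eq_zero_of_ae (Eventually.of_forall fun ξ => ?_)
      have := h.level_shift_pos (hη' 0) hp ξ
      rw [← hshift] at this
      simp [heavisideStep, this]
    · have hneg : ∀ ξ, ¬ 0 < Φ (lineChart u v (η, ξ)) := fun ξ hpos => hp (by
        have := h.level_shift_pos (hη' ξ) hpos (-ξ)
        rwa [shift_lineChart, add_neg_cancel] at this)
      simp only [heavisideStep, hneg, if_false, sub_zero, mul_one]
      rw [show (fun ξ => dirDeriv u v f (lineChart u v (η, ξ))) =
        deriv fun s => f (shift u v s (lineChart u v (η, 0))) by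
          rw [← hderiv]; funext ξ; rw [hshift]]
      have hc := contDiff_comp_shift (u := u) (v := v) hf.1 (lineChart u v (η, 0))
      have hs := hasCompactSupport_comp_shift hq hf.2 (lineChart u v (η, 0))
      have hint :=
        (hc.continuous_deriv le_rfl).integrable_of_hasCompactSupport (μ := volume) hs.deriv
      rw [← integral_add_compl (measurableSet_Iic (a := (0 : ℝ))) hint, compl_Iic,
        hs.integral_Iic_deriv_eq hc, hs.integral_Ioi_deriv_eq hc, add_neg_cancel]
  rw [setIntegral_congr_fun h.isOpenEmbedding_transCoord.isOpen_range.measurableSet.compl hoff,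
    integral_zero, add_zero]
  congr 1
  funext l
  congr 1
  rw [movedCurve_eq_shift,
    ← (hasCompactSupport_comp_shift hq hf.2 (x₀ l, y₀ l)).integral_Iic_deriv_eq
    (contDiff_comp_shift hf.1 _), ← integral_indicator measurableSet_Iic]
  congr 1
  funext s
  simp only [heavisideStep, h.movedLevel_shift_curve_pos_iff, indicator, mem_Iic, ← hderiv]
  by_cases hs : K t l < s
  · simp [hs, hs.not_ge]
  · simp [hs, not_lt.1 hs]

end IsTransversalCurve

/-! ### Balance laws on the moving front -/

namespace IsTransversalCurve

variable {u v : ℝ} {x₀ y₀ : ℝ → ℝ} {Φ : ℝ × ℝ → ℝ} {K k D : ℝ → ℝ → ℝ} {ϱ δ : ℝ}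

/-- The time derivative of `frontIntegrand` when `D` satisfies its balance law. -/
def _root_.frontFlux (u v : ℝ) (x₀ y₀ : ℝ → ℝ) (K k D : ℝ → ℝ → ℝ) (ϱ : ℝ) (f : ℝ × ℝ → ℝ)
    (t l : ℝ) : ℝ :=
  ϱ * (crossSpeed u v x₀ y₀ l * f (movedCurve u v x₀ y₀ K t l)) +
    dirDeriv u v f (movedCurve u v x₀ y₀ K t l) * (D t l * k t l)

lemma hasDerivAt_frontIntegrand {f : ℝ × ℝ → ℝ} (hf : IsC1TestFunction f) {t l : ℝ}
    (hK' : HasDerivAt (fun τ => K τ l) (k t l) t)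
    (hD' : HasDerivAt (fun τ => D τ l) (crossSpeed u v x₀ y₀ l * (ϱ - δ * k t l)) t) :
    HasDerivAt (fun τ => frontIntegrand u v x₀ y₀ K D δ f τ l)
      (frontFlux u v x₀ y₀ K k D ϱ f t l) t := by
  have hc := (contDiff_comp_shift (u := u) (v := v) hf.1 (x₀ l, y₀ l)).continuous
  have h1 : HasDerivAt (fun τ => ∫ s in (0 : ℝ)..K τ l, f (shift u v s (x₀ l, y₀ l)))
      (f (shift u v (K t l) (x₀ l, y₀ l)) * k t l) t :=
    HasDerivAt.comp t (h₂ := fun b => ∫ s in (0 : ℝ)..b, f (shift u v s (x₀ l, y₀ l)))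
      (hc.integral_hasStrictDerivAt 0 (K t l)).hasDerivAt hK'
  have h2 : HasDerivAt (fun τ => f (shift u v (K τ l) (x₀ l, y₀ l)))
      (dirDeriv u v f (shift u v (K t l) (x₀ l, y₀ l)) * k t l) t :=
    HasDerivAt.comp t (h₂ := fun s => f (shift u v s (x₀ l, y₀ l)))
      (hasDerivAt_comp_shift hf.1 _ _) hK'
  simp only [frontIntegrand, frontFlux, movedCurve_eq_shift]
  refine (((h1.const_mul (crossSpeed u v x₀ y₀ l)).const_mul δ).add (h2.mul hD')).congr_deriv ?_
  ring

lemma continuousOn_frontFlux (h : IsTransversalCurve u v x₀ y₀ Φ) (hK : IsDisplacement K)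
    (hk : ContinuousOn (fun z : ℝ × ℝ => k z.1 z.2) (Ioi 0 ×ˢ univ))
    (hD : Continuous fun z : ℝ × ℝ => D z.1 z.2) {f : ℝ × ℝ → ℝ} (hf : IsC1TestFunction f) :
    ContinuousOn (fun z : ℝ × ℝ => frontFlux u v x₀ y₀ K k D ϱ f z.1 z.2) (Ioi 0 ×ˢ univ) := by
  have h2 : Continuous fun z : ℝ × ℝ => crossSpeed u v x₀ y₀ z.2 :=
    h.continuous_crossSpeed.comp continuous_snd
  have h3 := h.continuous_movedCurve hK
  have h4 : Continuous fun z : ℝ × ℝ => f (movedCurve u v x₀ y₀ K z.1 z.2) :=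
    hf.1.continuous.comp h3
  have h5 : Continuous fun z : ℝ × ℝ => dirDeriv u v f (movedCurve u v x₀ y₀ K z.1 z.2) :=
    (isTestFunction_dirDeriv hf).1.comp h3
  unfold frontFlux
  exact (continuous_const.mul (h2.mul h4)).continuousOn.add
    (h5.continuousOn.mul (hD.continuousOn.mul hk))

lemma exists_isCompact_frontFlux (h : IsTransversalCurve u v x₀ y₀ Φ) (hK : IsDisplacement K)
    {f : ℝ × ℝ → ℝ} (hf : IsC1TestFunction f) (T : ℝ) :
    ∃ L : Set ℝ, IsCompact L ∧ ∀ t ≤ T, ∀ l, l ∉ L → f (movedCurve u v x₀ y₀ K t l) = 0 ∧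
      dirDeriv u v f (movedCurve u v x₀ y₀ K t l) = 0 := by
  obtain ⟨L, hL, hL0⟩ := h.exists_isCompact_support hK hf.2 T
  obtain ⟨L', hL', hL0'⟩ := h.exists_isCompact_support hK
    (isTestFunction_dirDeriv (u := u) (v := v) hf).2 T
  exact ⟨L ∪ L', hL.union hL', fun t ht l hl =>
    ⟨(hL0 t ht l fun h => hl (.inl h)).2, (hL0' t ht l fun h => hl (.inr h)).2⟩⟩

lemma jumpDelta_dirDeriv (h : IsTransversalCurve u v x₀ y₀ Φ) (hK : IsDisplacement K)
    (hk : ContinuousOn (fun z : ℝ × ℝ => k z.1 z.2) (Ioi 0 ×ˢ univ))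
    (hD : Continuous fun z : ℝ × ℝ => D z.1 z.2) {f : ℝ × ℝ → ℝ} (hf : IsC1TestFunction f)
    {t : ℝ} (ht : 0 < t) :
    jumpDelta ϱ 0 (movedLevel u v x₀ y₀ Φ K t) (movedCurve u v x₀ y₀ K t)
        (fun l => D t l * k t l) (dirDeriv u v f) =
      ∫ l, frontFlux u v x₀ y₀ K k D ϱ f t l := by
  obtain ⟨L, hL, hL0⟩ := h.exists_isCompact_frontFlux hK hf t
  have hkt : Continuous fun l => k t l :=
    continuousOn_univ.1 (hk.comp (Continuous.prodMk_right t).continuousOn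
      fun l _ => ⟨ht, mem_univ l⟩)
  have h3 : Continuous fun l => movedCurve u v x₀ y₀ K t l :=
    (h.continuous_movedCurve hK).comp (Continuous.prodMk_right t)
  have hDt : Continuous fun l => D t l := hD.comp (Continuous.prodMk_right t)
  have hi1 :=
    (h.continuous_crossSpeed.mul (hf.1.continuous.comp h3)).integrable_of_hasCompactSupport
    (μ := volume) (HasCompactSupport.intro hL fun l hl => by
      simp [(hL0 t le_rfl l hl).1])
  have hi2 := (((isTestFunction_dirDeriv (u := u) (v := v) hf).1.comp h3).mul
    (hDt.mul hkt)).integrable_of_hasCompactSupport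
    (μ := volume) (HasCompactSupport.intro hL fun l hl => by
      simp [(hL0 t le_rfl l hl).2])
  simp only [frontFlux]
  refine Eq.trans ?_ (integral_add (hi1.const_mul ϱ) hi2).symm
  rw [integral_const_mul, jumpDelta]
  congr 1
  refine Eq.trans ?_ (congrArg (ϱ * ·) (h.integral_dirDeriv_behind hK hf t))
  rw [← integral_const_mul]
  congr 1
  funext X
  simp only [jumpField]
  ring

/-- The weak balance law over the time interval `[t₁, t₂]`, provided that the density `D` on the
front collects what the front overtakes. -/
lemma jumpDelta_sub_eq_integral (h : IsTransversalCurve u v x₀ y₀ Φ) (hK : IsDisplacement K)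
    (hk : ContinuousOn (fun z : ℝ × ℝ => k z.1 z.2) (Ioi 0 ×ˢ univ))
    (hD : Continuous fun z : ℝ × ℝ => D z.1 z.2) {cm cp : ℝ}
    (hK' : ∀ t > 0, ∀ l, HasDerivAt (fun τ => K τ l) (k t l) t)
    (hD' : ∀ t > 0, ∀ l,
      HasDerivAt (fun τ => D τ l) (crossSpeed u v x₀ y₀ l * (ϱ - (cm - cp) * k t l)) t)
    {f : ℝ × ℝ → ℝ} (hf : IsC1TestFunction f) {t₁ t₂ : ℝ} (h1 : 0 < t₁) (h12 : t₁ < t₂) :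
    IntervalIntegrable (fun τ => jumpDelta ϱ 0 (movedLevel u v x₀ y₀ Φ K τ)
      (movedCurve u v x₀ y₀ K τ) (fun l => D τ l * k τ l) (dirDeriv u v f)) volume t₁ t₂ ∧
    jumpDelta cm cp (movedLevel u v x₀ y₀ Φ K t₂) (movedCurve u v x₀ y₀ K t₂) (D t₂) f -
        jumpDelta cm cp (movedLevel u v x₀ y₀ Φ K t₁) (movedCurve u v x₀ y₀ K t₁) (D t₁) f =
      ∫ τ in t₁..t₂, jumpDelta ϱ 0 (movedLevel u v x₀ y₀ Φ K τ)
        (movedCurve u v x₀ y₀ K τ) (fun l => D τ l * k τ l) (dirDeriv u v f) := by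
  obtain ⟨L, hL, hL0⟩ := h.exists_isCompact_frontFlux hK hf t₂
  obtain ⟨L', hL', hL0'⟩ := h.exists_isCompact_support hK hf.2 t₂
  have hcF := h.continuousOn_frontFlux (ϱ := ϱ) hK hk hD hf
  have hint : Integrable (Function.uncurry fun t l => frontFlux u v x₀ y₀ K k D ϱ f t l)
      ((volume.restrict (uIoc t₁ t₂)).prod volume) := by
    have h2 : IntegrableOn (fun z : ℝ × ℝ => frontFlux u v x₀ y₀ K k D ϱ f z.1 z.2)
        (Icc t₁ t₂ ×ˢ L) (volume.prod volume) :=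
      (hcF.mono (prod_mono (fun t ht => h1.trans_le ht.1) (subset_univ _))).integrableOn_compact
        (isCompact_Icc.prod hL)
    have h3 : IntegrableOn (fun z : ℝ × ℝ => frontFlux u v x₀ y₀ K k D ϱ f z.1 z.2)
        (uIoc t₁ t₂ ×ˢ univ) (volume.prod volume) := by
      refine h2.of_forall_sdiff_eq_zero (measurableSet_uIoc.prod MeasurableSet.univ) ?_
      rintro ⟨t, l⟩ ⟨⟨ht, -⟩, htl⟩
      rw [uIoc_of_le h12.le] at ht
      have hl : l ∉ L := fun hl => htl ⟨⟨ht.1.le, ht.2⟩, hl⟩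
      simp [frontFlux, hL0 t ht.2 l hl]
    rwa [IntegrableOn, ← Measure.prod_restrict, Measure.restrict_univ] at h3
  have hpos : ∀ τ ∈ uIoc t₁ t₂, 0 < τ := fun τ hτ => by
    rw [uIoc_of_le h12.le] at hτ; exact h1.trans hτ.1
  have hflux : ∀ τ ∈ uIoc t₁ t₂, ∫ l, frontFlux u v x₀ y₀ K k D ϱ f τ l =
      jumpDelta ϱ 0 (movedLevel u v x₀ y₀ Φ K τ)
        (movedCurve u v x₀ y₀ K τ) (fun l => D τ l * k τ l) (dirDeriv u v f) :=
    fun τ hτ => (h.jumpDelta_dirDeriv hK hk hD hf (hpos τ hτ)).symm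
  have hiE : ∀ t ≤ t₂, Integrable fun l => frontIntegrand u v x₀ y₀ K D (cm - cp) f t l :=
    fun t ht => ((h.continuous_frontIntegrand hK hD (cm - cp) hf.1.continuous).comp
      (Continuous.prodMk_right t)).integrable_of_hasCompactSupport
      (HasCompactSupport.intro hL' fun l hl => by simp [frontIntegrand, hL0' t ht l hl])
  constructor
  · rw [intervalIntegrable_iff]
    exact hint.integral_prod_left.congr ((ae_restrict_iff' measurableSet_uIoc).2
      (Eventually.of_forall hflux))
  · rw [h.jumpDelta_movedLevel hK hD cm cp hf.isTestFunction,
      h.jumpDelta_movedLevel hK hD cm cp hf.isTestFunction, add_sub_add_left_eq_sub,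
      ← integral_sub (hiE t₂ le_rfl) (hiE t₁ h12.le)]
    have hFTC : ∀ l, frontIntegrand u v x₀ y₀ K D (cm - cp) f t₂ l -
        frontIntegrand u v x₀ y₀ K D (cm - cp) f t₁ l =
        ∫ τ in t₁..t₂, frontFlux u v x₀ y₀ K k D ϱ f τ l := fun l => by
      have hsub : uIcc t₁ t₂ ⊆ Ioi 0 := by
        rw [uIcc_of_le h12.le]; exact fun t ht => h1.trans_le ht.1
      refine (intervalIntegral.integral_eq_sub_of_hasDerivAt
        (fun τ hτ => hasDerivAt_frontIntegrand hf (hK' τ (hsub hτ) l) (hD' τ (hsub hτ) l)) ?_).symm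
      exact (hcF.comp (Continuous.prodMk_left l).continuousOn
        fun τ hτ => ⟨hsub hτ, mem_univ l⟩).intervalIntegrable
    simp only [hFTC]
    rw [← intervalIntegral_integral_swap hint]
    refine intervalIntegral.integral_congr_ae (Eventually.of_forall hflux)

end IsTransversalCurve

/-! ### Mass and momentum measures -/

namespace SignedRadon

/-- The signed measure `c W`. -/
def ofConstMul (W : Measure (ℝ × ℝ)) [IsFiniteMeasureOnCompacts W] (c : ℝ) : SignedRadon where
  pos := ENNReal.ofReal c • W
  neg := ENNReal.ofReal (-c) • W
  finite_pos := .smul W ENNReal.ofReal_ne_top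
  finite_neg := .smul W ENNReal.ofReal_ne_top
  mutuallySingular := by
    rcases le_total 0 c with hc | hc
    · rw [ENNReal.ofReal_of_nonpos (neg_nonpos.2 hc), zero_smul]
      exact Measure.MutuallySingular.zero_right
    · rw [ENNReal.ofReal_of_nonpos hc, zero_smul]
      exact Measure.MutuallySingular.zero_left

variable {M W : Measure (ℝ × ℝ)} [IsFiniteMeasureOnCompacts W] {c c' : ℝ} {θ : ℝ × ℝ → ℝ}

lemma toReal_ofReal_sub_toReal_ofReal_neg (c : ℝ) :
    (ENNReal.ofReal c).toReal - (ENNReal.ofReal (-c)).toReal = c := by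
  rw [ENNReal.toReal_ofReal', ENNReal.toReal_ofReal', max_zero_sub_max_neg_zero_eq_self]

lemma ofConstMul_integral (f : ℝ × ℝ → ℝ) : (ofConstMul W c).integral f = c * ∫ X, f X ∂W := by
  simp only [integral, ofConstMul, integral_smul_measure, smul_eq_mul, ← sub_mul,
    toReal_ofReal_sub_toReal_ofReal_neg]

lemma ofConstMul_variation :
    (ofConstMul W c).variation = (ENNReal.ofReal c + ENNReal.ofReal (-c)) • W :=
  (add_smul _ _ _).symm

lemma ofConstMul_absCont (h : W ≪ M) : (ofConstMul W c).AbsCont M := by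
  rw [AbsCont, ofConstMul_variation]
  exact h.smul_left _

lemma ofConstMul_density [IsFiniteMeasureOnCompacts M] (hθ : Measurable θ) (hθ0 : ∀ X, 0 ≤ θ X)
    (hW : W = M.withDensity fun X => ENNReal.ofReal (θ X)) :
    (ofConstMul W c).density M =ᵐ[M] fun X => c * θ X := by
  have key : ∀ r : ℝ, (ENNReal.ofReal r • W).rnDeriv M =ᵐ[M]
      ENNReal.ofReal r • fun X => ENNReal.ofReal (θ X) := fun r => by
    rw [hW, ← withDensity_smul _ hθ.ennreal_ofReal]
    exact Measure.rnDeriv_withDensity M (hθ.ennreal_ofReal.const_smul _)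
  filter_upwards [key c, key (-c)] with X h1 h2
  simp only [density, ofConstMul, h1, h2, Pi.smul_apply, smul_eq_mul, ENNReal.toReal_mul, ← sub_mul,
    toReal_ofReal_sub_toReal_ofReal_neg, ENNReal.toReal_ofReal (hθ0 X)]

lemma ofConstMul_locallyIntegrable [IsFiniteMeasureOnCompacts M] (hθ : Measurable θ)
    (hθ0 : ∀ X, 0 ≤ θ X) (hθ1 : ∀ X, θ X ≤ 1)
    (hW : W = M.withDensity fun X => ENNReal.ofReal (θ X)) :
    LocallyIntegrable ((ofConstMul W c).density M) (ofConstMul W c').variation := by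
  have hac : (ofConstMul W c').variation ≪ M :=
    ofConstMul_absCont (hW ▸ withDensity_absolutelyContinuous _ _)
  have hfin : IsFiniteMeasureOnCompacts (ofConstMul W c').variation := by
    rw [ofConstMul_variation]
    exact .smul W (by simp)
  refine (locallyIntegrable_const c).mono ?_ ?_
  · refine Measurable.aestronglyMeasurable ?_
    exact (Measure.measurable_rnDeriv _ _).ennreal_toReal.sub
      (Measure.measurable_rnDeriv _ _).ennreal_toReal
  · filter_upwards [hac.ae_le (ofConstMul_density (c := c) hθ hθ0 hW)] with X hX
    rw [hX, norm_mul, Real.norm_of_nonneg (hθ0 X)]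
    exact mul_le_of_le_one_right (norm_nonneg _) (hθ1 X)

end SignedRadon

/-- The positive measure with density `ϱ` where `σ ≤ 0` and `ϱ'` where `0 < σ` that carries in
addition the mass `d(l) dl` on the curve `Γ`. -/
def frontMeasure (ϱ ϱ' : ℝ) (σ : ℝ × ℝ → ℝ) (Γ : ℝ → ℝ × ℝ) (d : ℝ → ℝ) : Measure (ℝ × ℝ) :=
  (volume.withDensity fun X => ENNReal.ofReal (jumpField ϱ ϱ' σ X)) +
    (volume.withDensity fun l => ENNReal.ofReal (d l)).map Γ

open Classical in
/-- The ratio of the velocity to `(u, v)`: `k(l)` at the point `Γ(l)` of the front, and otherwise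
`1` behind the front and `0` ahead of it. -/
def velocityRatio (σ : ℝ × ℝ → ℝ) (Γ : ℝ → ℝ × ℝ) (k : ℝ → ℝ) : ℝ × ℝ → ℝ :=
  Function.extend Γ k fun X => 1 - heavisideStep (σ X)

/-- A curve that is a properly embedded null set. -/
structure IsProperCurve (Γ : ℝ → ℝ × ℝ) : Prop where
  continuous : Continuous Γ
  injective : Function.Injective Γ
  proper : ∀ C, IsCompact C → ∃ L, IsCompact L ∧ Γ ⁻¹' C ⊆ L
  null : volume (range Γ) = 0

section FrontMeasure

variable {ϱ ϱ' : ℝ} {σ : ℝ × ℝ → ℝ} {Γ : ℝ → ℝ × ℝ} {d k : ℝ → ℝ}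

lemma measurable_jumpField (hσ : MeasurableSet {X | 0 < σ X}) (cm cp : ℝ) :
    Measurable (jumpField cm cp σ) :=
  ((measurable_heavisideStep_comp hσ).const_mul _).const_add _

lemma jumpField_nonneg (hϱ : 0 < ϱ) (hϱ' : 0 < ϱ') (X : ℝ × ℝ) : 0 ≤ jumpField ϱ ϱ' σ X := by
  simp only [jumpField, heavisideStep]
  split_ifs <;> linarith

lemma jumpField_le (hϱ : 0 < ϱ) (hϱ' : 0 < ϱ') (X : ℝ × ℝ) :
    jumpField ϱ ϱ' σ X ≤ ϱ + ϱ' := by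
  simp only [jumpField, heavisideStep]
  split_ifs <;> linarith

lemma isFiniteMeasureOnCompacts_of_le {M N : Measure (ℝ × ℝ)} [IsFiniteMeasureOnCompacts M]
    (h : N ≤ M) : IsFiniteMeasureOnCompacts N :=
  ⟨fun _ hC => (h _).trans_lt hC.measure_lt_top⟩

lemma isFiniteMeasureOnCompacts_bulk (hϱ : 0 < ϱ) (hϱ' : 0 < ϱ') :
    IsFiniteMeasureOnCompacts
      (volume.withDensity fun X => ENNReal.ofReal (jumpField ϱ ϱ' σ X)) := by
  have h1 : IsFiniteMeasureOnCompacts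
      (ENNReal.ofReal (ϱ + ϱ') • (volume : Measure (ℝ × ℝ))) := .smul _ ENNReal.ofReal_ne_top
  refine isFiniteMeasureOnCompacts_of_le (M := ENNReal.ofReal (ϱ + ϱ') • volume) ?_
  rw [← withDensity_const]
  exact withDensity_mono (Eventually.of_forall fun X =>
    ENNReal.ofReal_le_ofReal (jumpField_le hϱ hϱ' X))

lemma isFiniteMeasureOnCompacts_curve (hΓ : IsProperCurve Γ) (hd : Continuous d) :
    IsFiniteMeasureOnCompacts ((volume.withDensity fun l => ENNReal.ofReal (d l)).map Γ) := by
  refine ⟨fun C hC => ?_⟩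
  obtain ⟨L, hL, hCL⟩ := hΓ.proper C hC
  have := IsLocallyFiniteMeasure.withDensity_ofReal (μ := (volume : Measure ℝ)) hd
  rw [(hΓ.continuous.measurableEmbedding hΓ.injective).map_apply]
  exact (measure_mono hCL).trans_lt hL.measure_lt_top

lemma isFiniteMeasureOnCompacts_frontMeasure (hϱ : 0 < ϱ) (hϱ' : 0 < ϱ') (hΓ : IsProperCurve Γ)
    (hd : Continuous d) : IsFiniteMeasureOnCompacts (frontMeasure ϱ ϱ' σ Γ d) := by
  have h1 := isFiniteMeasureOnCompacts_bulk (σ := σ) hϱ hϱ'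
  have h2 := isFiniteMeasureOnCompacts_curve hΓ hd
  exact ⟨fun C hC => ENNReal.add_lt_top.2 ⟨hC.measure_lt_top, hC.measure_lt_top⟩⟩

lemma velocityRatio_curve (hΓ : IsProperCurve Γ) (l : ℝ) : velocityRatio σ Γ k (Γ l) = k l :=
  hΓ.injective.extend_apply _ _ _

lemma velocityRatio_of_notMem {X : ℝ × ℝ} (hX : X ∉ range Γ) :
    velocityRatio σ Γ k X = 1 - heavisideStep (σ X) := Function.extend_apply' _ _ _ hX

lemma velocityRatio_mem (hΓ : IsProperCurve Γ) (hk : ∀ l, k l ∈ Icc (0 : ℝ) 1) (X : ℝ × ℝ) :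
    velocityRatio σ Γ k X ∈ Icc (0 : ℝ) 1 := by
  by_cases hX : X ∈ range Γ
  · obtain ⟨l, rfl⟩ := hX
    rw [velocityRatio_curve hΓ]
    exact hk l
  · rw [velocityRatio_of_notMem hX, heavisideStep]
    split_ifs <;> simp

lemma measurable_velocityRatio (hσ : MeasurableSet {X | 0 < σ X}) (hΓ : IsProperCurve Γ)
    (hk : Measurable k) : Measurable (velocityRatio σ Γ k) :=
  (hΓ.continuous.measurableEmbedding hΓ.injective).measurable_extend hk
    ((measurable_heavisideStep_comp hσ).const_sub 1)

lemma integral_frontMeasure (hϱ : 0 < ϱ) (hϱ' : 0 < ϱ') (hσ : MeasurableSet {X | 0 < σ X})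
    (hΓ : IsProperCurve Γ) (hd : Continuous d) (hd0 : ∀ l, 0 ≤ d l) {ψ : ℝ × ℝ → ℝ}
    (hψ : Integrable ψ (frontMeasure ϱ ϱ' σ Γ d)) :
    ∫ X, ψ X ∂(frontMeasure ϱ ϱ' σ Γ d) =
      (∫ X, ψ X * jumpField ϱ ϱ' σ X) + ∫ l, ψ (Γ l) * d l := by
  have h := integrable_add_measure.1 hψ
  rw [frontMeasure, integral_add_measure h.1 h.2,
    (hΓ.continuous.measurableEmbedding hΓ.injective).integral_map,
    integral_withDensity_eq_integral_toReal_smul (measurable_jumpField hσ _ _).ennreal_ofReal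
      (by simp),
    integral_withDensity_eq_integral_toReal_smul hd.measurable.ennreal_ofReal (by simp)]
  simp only [ENNReal.toReal_ofReal (jumpField_nonneg hϱ hϱ' _), ENNReal.toReal_ofReal (hd0 _),
    smul_eq_mul, mul_comm]

lemma integrable_mul_velocityRatio_pow {M : Measure (ℝ × ℝ)} [IsFiniteMeasureOnCompacts M]
    (hσ : MeasurableSet {X | 0 < σ X}) (hΓ : IsProperCurve Γ) (hk : Measurable k)
    (hk01 : ∀ l, k l ∈ Icc (0 : ℝ) 1) {φ : ℝ × ℝ → ℝ} (hφ : IsTestFunction φ) (n : ℕ) :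
    Integrable (fun X => φ X * velocityRatio σ Γ k X ^ n) M := by
  refine (hφ.1.integrable_of_hasCompactSupport hφ.2).mul_bdd (c := 1)
    ((measurable_velocityRatio hσ hΓ hk).pow_const n).aestronglyMeasurable
    (Eventually.of_forall fun X => ?_)
  have := velocityRatio_mem (σ := σ) hΓ hk01 X
  rw [norm_pow, Real.norm_of_nonneg this.1]
  exact pow_le_one₀ this.1 this.2

lemma integral_frontMeasure_test (hϱ : 0 < ϱ) (hϱ' : 0 < ϱ') (hσ : MeasurableSet {X | 0 < σ X})
    (hΓ : IsProperCurve Γ) (hd : Continuous d) (hd0 : ∀ l, 0 ≤ d l) {φ : ℝ × ℝ → ℝ}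
    (hφ : IsTestFunction φ) :
    ∫ X, φ X ∂(frontMeasure ϱ ϱ' σ Γ d) = jumpDelta ϱ ϱ' σ Γ d φ := by
  have := isFiniteMeasureOnCompacts_frontMeasure (σ := σ) hϱ hϱ' hΓ hd
  exact integral_frontMeasure hϱ hϱ' hσ hΓ hd hd0 (hφ.1.integrable_of_hasCompactSupport hφ.2)

/-- Weighting with a positive power of the velocity ratio removes the resting medium ahead of the
front. -/
lemma integral_frontMeasure_mul_pow (hϱ : 0 < ϱ) (hϱ' : 0 < ϱ') (hσ : MeasurableSet {X | 0 < σ X})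
    (hΓ : IsProperCurve Γ) (hd : Continuous d) (hd0 : ∀ l, 0 ≤ d l) (hk : Measurable k)
    (hk01 : ∀ l, k l ∈ Icc (0 : ℝ) 1) {φ : ℝ × ℝ → ℝ} (hφ : IsTestFunction φ) (n : ℕ) :
    ∫ X, φ X * velocityRatio σ Γ k X ^ (n + 1) ∂(frontMeasure ϱ ϱ' σ Γ d) =
      jumpDelta ϱ 0 σ Γ (fun l => d l * k l ^ (n + 1)) φ := by
  have := isFiniteMeasureOnCompacts_frontMeasure (σ := σ) hϱ hϱ' hΓ hd
  rw [integral_frontMeasure hϱ hϱ' hσ hΓ hd hd0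
    (integrable_mul_velocityRatio_pow hσ hΓ hk hk01 hφ _), jumpDelta]
  congr 1
  · refine integral_congr_ae ?_
    have hae : ∀ᵐ X : ℝ × ℝ, X ∉ range Γ := measure_eq_zero_iff_ae_notMem.1 hΓ.null
    filter_upwards [hae] with X hX
    rw [velocityRatio_of_notMem hX]
    simp only [jumpField, heavisideStep]
    split_ifs <;> simp
  · simp only [velocityRatio_curve hΓ]
    congr 1
    funext l
    ring

end FrontMeasure

lemma jumpDelta_const_mul (c cm cp : ℝ) (σ : ℝ × ℝ → ℝ) (Γ : ℝ → ℝ × ℝ) (d : ℝ → ℝ)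
    (φ : ℝ × ℝ → ℝ) :
    jumpDelta (cm * c) (cp * c) σ Γ (fun l => d l * c) φ = c * jumpDelta cm cp σ Γ d φ := by
  rw [jumpDelta, jumpDelta, mul_add, ← integral_const_mul, ← integral_const_mul]
  congr 2
  · funext X
    simp only [jumpField]
    ring
  · funext l
    ring

lemma jumpField_congr {cm cp : ℝ} {σ σ' : ℝ × ℝ → ℝ} (h : ∀ X, 0 < σ X ↔ 0 < σ' X) :
    jumpField cm cp σ = jumpField cm cp σ' := by
  funext X
  simp only [jumpField, heavisideStep, h X]

lemma IsTransversalCurve.isProperCurve {u v : ℝ} {x₀ y₀ : ℝ → ℝ} {Φ : ℝ × ℝ → ℝ} {K : ℝ → ℝ → ℝ}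
    (h : IsTransversalCurve u v x₀ y₀ Φ) (hK : IsDisplacement K) (t : ℝ) :
    IsProperCurve (movedCurve u v x₀ y₀ K t) := by
  have hc : Continuous (movedCurve u v x₀ y₀ K t) :=
    (h.continuous_movedCurve hK).comp (Continuous.prodMk_right t)
  have hq := h.velocity_sq_pos
  refine ⟨hc, h.movedCurve_injective K t, fun C hC => ?_, ?_⟩
  · obtain ⟨L, hL, hLC⟩ := h.exists_isCompact_label_moved hK hC t
    exact ⟨L, hL, fun l hl => hLC t le_rfl l hl⟩
  · have hm : MeasurableSet (range (movedCurve u v x₀ y₀ K t)) :=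
      (hc.measurableEmbedding (h.movedCurve_injective K t)).measurableSet_range
    rw [← (measurePreserving_lineChart hq).measure_preimage hm.nullMeasurableSet]
    refine (Measure.measure_prod_null ((measurableEmbedding_lineChart hq).measurable hm)).2
      (Eventually.of_forall fun η => Subsingleton.measure_zero ?_ _)
    -- a line in the direction `(u, v)` meets the front in one point at most
    rintro ξ ⟨l, hl⟩ ξ' ⟨l', hl'⟩
    have e1 : transCoord u v (movedCurve u v x₀ y₀ K t l) = η := by
      rw [hl, transCoord_lineChart hq]
    have e2 : transCoord u v (movedCurve u v x₀ y₀ K t l') = η := by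
      rw [hl', transCoord_lineChart hq]
    have hll : l = l' := h.strictMono_transCoord.injective (by
      simpa [movedCurve_eq_shift] using e1.trans e2.symm)
    subst hll
    have := (measurableEmbedding_lineChart hq).injective (hl.symm.trans hl')
    exact (Prod.mk.inj this).2

/-! ### The generalized solution -/

/-- The momentum measure, up to the factor `u` or `v`, that belongs to `frontMeasure`. -/
def frontMomentum (ϱ ϱ' : ℝ) (σ : ℝ × ℝ → ℝ) (Γ : ℝ → ℝ × ℝ) (d k : ℝ → ℝ) : Measure (ℝ × ℝ) :=
  (frontMeasure ϱ ϱ' σ Γ d).withDensity fun X => ENNReal.ofReal (velocityRatio σ Γ k X)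

section FrontMomentum

variable {ϱ ϱ' : ℝ} {σ : ℝ × ℝ → ℝ} {Γ : ℝ → ℝ × ℝ} {d k : ℝ → ℝ}

lemma isFiniteMeasureOnCompacts_frontMomentum (hϱ : 0 < ϱ) (hϱ' : 0 < ϱ') (hΓ : IsProperCurve Γ)
    (hd : Continuous d) (hk01 : ∀ l, k l ∈ Icc (0 : ℝ) 1) :
    IsFiniteMeasureOnCompacts (frontMomentum ϱ ϱ' σ Γ d k) := by
  have := isFiniteMeasureOnCompacts_frontMeasure (σ := σ) hϱ hϱ' hΓ hd
  refine isFiniteMeasureOnCompacts_of_le (M := frontMeasure ϱ ϱ' σ Γ d) ?_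
  conv_rhs => rw [← withDensity_one (μ := frontMeasure ϱ ϱ' σ Γ d)]
  exact withDensity_mono (Eventually.of_forall fun X =>
    ENNReal.ofReal_le_one.2 (velocityRatio_mem hΓ hk01 X).2)

lemma integral_frontMomentum_mul_pow (hϱ : 0 < ϱ) (hϱ' : 0 < ϱ') (hσ : MeasurableSet {X | 0 < σ X})
    (hΓ : IsProperCurve Γ) (hd : Continuous d) (hd0 : ∀ l, 0 ≤ d l) (hk : Measurable k)
    (hk01 : ∀ l, k l ∈ Icc (0 : ℝ) 1) {φ : ℝ × ℝ → ℝ} (hφ : IsTestFunction φ) (n : ℕ) :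
    ∫ X, φ X * velocityRatio σ Γ k X ^ n ∂(frontMomentum ϱ ϱ' σ Γ d k) =
      jumpDelta ϱ 0 σ Γ (fun l => d l * k l ^ (n + 1)) φ := by
  rw [← integral_frontMeasure_mul_pow hϱ hϱ' hσ hΓ hd hd0 hk hk01 hφ, frontMomentum,
    integral_withDensity_eq_integral_toReal_smul
      (measurable_velocityRatio hσ hΓ hk).ennreal_ofReal (by simp)]
  congr 1
  funext X
  rw [ENNReal.toReal_ofReal (velocityRatio_mem hΓ hk01 X).1, smul_eq_mul]
  ring

lemma integral_frontMomentum (hϱ : 0 < ϱ) (hϱ' : 0 < ϱ') (hσ : MeasurableSet {X | 0 < σ X})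
    (hΓ : IsProperCurve Γ) (hd : Continuous d) (hd0 : ∀ l, 0 ≤ d l) (hk : Measurable k)
    (hk01 : ∀ l, k l ∈ Icc (0 : ℝ) 1) {φ : ℝ × ℝ → ℝ} (hφ : IsTestFunction φ) :
    ∫ X, φ X ∂(frontMomentum ϱ ϱ' σ Γ d k) = jumpDelta ϱ 0 σ Γ (fun l => d l * k l) φ := by
  simpa using integral_frontMomentum_mul_pow hϱ hϱ' hσ hΓ hd hd0 hk hk01 hφ 0

variable {u v : ℝ} [IsFiniteMeasureOnCompacts (frontMomentum ϱ ϱ' σ Γ d k)]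

/-- The divergence of the mass flux. -/
lemma integral_partial_add (hϱ : 0 < ϱ) (hϱ' : 0 < ϱ') (hσ : MeasurableSet {X | 0 < σ X})
    (hΓ : IsProperCurve Γ) (hd : Continuous d) (hd0 : ∀ l, 0 ≤ d l) (hk : Measurable k)
    (hk01 : ∀ l, k l ∈ Icc (0 : ℝ) 1) {f : ℝ × ℝ → ℝ} (hf : IsC1TestFunction f) :
    (SignedRadon.ofConstMul (frontMomentum ϱ ϱ' σ Γ d k) u).integral (partialX f) +
      (SignedRadon.ofConstMul (frontMomentum ϱ ϱ' σ Γ d k) v).integral (partialY f) =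
    jumpDelta ϱ 0 σ Γ (fun l => d l * k l) (dirDeriv u v f) := by
  have hx := isTestFunction_partialX hf
  have hy := isTestFunction_partialY hf
  rw [← integral_frontMomentum hϱ hϱ' hσ hΓ hd hd0 hk hk01 (isTestFunction_dirDeriv hf),
    SignedRadon.ofConstMul_integral, SignedRadon.ofConstMul_integral, ← integral_const_mul,
    ← integral_const_mul, ← integral_add]
  · rfl
  · exact (hx.1.integrable_of_hasCompactSupport hx.2).const_mul u
  · exact (hy.1.integrable_of_hasCompactSupport hy.2).const_mul v

/-- The divergence of the momentum flux. -/
lemma integral_partial_mul_density_add (hϱ : 0 < ϱ) (hϱ' : 0 < ϱ')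
    (hσ : MeasurableSet {X | 0 < σ X})
    (hΓ : IsProperCurve Γ) (hd : Continuous d) (hd0 : ∀ l, 0 ≤ d l) (hk : Measurable k)
    (hk01 : ∀ l, k l ∈ Icc (0 : ℝ) 1) {f : ℝ × ℝ → ℝ} (hf : IsC1TestFunction f) (c : ℝ) :
    (SignedRadon.ofConstMul (frontMomentum ϱ ϱ' σ Γ d k) c).integral (fun X => partialX f X *
        (SignedRadon.ofConstMul (frontMomentum ϱ ϱ' σ Γ d k) u).density
          (frontMeasure ϱ ϱ' σ Γ d) X) +
      (SignedRadon.ofConstMul (frontMomentum ϱ ϱ' σ Γ d k) c).integral (fun X => partialY f X *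
        (SignedRadon.ofConstMul (frontMomentum ϱ ϱ' σ Γ d k) v).density
          (frontMeasure ϱ ϱ' σ Γ d) X) =
    c * jumpDelta ϱ 0 σ Γ (fun l => d l * k l * k l) (dirDeriv u v f) := by
  have := isFiniteMeasureOnCompacts_frontMeasure (σ := σ) hϱ hϱ' hΓ hd
  have hx := integrable_mul_velocityRatio_pow (M := frontMomentum ϱ ϱ' σ Γ d k) hσ hΓ hk hk01
    (isTestFunction_partialX hf) 1
  have hy := integrable_mul_velocityRatio_pow (M := frontMomentum ϱ ϱ' σ Γ d k) hσ hΓ hk hk01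
    (isTestFunction_partialY hf) 1
  have hac : frontMomentum ϱ ϱ' σ Γ d k ≪ frontMeasure ϱ ϱ' σ Γ d :=
    withDensity_absolutelyContinuous _ _
  have hdens : ∀ (r : ℝ) (φ : ℝ × ℝ → ℝ), ∫ X, φ X *
      (SignedRadon.ofConstMul (frontMomentum ϱ ϱ' σ Γ d k) r).density (frontMeasure ϱ ϱ' σ Γ d) X
        ∂(frontMomentum ϱ ϱ' σ Γ d k) =
      r * ∫ X, φ X * velocityRatio σ Γ k X ^ 1 ∂(frontMomentum ϱ ϱ' σ Γ d k) := fun r φ => by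
    rw [← integral_const_mul]
    refine integral_congr_ae ?_
    filter_upwards [hac.ae_le (SignedRadon.ofConstMul_density (c := r)
      (W := frontMomentum ϱ ϱ' σ Γ d k)
      (measurable_velocityRatio hσ hΓ hk) (fun X => (velocityRatio_mem hΓ hk01 X).1) rfl)] with X hX
    rw [hX]
    ring
  have key := integral_frontMomentum_mul_pow hϱ hϱ' hσ hΓ hd hd0 hk hk01
    (isTestFunction_dirDeriv (u := u) (v := v) hf) 1
  simp only [mul_assoc, ← pow_two]
  rw [SignedRadon.ofConstMul_integral, SignedRadon.ofConstMul_integral, hdens, hdens, ← mul_add,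
    ← integral_const_mul, ← integral_const_mul, ← integral_add (hx.const_mul u) (hy.const_mul v),
    ← key]
  congr 2
  funext X
  simp only [dirDeriv]
  ring

end FrontMomentum

/-- The balance laws of the mass density `P` and the momentum density `P k` on a front with
displacement `K`. -/
structure IsFrontSolution (ϱ ϱ' : ℝ) (G : ℝ → ℝ) (P k K : ℝ → ℝ → ℝ) : Prop where
  continuous_mass : Continuous fun z : ℝ × ℝ => P z.1 z.2
  continuous_momentum : Continuous fun z : ℝ × ℝ => P z.1 z.2 * k z.1 z.2
  continuousOn_ratio : ContinuousOn (fun z : ℝ × ℝ => k z.1 z.2) (Ioi 0 ×ˢ univ)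
  mass_nonneg : ∀ t l, 0 ≤ P t l
  ratio_mem : ∀ t l, k t l ∈ Icc (0 : ℝ) 1
  hasDerivAt_disp : ∀ t > 0, ∀ l, HasDerivAt (fun τ => K τ l) (k t l) t
  hasDerivAt_mass : ∀ t > 0, ∀ l,
    HasDerivAt (fun τ => P τ l) (G l * (ϱ - (ϱ - ϱ') * k t l)) t
  hasDerivAt_momentum : ∀ t > 0, ∀ l,
    HasDerivAt (fun τ => P τ l * k τ l) (G l * (ϱ - (ϱ - 0) * k t l)) t

/-- The regions separated by the moving front, together with the mass and momentum on it, form a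
generalized solution as soon as `P`, `k` and `K` satisfy the balance laws on the front. -/
theorem IsTransversalCurve.exists_isGeneralizedSolution {ϱ ϱ' u v : ℝ} {x₀ y₀ : ℝ → ℝ}
    {Φ : ℝ × ℝ → ℝ} {P k K : ℝ → ℝ → ℝ} (hϱ : 0 < ϱ) (hϱ' : 0 < ϱ')
    (h : IsTransversalCurve u v x₀ y₀ Φ) (hK : IsDisplacement K)
    (hs : IsFrontSolution ϱ ϱ' (crossSpeed u v x₀ y₀) P k K) :
    ∃ (M : ℝ → Measure (ℝ × ℝ)) (I J : ℝ → SignedRadon),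
      IsGeneralizedSolution M I J
        (jumpDelta ϱ ϱ' Φ (fun l => (x₀ l, y₀ l)) (P 0))
        (jumpDelta (ϱ * u) 0 Φ (fun l => (x₀ l, y₀ l)) (fun l => P 0 l * k 0 l * u))
        (jumpDelta (ϱ * v) 0 Φ (fun l => (x₀ l, y₀ l)) (fun l => P 0 l * k 0 l * v)) ∧
      ∀ t > 0, ∀ φ, IsTestFunction φ →
        (∫ X, φ X ∂(M t)) = jumpDelta ϱ ϱ' (movedLevel u v x₀ y₀ Φ K t)
          (movedCurve u v x₀ y₀ K t) (P t) φ ∧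
        (I t).integral φ = jumpDelta (ϱ * u) 0 (movedLevel u v x₀ y₀ Φ K t)
          (movedCurve u v x₀ y₀ K t) (fun l => P t l * k t l * u) φ ∧
        (J t).integral φ = jumpDelta (ϱ * v) 0 (movedLevel u v x₀ y₀ Φ K t)
          (movedCurve u v x₀ y₀ K t) (fun l => P t l * k t l * v) φ := by
  set σ := movedLevel u v x₀ y₀ Φ K with hσdef
  set Γ := movedCurve u v x₀ y₀ K with hΓdef
  have hσ : ∀ t, MeasurableSet {X | 0 < σ t X} := h.measurableSet_movedLevel_pos hK
  have hΓ : ∀ t, IsProperCurve (Γ t) := h.isProperCurve hK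
  have hP : ∀ t, Continuous (P t) := fun t => hs.continuous_mass.comp (Continuous.prodMk_right t)
  have hP0 := hs.mass_nonneg
  have hk01 := hs.ratio_mem
  have hk : ∀ t > 0, Measurable (k t) := fun t ht =>
    (continuousOn_univ.1 (hs.continuousOn_ratio.comp (Continuous.prodMk_right t).continuousOn
      fun l _ => ⟨ht, mem_univ l⟩)).measurable
  have hM : ∀ t, IsFiniteMeasureOnCompacts (frontMeasure ϱ ϱ' (σ t) (Γ t) (P t)) := fun t =>
    isFiniteMeasureOnCompacts_frontMeasure hϱ hϱ' (hΓ t) (hP t)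
  have hW : ∀ t, IsFiniteMeasureOnCompacts (frontMomentum ϱ ϱ' (σ t) (Γ t) (P t) (k t)) :=
    fun t => isFiniteMeasureOnCompacts_frontMomentum hϱ hϱ' (hΓ t) (hP t) (hk01 t)
  let M : ℝ → Measure (ℝ × ℝ) := fun t => frontMeasure ϱ ϱ' (σ t) (Γ t) (P t)
  let R : ℝ → ℝ → SignedRadon := fun c t =>
    SignedRadon.ofConstMul (frontMomentum ϱ ϱ' (σ t) (Γ t) (P t) (k t)) c
  have eM : ∀ t, ∀ φ, IsTestFunction φ → ∫ X, φ X ∂(M t) = jumpDelta ϱ ϱ' (σ t) (Γ t) (P t) φ :=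
    fun t φ hφ => integral_frontMeasure_test hϱ hϱ' (hσ t) (hΓ t) (hP t) (hP0 t) hφ
  have eR : ∀ c, ∀ t > 0, ∀ φ, IsTestFunction φ → (R c t).integral φ =
      c * jumpDelta ϱ 0 (σ t) (Γ t) (fun l => P t l * k t l) φ := fun c t ht φ hφ => by
    rw [SignedRadon.ofConstMul_integral, integral_frontMomentum hϱ hϱ' (hσ t) (hΓ t) (hP t) (hP0 t)
      (hk t ht) (hk01 t) hφ]
  have cM : ∀ φ, IsTestFunction φ → Continuous fun t => jumpDelta ϱ ϱ' (σ t) (Γ t) (P t) φ :=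
    fun φ hφ => h.continuous_jumpDelta_movedLevel hK hs.continuous_mass _ _ hφ
  have cR : ∀ c : ℝ, ∀ φ, IsTestFunction φ → Continuous fun t =>
      c * jumpDelta ϱ 0 (σ t) (Γ t) (fun l => P t l * k t l) φ := fun c φ hφ =>
    continuous_const.mul
      (h.continuous_jumpDelta_movedLevel hK (D := fun t l => P t l * k t l)
        hs.continuous_momentum _ _ hφ)
  have hK0 : ∀ l, K 0 l = 0 := fun l => le_antisymm (by simpa using hK.le_max 0 l) (hK.nonneg 0 l)
  have hσ0 : σ 0 = Φ := funext fun X => movedLevel_eq_of_zero hK0 X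
  have hΓ0 : Γ 0 = fun l => (x₀ l, y₀ l) := by
    funext l; simp [hΓdef, movedCurve, hK0]
  have lR : ∀ c : ℝ, ∀ φ, IsTestFunction φ → Tendsto (fun t => (R c t).integral φ) (𝓝[>] 0)
      (𝓝 (jumpDelta (ϱ * c) 0 Φ (fun l => (x₀ l, y₀ l)) (fun l => P 0 l * k 0 l * c) φ)) := by
    intro c φ hφ
    have h1 := ((cR c φ hφ).tendsto 0).mono_left (nhdsWithin_le_nhds (s := Ioi 0))
    rw [← jumpDelta_const_mul, zero_mul, hσ0, hΓ0] at h1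
    refine h1.congr' ?_
    filter_upwards [self_mem_nhdsWithin] with t ht using (eR c t ht φ hφ).symm
  have mR : ∀ c : ℝ, ∀ g, IsC1TestFunction g → ∀ t₁ t₂ : ℝ, 0 < t₁ → t₁ < t₂ →
      IntervalIntegrable
        (fun τ => (R c τ).integral (fun X => partialX g X * (R u τ).density (M τ) X) +
          (R c τ).integral (fun X => partialY g X * (R v τ).density (M τ) X)) volume t₁ t₂ ∧
      (R c t₂).integral g - (R c t₁).integral g =
        ∫ τ in t₁..t₂, ((R c τ).integral (fun X => partialX g X * (R u τ).density (M τ) X) +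
          (R c τ).integral (fun X => partialY g X * (R v τ).density (M τ) X)) := by
    intro c g hg t₁ t₂ h1 h12
    obtain ⟨hi, he⟩ := h.jumpDelta_sub_eq_integral (D := fun t l => P t l * k t l) (cm := ϱ)
      (cp := 0) hK hs.continuousOn_ratio hs.continuous_momentum hs.hasDerivAt_disp
      hs.hasDerivAt_momentum hg h1 h12
    have hflux : ∀ τ ∈ uIoc t₁ t₂,
        (R c τ).integral (fun X => partialX g X * (R u τ).density (M τ) X) +
        (R c τ).integral (fun X => partialY g X * (R v τ).density (M τ) X) =
        c * jumpDelta ϱ 0 (σ τ) (Γ τ) (fun l => P τ l * k τ l * k τ l) (dirDeriv u v g) := by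
      intro τ hτ
      rw [uIoc_of_le h12.le] at hτ
      exact integral_partial_mul_density_add hϱ hϱ' (hσ τ) (hΓ τ) (hP τ) (hP0 τ)
        (hk τ (h1.trans hτ.1)) (hk01 τ) hg c
    refine ⟨(intervalIntegrable_congr hflux).2 (hi.const_mul c), ?_⟩
    rw [eR c t₂ (h1.trans h12) g hg.isTestFunction, eR c t₁ h1 g hg.isTestFunction, ← mul_sub, he,
      ← intervalIntegral.integral_const_mul]
    exact intervalIntegral.integral_congr_ae (Eventually.of_forall fun τ hτ => (hflux τ hτ).symm)
  refine ⟨M, R u, R v, ⟨fun t _ => hM t, ?_, ?_, ?_, ?_, mR u, mR v, ?_⟩, ?_⟩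
  · intro φ hφ
    exact ⟨(cM φ hφ).continuousOn.congr fun t _ => eM t φ hφ,
      (cR u φ hφ).continuousOn.congr fun t ht => eR u t ht φ hφ,
      (cR v φ hφ).continuousOn.congr fun t ht => eR v t ht φ hφ⟩
  · exact Eventually.of_forall fun t =>
      ⟨SignedRadon.ofConstMul_absCont (withDensity_absolutelyContinuous _ _),
        SignedRadon.ofConstMul_absCont (withDensity_absolutelyContinuous _ _)⟩
  · refine (ae_restrict_iff' measurableSet_Ioi).2 (Eventually.of_forall fun t ht => ?_)
    have key : ∀ c c' : ℝ, LocallyIntegrable ((R c t).density (M t)) (R c' t).variation :=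
      fun c c' => SignedRadon.ofConstMul_locallyIntegrable
        (measurable_velocityRatio (hσ t) (hΓ t) (hk t ht))
        (fun X => (velocityRatio_mem (hΓ t) (hk01 t) X).1)
        (fun X => (velocityRatio_mem (hΓ t) (hk01 t) X).2) rfl
    exact ⟨key _ _, key _ _, key _ _, key _ _⟩
  · intro f hf t₁ t₂ h1 h12
    obtain ⟨hi, he⟩ := h.jumpDelta_sub_eq_integral hK hs.continuousOn_ratio hs.continuous_mass
      hs.hasDerivAt_disp hs.hasDerivAt_mass hf h1 h12
    have hflux : ∀ τ ∈ uIoc t₁ t₂, (R u τ).integral (partialX f) + (R v τ).integral (partialY f) =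
        jumpDelta ϱ 0 (σ τ) (Γ τ) (fun l => P τ l * k τ l) (dirDeriv u v f) := by
      intro τ hτ
      rw [uIoc_of_le h12.le] at hτ
      exact integral_partial_add hϱ hϱ' (hσ τ) (hΓ τ) (hP τ) (hP0 τ)
        (hk τ (h1.trans hτ.1)) (hk01 τ) hf
    refine ⟨(intervalIntegrable_congr hflux).2 hi, ?_⟩
    rw [eM t₂ f hf.isTestFunction, eM t₁ f hf.isTestFunction, he]
    exact intervalIntegral.integral_congr_ae (Eventually.of_forall fun τ hτ => (hflux τ hτ).symm)
  · intro φ hφ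
    refine ⟨?_, lR u φ hφ, lR v φ hφ⟩
    have h1 := ((cM φ hφ).tendsto 0).mono_left (nhdsWithin_le_nhds (s := Ioi 0))
    rw [hσ0, hΓ0] at h1
    exact h1.congr fun t => (eM t φ hφ).symm
  · intro t ht φ hφ
    have e : ∀ c, jumpDelta (ϱ * c) 0 (σ t) (Γ t) (fun l => P t l * k t l * c) φ =
        c * jumpDelta ϱ 0 (σ t) (Γ t) (fun l => P t l * k t l) φ := fun c => by
      rw [← jumpDelta_const_mul, zero_mul]
    exact ⟨eM t φ hφ, (eR u t ht φ hφ).trans (e u).symm, (eR v t ht φ hφ).trans (e v).symm⟩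

/-! ### The shock-internal system -/

section Internal

variable {ϱ ϱ' u v : ℝ} {x₀ y₀ : ℝ → ℝ} {Φ : ℝ × ℝ → ℝ}

/-- Along every solution the momentum stays parallel to `(u, v)`, so that front points move on the
lines in this direction; the cross product `u y_l - v x_l` therefore keeps its initial value `G`,
and the system becomes the reduced equation for each label. -/
lemma InternalSystemAt.unique (hϱ : 0 < ϱ) (hϱ' : 0 < ϱ')
    (h : IsTransversalCurve u v x₀ y₀ Φ) {P₀ k₀ : ℝ → ℝ}
    (hP₀ : ∀ l, 0 ≤ P₀ l) (hk₀ : ∀ l, 0 < k₀ l ∧ k₀ l < 1) {P₁ I₁ J₁ x₁ y₁ : ℝ → ℝ → ℝ}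
    (hsys : ∀ t > 0, ∀ l, 0 < P₁ t l ∧ InternalSystemAt ϱ u v ϱ' 0 0 P₁ I₁ J₁ x₁ y₁ t l)
    (hlim : ∀ l, Tendsto (fun t => P₁ t l) (𝓝[>] 0) (𝓝 (P₀ l)) ∧
      Tendsto (fun t => I₁ t l) (𝓝[>] 0) (𝓝 (k₀ l * P₀ l * u)) ∧
      Tendsto (fun t => J₁ t l) (𝓝[>] 0) (𝓝 (k₀ l * P₀ l * v)) ∧
      Tendsto (fun t => x₁ t l) (𝓝[>] 0) (𝓝 (x₀ l)) ∧
      Tendsto (fun t => y₁ t l) (𝓝[>] 0) (𝓝 (y₀ l))) {t : ℝ} (ht : 0 < t) (l : ℝ) :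
    let G := crossSpeed u v x₀ y₀ l
    P₁ t l = frontMass (ϱ * G) (ϱ' * G) (P₀ l) (k₀ l) t ∧
    I₁ t l = frontMass (ϱ * G) (ϱ' * G) (P₀ l) (k₀ l) t *
      frontRatio (ϱ * G) (ϱ' * G) (P₀ l) (k₀ l) t * u ∧
    J₁ t l = frontMass (ϱ * G) (ϱ' * G) (P₀ l) (k₀ l) t *
      frontRatio (ϱ * G) (ϱ' * G) (P₀ l) (k₀ l) t * v ∧
    x₁ t l = x₀ l + u * frontDisp (ϱ * G) (ϱ' * G) (P₀ l) (k₀ l) t ∧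
    y₁ t l = y₀ l + v * frontDisp (ϱ * G) (ϱ' * G) (P₀ l) (k₀ l) t := by
  intro G
  have hq := h.velocity_sq_pos
  have hG : 0 < G := h.crossSpeed_pos l
  have hIJ : ∀ t > 0, ∀ l, v * I₁ t l - u * J₁ t l = 0 := by
    intro t ht l
    refine eq_of_hasDerivAt_zero_of_tendsto (f := fun t => v * I₁ t l - u * J₁ t l)
      (fun s hs => ?_) ?_ ht
    · obtain ⟨-, xl, yl, -, -, U, V, dP, dI, dJ, -, -, -, hI, hJ, -, -, -, eI, eJ⟩ := hsys s hs l
      refine ((hI.const_mul v).sub (hJ.const_mul u)).congr_deriv ?_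
      linear_combination v * eI - u * eJ
    · have := ((hlim l).2.1.const_mul v).sub ((hlim l).2.2.1.const_mul u)
      rwa [show v * (k₀ l * P₀ l * u) - u * (k₀ l * P₀ l * v) = 0 by ring] at this
  have hxy : ∀ t > 0, ∀ l, u * y₁ t l - v * x₁ t l = u * y₀ l - v * x₀ l := by
    intro t ht l
    refine eq_of_hasDerivAt_zero_of_tendsto (f := fun t => u * y₁ t l - v * x₁ t l)
      (fun s hs => ?_) ?_ ht
    · obtain ⟨hp, xl, yl, -, -, U, V, dP, dI, dJ, hU, hV, -, -, -, hx, hy, -⟩ := hsys s hs l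
      refine ((hy.const_mul u).sub (hx.const_mul v)).congr_deriv ?_
      rw [hU, hV]
      field_simp
      linear_combination -hIJ s hs l
    · exact ((hlim l).2.2.2.2.const_mul u).sub ((hlim l).2.2.2.1.const_mul v)
  have hcross : ∀ t > 0, ∀ xl yl, HasDerivAt (fun l' => x₁ t l') xl l →
      HasDerivAt (fun l' => y₁ t l') yl l → u * yl - v * xl = G := by
    intro t ht xl yl hx hy
    have h1 := (hy.const_mul u).sub (hx.const_mul v)
    have h2 : HasDerivAt (fun l => u * y₀ l - v * x₀ l) G l :=
      (h.hasStrictDerivAt_transCoord l).hasDerivAt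
    refine h1.unique (h2.congr_of_eventuallyEq (Eventually.of_forall fun l' => ?_))
    exact hxy t ht l'
  set k : ℝ → ℝ := fun τ => (u * I₁ τ l + v * J₁ τ l) / ((u ^ 2 + v ^ 2) * P₁ τ l) with hkdef
  set K : ℝ → ℝ := fun τ => (u * (x₁ τ l - x₀ l) + v * (y₁ τ l - y₀ l)) / (u ^ 2 + v ^ 2) with hKdef
  have hPk : ∀ τ > 0, P₁ τ l * k τ = (u * I₁ τ l + v * J₁ τ l) / (u ^ 2 + v ^ 2) := fun τ hτ => by
    have := (hsys τ hτ l).1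
    simp only [hkdef]
    field_simp
  have hIk : ∀ τ > 0, I₁ τ l = P₁ τ l * k τ * u := fun τ hτ => by
    rw [hPk τ hτ]
    field_simp
    linear_combination v * hIJ τ hτ l
  have hJk : ∀ τ > 0, J₁ τ l = P₁ τ l * k τ * v := fun τ hτ => by
    rw [hPk τ hτ]
    field_simp
    linear_combination -u * hIJ τ hτ l
  have hU : ∀ τ > 0, I₁ τ l / P₁ τ l = k τ * u := fun τ hτ => by
    have := (hsys τ hτ l).1
    rw [hIk τ hτ]
    field_simp
  have hV : ∀ τ > 0, J₁ τ l / P₁ τ l = k τ * v := fun τ hτ => by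
    have := (hsys τ hτ l).1
    rw [hJk τ hτ]
    field_simp
  have key := reduced_unique (a := ϱ * G) (b := ϱ' * G) (p := P₀ l) (m := k₀ l)
    (P := fun τ => P₁ τ l) (K := K) (k := k) (by positivity) (by positivity) (hP₀ l) (hk₀ l)
    (fun τ hτ => (hsys τ hτ l).1) ?_ ?_ ?_ (hlim l).1 ?_ ?_ ht
  · obtain ⟨e1, e2, e3⟩ := key
    have e4 := hxy t ht l
    have e5 : u * (x₁ t l - x₀ l) + v * (y₁ t l - y₀ l) =
        frontDisp (ϱ * G) (ϱ' * G) (P₀ l) (k₀ l) t * (u ^ 2 + v ^ 2) := by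
      rw [← e2]
      simp only [hKdef]
      field_simp
    refine ⟨e1, ?_, ?_, ?_, ?_⟩
    · rw [hIk t ht, e1, e3]
    · rw [hJk t ht, e1, e3]
    · refine mul_right_cancel₀ hq.ne' ?_
      linear_combination u * e5 - v * e4
    · refine mul_right_cancel₀ hq.ne' ?_
      linear_combination v * e5 + u * e4
  · intro τ hτ
    obtain ⟨hp, xl, yl, hxl, hyl, U, V, dP, dI, dJ, eU, eV, hP, -, -, -, -, eP, -⟩ := hsys τ hτ l
    refine hP.congr_deriv ?_
    rw [hU τ hτ] at eU
    rw [hV τ hτ] at eV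
    rw [eU, eV] at eP
    linear_combination eP + (ϱ - (ϱ - ϱ') * k τ) * hcross τ hτ xl yl hxl hyl
  · intro τ hτ
    obtain ⟨hp, xl, yl, hxl, hyl, U, V, dP, dI, dJ, eU, eV, -, hI, hJ, -, -, -, eI, eJ⟩ :=
      hsys τ hτ l
    rw [hU τ hτ] at eU
    rw [hV τ hτ] at eV
    rw [eU, eV] at eI eJ
    have h1 := (((hI.const_mul u).add (hJ.const_mul v)).div_const (u ^ 2 + v ^ 2))
    refine (h1.congr_of_eventuallyEq ?_).congr_deriv ?_
    · filter_upwards [Ioi_mem_nhds hτ] with s hs using hPk s hs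
    · rw [div_eq_iff hq.ne']
      linear_combination u * eI + v * eJ +
        (ϱ * (1 - k τ) * (u ^ 2 + v ^ 2)) * hcross τ hτ xl yl hxl hyl
  · intro τ hτ
    obtain ⟨hp, xl, yl, -, -, U, V, dP, dI, dJ, eU, eV, -, -, -, hx, hy, -⟩ := hsys τ hτ l
    refine ((((hx.sub_const (x₀ l)).const_mul u).add
      ((hy.sub_const (y₀ l)).const_mul v)).div_const (u ^ 2 + v ^ 2)).congr_deriv ?_
    rw [eU, eV, hU τ hτ, hV τ hτ, div_eq_iff hq.ne']
    ring
  · have h1 := (((hlim l).2.1.const_mul u).add ((hlim l).2.2.1.const_mul v)).div_const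
      (u ^ 2 + v ^ 2)
    have e : (u * (k₀ l * P₀ l * u) + v * (k₀ l * P₀ l * v)) / (u ^ 2 + v ^ 2) = P₀ l * k₀ l := by
      field_simp
    rw [e] at h1
    refine h1.congr' ?_
    filter_upwards [self_mem_nhdsWithin] with s hs using (hPk s hs).symm
  · have h1 := ((((hlim l).2.2.2.1.sub_const (x₀ l)).const_mul u).add
      (((hlim l).2.2.2.2.sub_const (y₀ l)).const_mul v)).div_const (u ^ 2 + v ^ 2)
    simpa using h1

/-- A front whose points move with velocity `k (u, v)` solves the shock-internal system as soon as
it solves the reduced equation. -/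
lemma internalSystemAt_of_reduced {P k x y : ℝ → ℝ → ℝ} {G t l : ℝ} (hP : 0 < P t l)
    (hP' : HasDerivAt (fun τ => P τ l) (-(G * (k t l * (ϱ - ϱ') - ϱ))) t)
    (hM' : HasDerivAt (fun τ => P τ l * k τ l) (-(ϱ * G * (k t l - 1))) t)
    (hx' : HasDerivAt (fun τ => x τ l) (k t l * u) t)
    (hy' : HasDerivAt (fun τ => y τ l) (k t l * v) t)
    (hx : DifferentiableAt ℝ (x t) l) (hy : DifferentiableAt ℝ (y t) l)
    (hG : u * deriv (y t) l - v * deriv (x t) l = G) :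
    InternalSystemAt ϱ u v ϱ' 0 0 P (fun t l => P t l * k t l * u) (fun t l => P t l * k t l * v)
      x y t l := by
  refine ⟨_, _, hx.hasDerivAt, hy.hasDerivAt, k t l * u, k t l * v, _, _, _, ?_, ?_, hP',
    hM'.mul_const u, hM'.mul_const v, hx', hy', ?_, ?_, ?_⟩
  · field_simp
  · field_simp
  · linear_combination (-ϱ + k t l * (ϱ - ϱ')) * hG
  · linear_combination (-ϱ * u * (1 - k t l)) * hG
  · linear_combination (-ϱ * v * (1 - k t l)) * hG

end Internal

/-! ### The front generated by the data -/

section Data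

variable {ϱ ϱ' u v : ℝ} {x₀ y₀ : ℝ → ℝ} {Φ : ℝ × ℝ → ℝ} {P₀ k₀ : ℝ → ℝ}

/-- The reduced solution with the given data, continued constantly to negative times. -/
lemma isFrontSolution_front (hϱ : 0 < ϱ) (hϱ' : 0 < ϱ') {G : ℝ → ℝ} (hG : Continuous G)
    (hG0 : ∀ l, 0 < G l) (hP₀c : Continuous P₀) (hk₀c : Continuous k₀)
    (hP₀ : ∀ l, 0 ≤ P₀ l) (hk₀ : ∀ l, 0 < k₀ l ∧ k₀ l < 1) :
    IsFrontSolution ϱ ϱ' G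
      (fun t l => frontMass (ϱ * G l) (ϱ' * G l) (P₀ l) (k₀ l) (max t 0))
      (fun t l => frontRatio (ϱ * G l) (ϱ' * G l) (P₀ l) (k₀ l) (max t 0))
      (fun t l => frontDisp (ϱ * G l) (ϱ' * G l) (P₀ l) (k₀ l) (max t 0)) := by
  have ha : ∀ l, 0 < ϱ * G l := fun l => mul_pos hϱ (hG0 l)
  have hb : ∀ l, 0 < ϱ' * G l := fun l => mul_pos hϱ' (hG0 l)
  have ca : Continuous fun z : ℝ × ℝ => ϱ * G z.2 := by fun_prop
  have cb : Continuous fun z : ℝ × ℝ => ϱ' * G z.2 := by fun_prop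
  have cp : Continuous fun z : ℝ × ℝ => P₀ z.2 := by fun_prop
  have cm : Continuous fun z : ℝ × ℝ => k₀ z.2 := by fun_prop
  have ct : Continuous fun z : ℝ × ℝ => max z.1 0 := by fun_prop
  have hloc : ∀ {t : ℝ}, 0 < t → (fun τ : ℝ => max τ 0) =ᶠ[𝓝 t] id := fun ht => by
    filter_upwards [Ioi_mem_nhds ht] with s hs using max_eq_left (le_of_lt hs)
  refine ⟨ca.frontMass cb cp cm ct, ?_, ?_, fun t l => frontMass_nonneg _, fun t l =>
    ⟨frontRatio_nonneg (ha l) (hb l) (hP₀ l) (hk₀ l) (le_max_right t 0),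
      frontRatio_le_one (ha l) (hb l) (hP₀ l) (hk₀ l) (le_max_right t 0)⟩, ?_, ?_, ?_⟩
  · exact ca.frontMomentum cb cp cm ct (fun z => ha z.2) (fun z => hb z.2) (fun z => hP₀ z.2)
      (fun z => hk₀ z.2) fun z => le_max_right _ _
  · exact (continuousOn_frontRatio ca cb cp cm ct (fun z => ha z.2) (fun z => hb z.2)
      (fun z => hP₀ z.2) (fun z => hk₀ z.2) fun z => le_max_right _ _).mono
      fun z hz => show 0 < max z.1 0 from lt_max_of_lt_left hz.1
  · intro t ht l
    simp only [max_eq_left ht.le]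
    exact (hasDerivAt_frontDisp (ha l) (hb l) (hP₀ l) (hk₀ l) ht).congr_of_eventuallyEq
      ((hloc ht).fun_comp (frontDisp _ _ _ _))
  · intro t ht l
    simp only [max_eq_left ht.le]
    refine ((hasDerivAt_frontMass (ha l) (hb l) (hP₀ l) (hk₀ l) ht).congr_of_eventuallyEq
      ((hloc ht).fun_comp (frontMass _ _ _ _))).congr_deriv ?_
    ring
  · intro t ht l
    simp only [max_eq_left ht.le]
    refine ((hasDerivAt_frontMomentum (ha l) (hb l) (hP₀ l) (hk₀ l) ht).congr_of_eventuallyEq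
      ((hloc ht).fun_comp fun τ => frontMass _ _ _ _ τ * frontRatio _ _ _ _ τ)).congr_deriv ?_
    ring

lemma isDisplacement_front (hϱ : 0 < ϱ) (hϱ' : 0 < ϱ') {G : ℝ → ℝ} (hG : Continuous G)
    (hG0 : ∀ l, 0 < G l) (hP₀c : Continuous P₀) (hk₀c : Continuous k₀)
    (hP₀ : ∀ l, 0 ≤ P₀ l) (hk₀ : ∀ l, 0 < k₀ l ∧ k₀ l < 1) :
    IsDisplacement fun t l => frontDisp (ϱ * G l) (ϱ' * G l) (P₀ l) (k₀ l) (max t 0) := by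
  have ha : ∀ l, 0 < ϱ * G l := fun l => mul_pos hϱ (hG0 l)
  have hb : ∀ l, 0 < ϱ' * G l := fun l => mul_pos hϱ' (hG0 l)
  refine ⟨?_, fun t l => frontDisp_nonneg (ha l) (hP₀ l) (hk₀ l) (le_max_right t 0),
    fun t l => frontDisp_le (ha l) (hb l) (hP₀ l) (hk₀ l) (le_max_right t 0)⟩
  exact Continuous.frontDisp (α := fun z : ℝ × ℝ => ϱ * G z.2) (β := fun z : ℝ × ℝ => ϱ' * G z.2)
    (π := fun z : ℝ × ℝ => P₀ z.2) (μ := fun z : ℝ × ℝ => k₀ z.2)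
    (τ := fun z : ℝ × ℝ => max z.1 0) (by fun_prop) (by fun_prop) (by fun_prop) (by fun_prop)
    (by fun_prop) (fun z => ha z.2) (fun z => hb z.2) (fun z => hP₀ z.2) (fun z => hk₀ z.2)
    fun z => le_max_right _ _

lemma frontCoord_front (hϱ : 0 < ϱ) (hϱ' : 0 < ϱ') {G : ℝ → ℝ} (hG0 : ∀ l, 0 < G l)
    (hP₀ : ∀ l, 0 ≤ P₀ l) (hk₀ : ∀ l, 0 < k₀ l ∧ k₀ l < 1) (c : ℝ) (z₀ : ℝ → ℝ) {t : ℝ}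
    (ht : 0 ≤ t) (l : ℝ) :
    (∫ τ in (0 : ℝ)..t, frontRatio (ϱ * G l) (ϱ' * G l) (P₀ l) (k₀ l) (max τ 0)) =
        frontDisp (ϱ * G l) (ϱ' * G l) (P₀ l) (k₀ l) (max t 0) ∧
    frontCoord c z₀ (fun t l => frontRatio (ϱ * G l) (ϱ' * G l) (P₀ l) (k₀ l) (max t 0)) t l =
      z₀ l + c * frontDisp (ϱ * G l) (ϱ' * G l) (P₀ l) (k₀ l) (max t 0) := by
  have key : (∫ τ in (0 : ℝ)..t, frontRatio (ϱ * G l) (ϱ' * G l) (P₀ l) (k₀ l) (max τ 0)) =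
      frontDisp (ϱ * G l) (ϱ' * G l) (P₀ l) (k₀ l) (max t 0) := by
    rw [max_eq_left ht, ← integral_frontRatio (mul_pos hϱ (hG0 l)) (mul_pos hϱ' (hG0 l)) (hP₀ l)
      (hk₀ l) ht]
    refine intervalIntegral.integral_congr fun τ hτ => ?_
    rw [uIcc_of_le ht] at hτ
    simp only [max_eq_left hτ.1]
  exact ⟨key, by rw [frontCoord, key]⟩

end Data

end

theorem theorem5p1
    (ϱ ϱ' u v : ℝ) (hϱ : 0 < ϱ) (hϱ' : 0 < ϱ')
    -- the initial front: a continuously differentiable curve, the zero set of `Φ`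
    (x₀ y₀ : ℝ → ℝ) (hx₀ : ContDiff ℝ 1 x₀) (hy₀ : ContDiff ℝ 1 y₀)
    (Φ : ℝ × ℝ → ℝ) (hΦ : ContDiff ℝ 1 Φ)
    (hcurve : ∀ X : ℝ × ℝ, Φ X = 0 ↔ ∃ l, X = (x₀ l, y₀ l))
    -- the `-` side of the front is the one that the velocity `(u, v)` comes from
    (hside : ∀ l, ∀ᶠ ε in 𝓝[>] (0 : ℝ),
      Φ (x₀ l - ε * u, y₀ l - ε * v) < 0 ∧ 0 < Φ (x₀ l + ε * u, y₀ l + ε * v))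
    (hG : ∀ l, 0 < crossSpeed u v x₀ y₀ l)
    -- the data along the initial front: mass density `P₀`, momentum density `k₀ P₀ (u, v)`
    (P₀ k₀ : ℝ → ℝ) (hP₀c : Continuous P₀) (hk₀c : Continuous k₀)
    (hP₀ : ∀ l, 0 ≤ P₀ l) (hk₀ : ∀ l, 0 < k₀ l ∧ k₀ l < 1) :
    ∃ P k : ℝ → ℝ → ℝ,
      -- initial values and regularity
      (∀ l, P 0 l = P₀ l ∧ (0 < P₀ l → k 0 l = k₀ l)) ∧
      ContinuousOn (fun z : ℝ × ℝ => P z.1 z.2) (Ici 0 ×ˢ univ) ∧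
      ContinuousOn (fun z : ℝ × ℝ => P z.1 z.2 * k z.1 z.2) (Ici 0 ×ˢ univ) ∧
      ContinuousOn (fun z : ℝ × ℝ => frontCoord u x₀ k z.1 z.2) (Ici 0 ×ˢ univ) ∧
      ContinuousOn (fun z : ℝ × ℝ => frontCoord v y₀ k z.1 z.2) (Ici 0 ×ˢ univ) ∧
      (ContDiff ℝ 1 (crossSpeed u v x₀ y₀) → ContDiff ℝ 1 P₀ → ContDiff ℝ 1 k₀ →
        ContDiffOn ℝ 1 (fun z : ℝ × ℝ => P z.1 z.2) (Ioi 0 ×ˢ univ) ∧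
        ContDiffOn ℝ 1 (fun z : ℝ × ℝ => P z.1 z.2 * k z.1 z.2) (Ioi 0 ×ˢ univ) ∧
        ContDiffOn ℝ 1 (fun z : ℝ × ℝ => frontCoord u x₀ k z.1 z.2) (Ioi 0 ×ˢ univ) ∧
        ContDiffOn ℝ 1 (fun z : ℝ × ℝ => frontCoord v y₀ k z.1 z.2) (Ioi 0 ×ˢ univ)) ∧
      -- the reduced ordinary differential equations
      (∀ t > 0, ∀ l, 0 < P t l ∧
        HasDerivAt (fun τ => P τ l)
          (-(crossSpeed u v x₀ y₀ l * (k t l * (ϱ - ϱ') - ϱ))) t ∧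
        HasDerivAt (fun τ => P τ l * k τ l)
          (-(ϱ * crossSpeed u v x₀ y₀ l * (k t l - 1))) t) ∧
      -- their explicit solution
      (∀ t ≥ 0, ∀ l, P t l ^ 2 =
        P₀ l ^ 2 - 2 * crossSpeed u v x₀ y₀ l * P₀ l * (k₀ l * (ϱ - ϱ') - ϱ) * t
          + ϱ * ϱ' * crossSpeed u v x₀ y₀ l ^ 2 * t ^ 2) ∧
      (∀ t > 0, ∀ l,
        k t l * (ϱ - ϱ') = ϱ - deriv (fun τ => P τ l) t / crossSpeed u v x₀ y₀ l) ∧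
      (∀ t > 0, ∀ l, (∫ τ in (0 : ℝ)..t, k τ l) =
        t * (2 * P₀ l * k₀ l + ϱ * crossSpeed u v x₀ y₀ l * t) /
          (P₀ l + ϱ * crossSpeed u v x₀ y₀ l * t + P t l)) ∧
      -- they solve the shock-internal system
      (∀ t > 0, ∀ l, DifferentiableAt ℝ (frontCoord u x₀ k t) l →
        DifferentiableAt ℝ (frontCoord v y₀ k t) l →
        InternalSystemAt ϱ u v ϱ' 0 0 P (fun t l => P t l * k t l * u)
          (fun t l => P t l * k t l * v) (frontCoord u x₀ k) (frontCoord v y₀ k) t l) ∧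
      -- every solution of the shock-internal system with these data is of this form
      (∀ P₁ I₁ J₁ x₁ y₁ : ℝ → ℝ → ℝ,
        (∀ t > 0, ∀ l, 0 < P₁ t l ∧ InternalSystemAt ϱ u v ϱ' 0 0 P₁ I₁ J₁ x₁ y₁ t l) →
        (∀ l, Tendsto (fun t => P₁ t l) (𝓝[>] 0) (𝓝 (P₀ l)) ∧
          Tendsto (fun t => I₁ t l) (𝓝[>] 0) (𝓝 (k₀ l * P₀ l * u)) ∧
          Tendsto (fun t => J₁ t l) (𝓝[>] 0) (𝓝 (k₀ l * P₀ l * v)) ∧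
          Tendsto (fun t => x₁ t l) (𝓝[>] 0) (𝓝 (x₀ l)) ∧
          Tendsto (fun t => y₁ t l) (𝓝[>] 0) (𝓝 (y₀ l))) →
        ∀ t > 0, ∀ l, P₁ t l = P t l ∧ I₁ t l = P t l * k t l * u ∧ J₁ t l = P t l * k t l * v ∧
          x₁ t l = frontCoord u x₀ k t l ∧ y₁ t l = frontCoord v y₀ k t l) ∧
      -- the front is stable for all times
      (∀ t > 0, ∀ l, 0 < (∫ τ in (0 : ℝ)..t, k τ l) ∧ (∫ τ in (0 : ℝ)..t, k τ l) < t) ∧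
      -- the generalized solution: `S` describes the front and its two sides
      (∃ S : ℝ → ℝ × ℝ → ℝ,
        ContDiffOn ℝ 1 (fun z : ℝ × (ℝ × ℝ) => S z.1 z.2) (Ici 0 ×ˢ univ) ∧
        (∀ t ≥ 0, ∀ X, S t X = 0 ↔ ∃ l, X = (frontCoord u x₀ k t l, frontCoord v y₀ k t l)) ∧
        (∀ X, (S 0 X < 0 ↔ Φ X < 0) ∧ (0 < S 0 X ↔ 0 < Φ X)) ∧
        ∃ (M : ℝ → Measure (ℝ × ℝ)) (I J : ℝ → SignedRadon),
          IsGeneralizedSolution M I J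
            (jumpDelta ϱ ϱ' Φ (fun l => (x₀ l, y₀ l)) P₀)
            (jumpDelta (ϱ * u) 0 Φ (fun l => (x₀ l, y₀ l)) (fun l => k₀ l * P₀ l * u))
            (jumpDelta (ϱ * v) 0 Φ (fun l => (x₀ l, y₀ l)) (fun l => k₀ l * P₀ l * v)) ∧
          ∀ t > 0, ∀ φ, IsTestFunction φ →
            (∫ X, φ X ∂(M t)) = jumpDelta ϱ ϱ' (S t)
              (fun l => (frontCoord u x₀ k t l, frontCoord v y₀ k t l)) (P t) φ ∧
            (I t).integral φ = jumpDelta (ϱ * u) 0 (S t)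
              (fun l => (frontCoord u x₀ k t l, frontCoord v y₀ k t l))
              (fun l => P t l * k t l * u) φ ∧
            (J t).integral φ = jumpDelta (ϱ * v) 0 (S t)
              (fun l => (frontCoord u x₀ k t l, frontCoord v y₀ k t l))
              (fun l => P t l * k t l * v) φ) ∧
      -- the motion of the front, and its asymptotics
      (∀ t > 0, ∀ l, HasDerivAt (fun τ => frontCoord u x₀ k τ l) (k t l * u) t ∧
        HasDerivAt (fun τ => frontCoord v y₀ k τ l) (k t l * v) t) ∧
      (∀ l, Tendsto (fun t => k t l) atTop (𝓝 (limitRatio ϱ ϱ'))) ∧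
      (∀ l,
        Tendsto (fun t => frontCoord u x₀ k t l - (x₀ l + limitRatio ϱ ϱ' * u * t)) atTop
          (𝓝 (P₀ l * (k₀ l - limitRatio ϱ ϱ') / (√(ϱ * ϱ') * crossSpeed u v x₀ y₀ l) * u)) ∧
        Tendsto (fun t => frontCoord v y₀ k t l - (y₀ l + limitRatio ϱ ϱ' * v * t)) atTop
          (𝓝 (P₀ l * (k₀ l - limitRatio ϱ ϱ') / (√(ϱ * ϱ') * crossSpeed u v x₀ y₀ l) * v))) ∧
      (∀ l, P₀ l = 0 → ∀ t ≥ 0,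
        frontCoord u x₀ k t l = x₀ l + limitRatio ϱ ϱ' * u * t ∧
        frontCoord v y₀ k t l = y₀ l + limitRatio ϱ ϱ' * v * t) := by
  have h : IsTransversalCurve u v x₀ y₀ Φ := ⟨hx₀, hy₀, hΦ.continuous, hcurve, hside, hG⟩
  have hGc := h.continuous_crossSpeed
  set G := crossSpeed u v x₀ y₀ with hGdef
  have ha : ∀ l, 0 < ϱ * G l := fun l => mul_pos hϱ (hG l)
  have hb : ∀ l, 0 < ϱ' * G l := fun l => mul_pos hϱ' (hG l)
  set P : ℝ → ℝ → ℝ :=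
    fun t l => frontMass (ϱ * G l) (ϱ' * G l) (P₀ l) (k₀ l) (max t 0) with hPdef
  set k : ℝ → ℝ → ℝ :=
    fun t l => frontRatio (ϱ * G l) (ϱ' * G l) (P₀ l) (k₀ l) (max t 0) with hkdef
  set K : ℝ → ℝ → ℝ :=
    fun t l => frontDisp (ϱ * G l) (ϱ' * G l) (P₀ l) (k₀ l) (max t 0) with hKdef
  have hs : IsFrontSolution ϱ ϱ' G P k K := isFrontSolution_front hϱ hϱ' hGc hG hP₀c hk₀c hP₀ hk₀
  have hK : IsDisplacement K := isDisplacement_front hϱ hϱ' hGc hG hP₀c hk₀c hP₀ hk₀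
  have hint : ∀ t ≥ 0, ∀ l, ∫ τ in (0 : ℝ)..t, k τ l = K t l := fun t ht l =>
    (frontCoord_front hϱ hϱ' hG hP₀ hk₀ 0 x₀ ht l).1
  have hfc : ∀ (c : ℝ) (z₀ : ℝ → ℝ), ∀ t ≥ 0, ∀ l, frontCoord c z₀ k t l = z₀ l + c * K t l :=
    fun c z₀ t ht l => (frontCoord_front hϱ hϱ' hG hP₀ hk₀ c z₀ ht l).2
  have hPt : ∀ t ≥ 0, ∀ l, P t l = frontMass (ϱ * G l) (ϱ' * G l) (P₀ l) (k₀ l) t :=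
    fun t ht l => by simp only [hPdef, max_eq_left ht]
  have hkt : ∀ t ≥ 0, ∀ l, k t l = frontRatio (ϱ * G l) (ϱ' * G l) (P₀ l) (k₀ l) t :=
    fun t ht l => by simp only [hkdef, max_eq_left ht]
  have hKt : ∀ t ≥ 0, ∀ l, K t l = frontDisp (ϱ * G l) (ϱ' * G l) (P₀ l) (k₀ l) t :=
    fun t ht l => by simp only [hKdef, max_eq_left ht]
  have hP00 : ∀ l, P 0 l = P₀ l := fun l => by rw [hPt 0 le_rfl, frontMass_zero (hP₀ l)]
  have hk00 : ∀ l, 0 < P₀ l → k 0 l = k₀ l := fun l hl => by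
    rw [hkt 0 le_rfl, frontRatio_zero hl]
  have hPk0 : ∀ l, P 0 l * k 0 l = k₀ l * P₀ l := fun l => by
    rw [hP00]
    rcases (hP₀ l).eq_or_lt with h0 | h0
    · rw [← h0, zero_mul, mul_zero]
    · rw [hk00 l h0, mul_comm]
  have hPpos : ∀ t > 0, ∀ l, 0 < P t l := fun t ht l => by
    rw [hPt t ht.le]; exact frontMass_pos (ha l) (hb l) (hP₀ l) (hk₀ l) ht
  have hKt0 : ∀ t > 0, ∀ l, 0 < K t l ∧ K t l < t := fun t ht l => by
    rw [hKt t ht.le]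
    exact ⟨frontDisp_pos (ha l) (hP₀ l) (hk₀ l) ht, frontDisp_lt (ha l) (hb l) (hP₀ l) (hk₀ l) ht⟩
  have hP' : ∀ t > 0, ∀ l, HasDerivAt (fun τ => P τ l) (-(G l * (k t l * (ϱ - ϱ') - ϱ))) t :=
    fun t ht l => (hs.hasDerivAt_mass t ht l).congr_deriv (by ring)
  have hM' : ∀ t > 0, ∀ l, HasDerivAt (fun τ => P τ l * k τ l) (-(ϱ * G l * (k t l - 1))) t :=
    fun t ht l => (hs.hasDerivAt_momentum t ht l).congr_deriv (by ring)
  have hx' : ∀ (c : ℝ) (z₀ : ℝ → ℝ), ∀ t > 0, ∀ l,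
      HasDerivAt (fun τ => frontCoord c z₀ k τ l) (k t l * c) t := fun c z₀ t ht l => by
    have h1 := ((hs.hasDerivAt_disp t ht l).const_mul c).const_add (z₀ l)
    refine (h1.congr_of_eventuallyEq ?_).congr_deriv (mul_comm _ _)
    filter_upwards [Ioi_mem_nhds ht] with τ hτ using hfc c z₀ τ (le_of_lt hτ) l
  have hcont : ∀ (c : ℝ) (z₀ : ℝ → ℝ), Continuous z₀ →
      ContinuousOn (fun z : ℝ × ℝ => frontCoord c z₀ k z.1 z.2) (Ici 0 ×ˢ univ) :=
    fun c z₀ hz₀ => by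
      have h1 : Continuous fun z : ℝ × ℝ => z₀ z.2 + c * K z.1 z.2 := by
        have := hK.continuous
        fun_prop
      exact h1.continuousOn.congr fun z hz => hfc c z₀ z.1 hz.1 z.2
  -- the constants of the asymptotics
  have hr : 0 < √(ϱ * ϱ') := Real.sqrt_pos.2 (mul_pos hϱ hϱ')
  have hc : ∀ l, 0 < √(ϱ * ϱ') * G l := fun l => mul_pos hr (hG l)
  have hab : ∀ l, (√(ϱ * ϱ') * G l) ^ 2 = ϱ * G l * (ϱ' * G l) := fun l => by
    rw [mul_pow, Real.sq_sqrt (mul_pos hϱ hϱ').le]; ring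
  have hκ : ∀ l, limitRatio ϱ ϱ' * (ϱ * G l + √(ϱ * ϱ') * G l) = ϱ * G l := fun l => by
    have h1 : 0 < √ϱ := Real.sqrt_pos.2 hϱ
    have h2 : 0 < √ϱ' := Real.sqrt_pos.2 hϱ'
    have h3 : √ϱ ^ 2 = ϱ := Real.sq_sqrt hϱ.le
    rw [limitRatio, Real.sqrt_mul hϱ.le]
    field_simp
    linear_combination √ϱ' * G l * h3
  have hasym : ∀ (c : ℝ) (z₀ : ℝ → ℝ) (l : ℝ),
      Tendsto (fun t => frontCoord c z₀ k t l - (z₀ l + limitRatio ϱ ϱ' * c * t)) atTop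
        (𝓝 (P₀ l * (k₀ l - limitRatio ϱ ϱ') / (√(ϱ * ϱ') * G l) * c)) := fun c z₀ l => by
    refine ((tendsto_frontDisp_sub (ha l) (hb l) (hP₀ l) (hk₀ l) (hc l) (hab l)
      (hκ l)).mul_const c).congr' ?_
    filter_upwards [eventually_ge_atTop 0] with t ht
    rw [hfc c z₀ t ht l, hKt t ht l]
    ring
  refine ⟨P, k, fun l => ⟨hP00 l, hk00 l⟩, hs.continuous_mass.continuousOn,
    hs.continuous_momentum.continuousOn, hcont u x₀ hx₀.continuous, hcont v y₀ hy₀.continuous,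
    ?_, fun t ht l => ⟨hPpos t ht l, hP' t ht l, hM' t ht l⟩, ?_, ?_, ?_, ?_, ?_, ?_, ?_,
    fun t ht l => ⟨hx' u x₀ t ht l, hx' v y₀ t ht l⟩, ?_, fun l => ⟨hasym u x₀ l, hasym v y₀ l⟩, ?_⟩
  · intro cG cP ck
    have da : ContDiffOn ℝ 1 (fun z : ℝ × ℝ => ϱ * G z.2) (Ioi 0 ×ˢ univ) := by fun_prop
    have db : ContDiffOn ℝ 1 (fun z : ℝ × ℝ => ϱ' * G z.2) (Ioi 0 ×ˢ univ) := by fun_prop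
    have dp : ContDiffOn ℝ 1 (fun z : ℝ × ℝ => P₀ z.2) (Ioi 0 ×ˢ univ) := by fun_prop
    have dm : ContDiffOn ℝ 1 (fun z : ℝ × ℝ => k₀ z.2) (Ioi 0 ×ˢ univ) := by fun_prop
    have dt : ContDiffOn ℝ 1 (fun z : ℝ × ℝ => max z.1 0) (Ioi 0 ×ˢ univ) :=
      contDiff_fst.contDiffOn.congr fun z hz => max_eq_left (le_of_lt hz.1)
    have ht0 : ∀ z ∈ (Ioi 0 ×ˢ univ : Set (ℝ × ℝ)), 0 < max z.1 0 :=
      fun z hz => lt_max_of_lt_left hz.1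
    have dK := da.frontDisp db dp dm dt (fun z => ha z.2) (fun z => hb z.2) (fun z => hP₀ z.2)
      (fun z => hk₀ z.2) ht0
    have dcoord : ∀ (c : ℝ) (z₀ : ℝ → ℝ), ContDiff ℝ 1 z₀ →
        ContDiffOn ℝ 1 (fun z : ℝ × ℝ => frontCoord c z₀ k z.1 z.2) (Ioi 0 ×ˢ univ) :=
      fun c z₀ hz₀ => ((hz₀.comp contDiff_snd).contDiffOn.add (contDiffOn_const.mul dK)).congr
        fun z hz => hfc c z₀ z.1 (le_of_lt hz.1) z.2
    exact ⟨da.frontMass db dp dm dt (fun z => ha z.2) (fun z => hb z.2) (fun z => hP₀ z.2)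
      (fun z => hk₀ z.2) ht0, da.frontMomentum db dp dm dt (fun z => ha z.2) (fun z => hb z.2)
      (fun z => hP₀ z.2) (fun z => hk₀ z.2) ht0, dcoord u x₀ hx₀, dcoord v y₀ hy₀⟩
  · intro t ht l
    rw [hPt t ht, frontMass_sq (ha l) (hb l) (hP₀ l) (hk₀ l) ht]
    ring
  · intro t ht l
    rw [(hP' t ht l).deriv]
    have := (hG l).ne'
    field_simp
    ring
  · intro t ht l
    rw [hint t ht.le, hKt t ht.le, hPt t ht.le, frontDisp, mul_assoc]
  · intro t ht l hx hy
    refine internalSystemAt_of_reduced (hPpos t ht l) (hP' t ht l) (hM' t ht l) (hx' u x₀ t ht l)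
      (hx' v y₀ t ht l) hx hy ?_
    -- `u y - v x` does not depend on the time
    have h1 := (hy.hasDerivAt.const_mul u).sub (hx.hasDerivAt.const_mul v)
    refine h1.unique ((h.hasStrictDerivAt_transCoord l).hasDerivAt.congr_of_eventuallyEq
      (Eventually.of_forall fun l' => ?_))
    simp only [Pi.sub_apply, hfc u x₀ t ht.le, hfc v y₀ t ht.le, transCoord]
    ring
  · intro P₁ I₁ J₁ x₁ y₁ hsys hlim t ht l
    obtain ⟨e1, e2, e3, e4, e5⟩ := InternalSystemAt.unique hϱ hϱ' h hP₀ hk₀ hsys hlim ht l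
    rw [hfc u x₀ t ht.le, hfc v y₀ t ht.le, hPt t ht.le, hkt t ht.le, hKt t ht.le]
    exact ⟨e1, e2, e3, e4, e5⟩
  · intro t ht l
    rw [hint t ht.le]
    exact hKt0 t ht l
  · obtain ⟨S, hS, hSpos, hSneg⟩ := h.exists_contDiff_level hK
    obtain ⟨M, I, J, hgen, hMIJ⟩ := h.exists_isGeneralizedSolution hϱ hϱ' hK hs
    have hcurve' : ∀ t ≥ 0, movedCurve u v x₀ y₀ K t =
        fun l => (frontCoord u x₀ k t l, frontCoord v y₀ k t l) := fun t ht => by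
      funext l
      rw [hfc u x₀ t ht, hfc v y₀ t ht, movedCurve]
    have hK0 : ∀ l, K 0 l = 0 := fun l => by rw [hKt 0 le_rfl, frontDisp_zero]
    refine ⟨S, hS.contDiffOn, fun t ht X => ?_, fun X => ?_, M, I, J, ?_, fun t ht φ hφ => ?_⟩
    · have h1 : S t X = 0 ↔ movedLevel u v x₀ y₀ Φ K t X = 0 := by
        have h2 := hSpos t X
        have h3 := hSneg t X
        constructor <;> intro h4 <;> refine le_antisymm (not_lt.1 fun h5 => ?_)
          (not_lt.1 fun h5 => ?_)
        · exact (h2.2 h5).ne' h4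
        · exact (h3.2 h5).ne h4
        · exact (h2.1 h5).ne' h4
        · exact (h3.1 h5).ne h4
      rw [h1, h.movedLevel_eq_zero_iff, hcurve' t ht]
    · rw [hSneg, hSpos, movedLevel_eq_of_zero hK0]
      exact ⟨Iff.rfl, Iff.rfl⟩
    · have e : P 0 = P₀ := funext hP00
      rw [e] at hgen
      simpa only [hP00, ← hPk0] using hgen
    · have h1 : ∀ (cm cp : ℝ) (Γ : ℝ → ℝ × ℝ) (d : ℝ → ℝ), jumpDelta cm cp (S t) Γ d φ =
          jumpDelta cm cp (movedLevel u v x₀ y₀ Φ K t) Γ d φ := fun cm cp Γ d => by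
        rw [jumpDelta, jumpDelta, jumpField_congr (hSpos t)]
      rw [h1, h1, h1, ← hcurve' t ht.le]
      exact hMIJ t ht φ hφ
  · intro l
    refine (tendsto_frontRatio (ha l) (hb l) (hP₀ l) (hk₀ l) (hc l) (hab l) (hκ l)).congr' ?_
    filter_upwards [eventually_ge_atTop 0] with t ht using (hkt t ht l).symm
  · intro l hl t ht
    rw [hfc u x₀ t ht, hfc v y₀ t ht, hKt t ht, hl,
      frontDisp_of_mass_zero (ha l) (hc l) (hab l) (hκ l) ht]
    constructor <;> ring
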